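/- Let $p,q\ge 1$ be integers and let $x_1,\dots,x_s$ be distinct points of $\mathbb{CP}^1$; put $D=x_1+\dots+x_s$ and let $K$ be the canonical bundle of $\mathbb{CP}^1$. *Definitions.* A parabolic bundle $\mathcal E_\bullet$ is a holomorphic vector bundle $\mathcal E$ on $\mathbb{CP}^1$ with a weighted flag, with weights in $[0,1)$, on the fibre at each $x_j$. The weights at $x_j$, repeated with multiplicity, form its type at $x_j$, and the parabolic degree $\deg\mathcal E_\bullet$ is $\deg\mathcal E$ plus the sum of all weights. Sub-bundles carry the induced weighted flags. A parabolic $\mathrm{SU}(p,q)$ Higgs bundle $(\mathcal U_\bullet\oplus\mathcal V_\bullet,\gamma\oplus\delta)$ of type $(\alpha,\beta)$ consists of parabolic bundles $\mathcal U_\bullet,\mathcal V_\bullet$ of ranks $p,q$ and types $\alpha,\beta$ such that $\det\mathcal U_\bullet\otimes\det\mathcal V_\bullet$ is the trivial line bundle with trivial parabolic structure, and of sections $\gamma\in H^0(K(D)\otimes\mathrm{Hom}(\mathcal U_\bullet,\mathcal V_\bullet))$ and $\delta\in H^0(K(D)\otimes\mathrm{Hom}(\mathcal V_\bullet,\mathcal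 U_\bullet))$, where $\mathrm{Hom}$ denotes strongly parabolic morphisms (at $x_j$, vectors of weight $\ge t$ are mapped to vectors of weight $>t$, for every $t$). It is semistable if $\deg(\mathcal U'_\bullet\oplus\mathcal V'_\bullet)\le 0$ for all holomorphic sub-bundles $\mathcal U'\subset\mathcal U$ and $\mathcal V'\subset\mathcal V$ such that $\mathcal U'\oplus\mathcal V'$ is invariant under $\gamma\oplus\delta$. We write $(\mathcal U_\bullet\oplus\mathcal V_\bullet,\gamma\oplus\delta)\in\mathcal M(\alpha,\beta,d)$ if it is semistable (for instance polystable) of type $(\alpha,\beta)$ and $\deg\mathcal U-\deg\mathcal V=d$. A constant $\mathrm{SU}(p,q)$-multiweight $(\alpha,\beta)$ is given by numbers $\alpha^j,\beta^j\in[0,1)$ with $p\alpha^j+q\beta^j\in\mathbb N$ for $1\le j\le s$: all weights of $\mathcal U_\bullet$ at $x_j$ are $\alpha^j$, and all weights of $\mathcal V_\bullet$ at $x_j$ are $\beta^j$. Put $|\alpha|=\sum_j\alpha^j$, $|\beta|=\sum_j\beta^j$, $\epsilon=|\beta|-|\alpha|$ and $$J_{\alpha,\beta}=\big(q|\beta|-p|\alpha|,\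 q|\beta|-p|\alpha|+2-\epsilon\big).$$ *Statement.* (1) Let $(\alpha,\beta)$ be a constant multiweight with $\alpha^j<\beta^j$ for all $j$ and $\epsilon<2$, and let $d\in J_{\alpha,\beta}$ be an integer. If $(\mathcal U_\bullet\oplus\mathcal V_\bullet,\gamma\oplus\delta)\in\mathcal M(\alpha,\beta,d)$, then $\mathcal V\cong\mathcal O(-a)^{q}$ for some integer $a>0$. (2) Let $a$ be an integer in $\left[\frac{s+p}{p+q},\frac{(p+q-1)s+p}{p+q}\right]$. There is a constant multiweight $(\alpha,\beta)$ such that - (a) $\alpha^j<\beta^j$ for all $j$; - (b) $\epsilon\in\left(\frac{2pq-2p-2q}{2pq-p-q},1\right)$, where for $p=q=1$ the interval is read as $(0,1)$; - (c) $d:=(q-p)a+p\in J_{\alpha,\beta}$; - (n) $p|\alpha|+q|\beta|=(p+q)a-p$. Moreover, for every constant multiweight $(\alpha,\beta)$ satisfying (a), (b), (c) and (n), every $(\mathcal U_\bullet\oplus\mathcal V_\bullet,\gamma\oplus\delta)\in\mathcal M(\alpha,\beta,d)$ has $\mathcal U\cong\mathcal O(-a+1)^{p}$ and $\mathcal V\cong\mathcal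 O(-a)^{q}$. -/

import Mathlib

open scoped Manifold ContDiff Topology
open Set

universe u v

noncomputable section

/-- The Riemann sphere `ℂℙ¹ = ℂ ∪ {∞}`. -/
abbrev RiemannSphere : Type := OnePoint ℂ

namespace RiemannSphere

/-- The affine coordinate `z` (with the junk value `0` at `∞`). -/
def coord (x : RiemannSphere) : ℂ := x.elim 0 id

@[simp] theorem coord_coe (z : ℂ) : coord (z : RiemannSphere) = z := rfl
@[simp] theorem coord_infty : coord (OnePoint.infty : RiemannSphere) = 0 := rfl

/-- The map `z ↦ 1 / z`, exchanging `0` and `∞`. -/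
def invFun (x : RiemannSphere) : RiemannSphere :=
  x.elim ((0 : ℂ) : RiemannSphere) (fun z => if z = 0 then OnePoint.infty else ((z⁻¹ : ℂ) : RiemannSphere))

@[simp] theorem invFun_infty : invFun OnePoint.infty = ((0 : ℂ) : RiemannSphere) := rfl
@[simp] theorem invFun_zero : invFun ((0 : ℂ) : RiemannSphere) = OnePoint.infty := by simp [invFun]
theorem invFun_coe {z : ℂ} (hz : z ≠ 0) :
    invFun (z : RiemannSphere) = ((z⁻¹ : ℂ) : RiemannSphere) := by simp [invFun, hz]

theorem invFun_invFun (x : RiemannSphere) : invFun (invFun x) = x := by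
  induction x using OnePoint.rec with
  | infty => simp
  | coe z =>
    by_cases hz : z = 0
    · subst hz; simp
    · rw [invFun_coe hz, invFun_coe (inv_ne_zero hz), inv_inv]

theorem continuous_invFun : Continuous invFun := by
  rw [continuous_iff_continuousAt]
  intro x
  induction x using OnePoint.rec with
  | infty =>
    rw [OnePoint.continuousAt_infty', Filter.coclosedCompact_eq_cocompact,
      ← Metric.cobounded_eq_cocompact, invFun_infty]
    have h1 : Filter.Tendsto (fun z : ℂ => ((z⁻¹ : ℂ) : RiemannSphere)) (Bornology.cobounded ℂ)
        (𝓝 ((0 : ℂ) : RiemannSphere)) :=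
      (OnePoint.continuous_coe.tendsto 0).comp Filter.tendsto_inv₀_cobounded
    refine h1.congr' ?_
    filter_upwards [Bornology.isBounded_singleton (x := (0 : ℂ))] with z hz
    simp only [Function.comp]
    rw [invFun_coe (by simpa using hz)]
  | coe z =>
    rw [OnePoint.continuousAt_coe]
    by_cases hz : z = 0
    · subst hz
      rw [continuousAt_iff_punctured_nhds]
      have h1 : Filter.Tendsto (fun z : ℂ => ((z⁻¹ : ℂ) : RiemannSphere)) (𝓝[≠] 0)
          (𝓝 (OnePoint.infty : RiemannSphere)) := by
        have := (OnePoint.tendsto_coe_infty (X := ℂ))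
        rw [Filter.coclosedCompact_eq_cocompact, ← Metric.cobounded_eq_cocompact] at this
        exact this.comp Filter.tendsto_inv₀_nhdsNE_zero
      simp only [Function.comp, invFun_zero]
      refine h1.congr' ?_
      filter_upwards [self_mem_nhdsWithin] with z hz
      simp only [Function.comp]
      rw [invFun_coe hz]
    · have h1 : ContinuousAt (fun z : ℂ => ((z⁻¹ : ℂ) : RiemannSphere)) z :=
        OnePoint.continuous_coe.continuousAt.comp (continuousAt_inv₀ hz)
      refine h1.congr ?_
      filter_upwards [isOpen_ne.mem_nhds hz] with w hw
      simp only [Function.comp]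
      rw [invFun_coe hw]

/-- The involution `z ↦ 1 / z` of the sphere. -/
def inversion : RiemannSphere ≃ₜ RiemannSphere where
  toFun := invFun
  invFun := invFun
  left_inv := invFun_invFun
  right_inv := invFun_invFun
  continuous_toFun := continuous_invFun
  continuous_invFun := continuous_invFun

/-- The affine chart `z`, on the complement of `OnePoint.infty`. -/
def chartZero : OpenPartialHomeomorph RiemannSphere ℂ where
  toFun := coord
  invFun := fun z => (z : RiemannSphere)
  source := {OnePoint.infty}ᶜ
  target := univ
  map_source' := fun _ _ => mem_univ _
  map_target' := fun z _ => OnePoint.coe_ne_infty z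
  left_inv' := by
    intro x hx
    induction x using OnePoint.rec with
    | infty => exact absurd rfl hx
    | coe z => rfl
  right_inv' := fun _ _ => rfl
  open_source := isOpen_compl_singleton
  open_target := isOpen_univ
  continuousOn_toFun := by
    intro x hx
    induction x using OnePoint.rec with
    | infty => exact absurd rfl hx
    | coe z =>
      refine ContinuousAt.continuousWithinAt ?_
      rw [OnePoint.continuousAt_coe]
      exact continuousAt_id
  continuousOn_invFun := OnePoint.continuous_coe.continuousOn

/-- The chart `w = 1 / z`, on the complement of `0`. -/
def chartInfty : OpenPartialHomeomorph RiemannSphere ℂ :=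
  inversion.toOpenPartialHomeomorph.trans chartZero

open Classical in
/-- The complex structure: the two charts `z` and `w = 1 / z`. The preferred chart is `z` at the
points of `ℂ` and `w` at `∞`. -/
instance instChartedSpace : ChartedSpace ℂ RiemannSphere where
  atlas := {chartZero, chartInfty}
  chartAt := fun x => if x = OnePoint.infty then chartInfty else chartZero
  mem_chart_source := by
    intro x
    by_cases hx : x = OnePoint.infty
    · subst hx
      simp [chartInfty, chartZero, inversion]
    · simp [hx, chartZero]
  chart_mem_atlas := by
    intro x
    by_cases hx : x = OnePoint.infty <;> simp [hx]

theorem chartInfty_apply (x : RiemannSphere) : chartInfty x = coord (invFun x) := rfl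
theorem chartInfty_symm_apply (z : ℂ) : chartInfty.symm z = invFun (z : RiemannSphere) := rfl

theorem chartInfty_source : chartInfty.source = {((0 : ℂ) : RiemannSphere)}ᶜ := by
  ext x
  have : invFun x = OnePoint.infty ↔ x = ((0 : ℂ) : RiemannSphere) :=
    ⟨fun h => by rw [← invFun_invFun x, h, invFun_infty], fun h => by rw [h, invFun_zero]⟩
  simp [chartInfty, chartZero, inversion, this]

theorem contDiffOn_transition :
    ContDiffOn ℂ ω (fun z : ℂ => coord (invFun (z : RiemannSphere))) {0}ᶜ := by
  have h : ContDiffOn ℂ ω (fun z : ℂ => z⁻¹) {0}ᶜ := contDiffOn_inv ℂ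
  refine h.congr ?_
  intro z hz
  rw [invFun_coe hz, coord_coe]

instance instIsManifold : IsManifold 𝓘(ℂ, ℂ) ω RiemannSphere := by
  refine isManifold_of_contDiffOn _ _ _ ?_
  intro e e' he he'
  have hsub : ∀ z : ℂ, ((z : RiemannSphere) ∈ ({((0 : ℂ) : RiemannSphere)}ᶜ : Set RiemannSphere)) ↔
      z ∈ ({0}ᶜ : Set ℂ) := by
    intro z
    simp only [mem_compl_iff, mem_singleton_iff, OnePoint.coe_eq_coe]
  rcases he with rfl | he <;> rcases he' with rfl | he'
  · exact contDiffOn_id.congr fun z _ => rfl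
  · rw [mem_singleton_iff] at he'
    subst he'
    refine contDiffOn_transition.mono ?_
    intro z hz
    have h1 := hz.1
    simp only [mem_preimage, OpenPartialHomeomorph.trans_source, mem_inter_iff,
      chartInfty_source] at h1
    exact (hsub z).1 h1.2
  · rw [mem_singleton_iff] at he
    subst he
    refine contDiffOn_transition.mono ?_
    intro z hz
    have h1 := hz.1
    simp only [mem_preimage, OpenPartialHomeomorph.trans_source, mem_inter_iff] at h1
    have h2 : invFun (z : RiemannSphere) ≠ OnePoint.infty := h1.2
    intro hz0
    rw [mem_singleton_iff] at hz0
    subst hz0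
    exact h2 invFun_zero
  · rw [mem_singleton_iff] at he he'
    subst he he'
    refine contDiffOn_id.congr ?_
    intro z _
    change coord (invFun (invFun (z : RiemannSphere))) = z
    rw [invFun_invFun, coord_coe]

end RiemannSphere

/-- A holomorphic vector bundle of rank `n` over the Riemann sphere. -/
structure HolBundle (n : ℕ) where
  fiber : RiemannSphere → Type u
  [addCommGroup : ∀ x, AddCommGroup (fiber x)]
  [module : ∀ x, Module ℂ (fiber x)]
  [topology : ∀ x, TopologicalSpace (fiber x)]
  [topologyTotal : TopologicalSpace (Bundle.TotalSpace (Fin n → ℂ) fiber)]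
  [fiberBundle : FiberBundle (Fin n → ℂ) fiber]
  [vectorBundle : VectorBundle ℂ (Fin n → ℂ) fiber]
  [holomorphic : ContMDiffVectorBundle ω (Fin n → ℂ) fiber 𝓘(ℂ, ℂ)]

namespace HolBundle

attribute [instance] addCommGroup module topology topologyTotal fiberBundle vectorBundle
  holomorphic

variable {m n : ℕ}

/-- The (set-theoretic) section `s` of `E` is holomorphic in a neighbourhood of `x`. -/
def SectionHolAt (E : HolBundle.{u} n) (s : ∀ y, E.fiber y) (x : RiemannSphere) : Prop :=
  ContMDiffAt 𝓘(ℂ, ℂ) (𝓘(ℂ, ℂ).prod 𝓘(ℂ, Fin n → ℂ)) ω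
    (fun y => Bundle.TotalSpace.mk' (Fin n → ℂ) y (s y)) x

/-- The bundle map `A : E → F` (over the identity) is holomorphic in a neighbourhood of `x`: it maps
local holomorphic sections to local holomorphic sections. -/
def HomHolAt (E : HolBundle.{u} m) (F : HolBundle.{v} n) (A : ∀ y, E.fiber y →ₗ[ℂ] F.fiber y)
    (x : RiemannSphere) : Prop :=
  ∀ s : ∀ y, E.fiber y, E.SectionHolAt s x → F.SectionHolAt (fun y => A y (s y)) x

/-- Isomorphism of holomorphic vector bundles. -/
def IsIsomorphic (E : HolBundle.{u} m) (F : HolBundle.{v} n) : Prop :=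
  ∃ e : ∀ y, E.fiber y ≃ₗ[ℂ] F.fiber y,
    (∀ x, HomHolAt E F (fun y => (e y).toLinearMap) x) ∧
    (∀ x, HomHolAt F E (fun y => (e y).symm.toLinearMap) x)

open RiemannSphere

/-- Numbering of the two charts: `false` is `z`, `true` is `w`. -/
def chartIndex : Bool → ℤ
  | false => 0
  | true => 1

theorem coord_ne_zero {x : RiemannSphere} (h0 : x ∈ chartZero.source)
    (h1 : x ∈ chartInfty.source) : coord x ≠ 0 := by
  rw [chartInfty_source] at h1
  induction x using OnePoint.rec with
  | infty => exact absurd rfl h0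
  | coe z => exact fun h => h1 (congrArg _ h)

theorem contMDiffOn_coord : ContMDiffOn 𝓘(ℂ, ℂ) 𝓘(ℂ, ℂ) ω coord chartZero.source :=
  contMDiffOn_of_mem_maximalAtlas (e := chartZero)
    (IsManifold.subset_maximalAtlas (by left; rfl))

/-- The diagonal endomorphism of `ℂⁿ` with entries `z ^ (c * d k)`. -/
def diagPow (d : Fin n → ℤ) (c : ℤ) (z : ℂ) : (Fin n → ℂ) →L[ℂ] (Fin n → ℂ) :=
  ContinuousLinearMap.pi fun k => (z ^ (c * d k)) • ContinuousLinearMap.proj k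

theorem diagPow_apply (d : Fin n → ℤ) (c : ℤ) (z : ℂ) (v : Fin n → ℂ) (k : Fin n) :
    diagPow d c z v k = z ^ (c * d k) * v k := rfl

theorem contDiffOn_diagPow (d : Fin n → ℤ) (c : ℤ) :
    ContDiffOn ℂ ω (diagPow d c) {0}ᶜ := by
  have h : diagPow d c = fun z => ∑ k, (z ^ (c * d k)) •
      ((ContinuousLinearMap.single ℂ (fun _ : Fin n => ℂ) k).comp
        (ContinuousLinearMap.proj k : (Fin n → ℂ) →L[ℂ] ℂ)) := by
    funext z
    ext v k
    simp [diagPow, Finset.sum_apply, Pi.single_apply]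
  rw [h]
  refine ContDiffOn.sum fun k _ => ?_
  have h1 : ContDiffOn ℂ ω (fun z : ℂ => z ^ (c * d k)) {0}ᶜ := fun z hz =>
    (analyticAt_id.zpow hz).contDiffAt.contDiffWithinAt
  exact h1.smul contDiffOn_const

theorem contMDiffOn_diagPow (d : Fin n → ℤ) (i j : Bool) :
    ContMDiffOn 𝓘(ℂ, ℂ) 𝓘(ℂ, (Fin n → ℂ) →L[ℂ] (Fin n → ℂ)) ω
      (fun x => diagPow d (chartIndex i - chartIndex j) (coord x))
      ((bif i then chartInfty.source else chartZero.source) ∩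
        (bif j then chartInfty.source else chartZero.source)) := by
  by_cases hij : i = j
  · subst hij
    have h : (fun x => diagPow d (chartIndex i - chartIndex i) (coord x)) =
        fun _ => diagPow d 0 1 := by
      funext x
      ext v k
      simp [diagPow_apply]
    rw [h]
    exact contMDiffOn_const
  · have hs : ((bif i then chartInfty.source else chartZero.source) ∩
        (bif j then chartInfty.source else chartZero.source)) ⊆
        chartZero.source ∩ chartInfty.source := by
      cases i <;> cases j <;> simp_all [Set.inter_comm]
    refine ((contDiffOn_diagPow d _).contMDiffOn.comp
      (contMDiffOn_coord.mono (hs.trans Set.inter_subset_left)) ?_)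
    intro x hx
    exact coord_ne_zero (hs hx).1 (hs hx).2

/-- The gluing data of `𝒪(d₁) ⊕ ⋯ ⊕ 𝒪(dₙ)`: the coordinates `f` over the chart `z` and `g` over the
chart `w = 1 / z` are related by `g k = z ^ (-d k) * f k`. -/
def splitCore (d : Fin n → ℤ) : VectorBundleCore ℂ RiemannSphere (Fin n → ℂ) Bool where
  baseSet i := bif i then chartInfty.source else chartZero.source
  isOpen_baseSet i := by cases i <;> exact OpenPartialHomeomorph.open_source _
  indexAt := open Classical in fun x => decide (x = OnePoint.infty)
  mem_baseSet_at := by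
    intro x
    by_cases hx : x = OnePoint.infty
    · simp [hx, chartInfty_source]
    · simp [hx, chartZero]
  coordChange i j x := diagPow d (chartIndex i - chartIndex j) (coord x)
  coordChange_self := by
    intro i x _ v
    ext k
    simp [diagPow_apply]
  continuousOn_coordChange i j := (contMDiffOn_diagPow d i j).continuousOn
  coordChange_comp := by
    intro i j k x hx v
    ext l
    simp only [diagPow_apply]
    rw [← mul_assoc]
    congr 1
    by_cases hij : i = j
    · subst hij; simp
    by_cases hjk : j = k
    · subst hjk; simp
    have h0 : coord x ≠ 0 := by
      obtain ⟨⟨h1, h2⟩, -⟩ := hx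
      cases i <;> cases j <;>
        first
        | exact absurd rfl hij
        | exact coord_ne_zero h1 h2
        | exact coord_ne_zero h2 h1
    rw [← zpow_add₀ h0]
    congr 1
    ring

instance splitCore_isContMDiff (d : Fin n → ℤ) :
    (splitCore d).IsContMDiff 𝓘(ℂ, ℂ) ω where
  contMDiffOn_coordChange i j := contMDiffOn_diagPow d i j

/-- The holomorphic vector bundle `𝒪(d₁) ⊕ ⋯ ⊕ 𝒪(dₙ)` over the Riemann sphere. -/
def split (d : Fin n → ℤ) : HolBundle.{0} n where
  fiber := (splitCore d).Fiber

/-- `f` is a holomorphic frame, near `x`, of the family of subspaces `L` of the fibres of `E`. -/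
structure IsFrameAt (E : HolBundle.{u} n) (L : ∀ y, Submodule ℂ (E.fiber y)) {r : ℕ}
    (f : Fin r → ∀ y, E.fiber y) (x : RiemannSphere) : Prop where
  hol : ∀ i, E.SectionHolAt (f i) x
  linearIndependent : ∀ᶠ y in 𝓝 x, LinearIndependent ℂ fun i => f i y
  span_eq : ∀ᶠ y in 𝓝 x, Submodule.span ℂ (Set.range fun i => f i y) = L y

/-- A holomorphic sub-bundle of rank `r`: a family of subspaces of the fibres that has, near each
point, a holomorphic frame (linearly independent at every point). -/
structure Subbundle (E : HolBundle.{u} n) (r : ℕ) where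
  toSubmodule : ∀ y, Submodule ℂ (E.fiber y)
  exists_frame : ∀ x, ∃ f : Fin r → ∀ y, E.fiber y, E.IsFrameAt toSubmodule f x

/-- The function `g` is meromorphic at `x`. -/
def MerAt (g : RiemannSphere → ℂ) (x : RiemannSphere) : Prop :=
  MeromorphicAt (g ∘ (chartAt ℂ x).symm) (chartAt ℂ x x)

/-- The order of vanishing at `x` of a meromorphic function (`⊤` if it vanishes near `x`). -/
def orderAt (g : RiemannSphere → ℂ) (x : RiemannSphere) : WithTop ℤ :=
  meromorphicOrderAt (g ∘ (chartAt ℂ x).symm) (chartAt ℂ x x)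

/-- The sections `s 0, …, s (r - 1)` of `L` are meromorphic at `x`, and the meromorphic section
`s 0 ∧ ⋯ ∧ s (r - 1)` of `det L` has order `k` at `x` (in particular it does not vanish
identically): in a local holomorphic frame `f` of `L` their coefficients form a meromorphic matrix
whose determinant has order `k`. -/
def HasDetOrderAt (E : HolBundle.{u} n) (L : ∀ y, Submodule ℂ (E.fiber y)) {r : ℕ}
    (s : Fin r → ∀ y, E.fiber y) (x : RiemannSphere) (k : ℤ) : Prop :=
  ∃ (f : Fin r → ∀ y, E.fiber y) (M : RiemannSphere → Matrix (Fin r) (Fin r) ℂ),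
    E.IsFrameAt L f x ∧ (∀ i j, MerAt (fun y => M y i j) x) ∧
    (∀ᶠ y in 𝓝[≠] x, ∀ i, s i y = ∑ j, M y i j • f j y) ∧
    orderAt (fun y => (M y).det) x = k

/-- `D` is the divisor of a nonzero meromorphic section `s 0 ∧ ⋯ ∧ s (r - 1)` of the determinant line
bundle of `L`, a sub-bundle of rank `r`. -/
def IsDetDivisor (E : HolBundle.{u} n) (L : ∀ y, Submodule ℂ (E.fiber y)) (r : ℕ)
    (D : RiemannSphere →₀ ℤ) : Prop :=
  ∃ s : Fin r → ∀ y, E.fiber y, ∀ x, E.HasDetOrderAt L s x (D x)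

open Classical in
/-- The degree of a sub-bundle `L` of rank `r`: the degree of the line bundle `det L`, i.e. the number
of zeros minus the number of poles of a nonzero meromorphic section of it. -/
def subDegree (E : HolBundle.{u} n) (L : ∀ y, Submodule ℂ (E.fiber y)) (r : ℕ) : ℤ :=
  if h : ∃ D, E.IsDetDivisor L r D then h.choose.sum fun _ k => k else 0

/-- The degree of a holomorphic vector bundle. -/
def degree (E : HolBundle.{u} n) : ℤ := E.subDegree (fun _ => ⊤) n

end HolBundle

/-- A weighted flag on a vector space `W`, written as a decreasing left-continuous filtration indexed
by the weights: `filt t` is the space of vectors of weight at least `t`, and all weights lie in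
`[0, 1)`. A parabolic structure on a bundle at a point is a weighted flag on the fibre. -/
structure WeightedFlag (W : Type u) [AddCommGroup W] [Module ℂ W] where
  filt : ℝ → Submodule ℂ W
  antitone : Antitone filt
  left_cont : ∀ t, ∃ ε > 0, filt (t - ε) = filt t
  filt_zero : filt 0 = ⊤
  filt_one : filt 1 = ⊥

namespace WeightedFlag
variable {W : Type u} [AddCommGroup W] [Module ℂ W]

/-- The vectors of weight greater than `t`. -/
def above (F : WeightedFlag W) (t : ℝ) : Submodule ℂ W := ⨆ t' : Set.Ioi t, F.filt t'

/-- The weights, repeated with multiplicity, are `w 0, …, w (n - 1)`. -/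
def HasType (F : WeightedFlag W) {n : ℕ} (w : Fin n → ℝ) : Prop :=
  ∀ t, Module.finrank ℂ (F.filt t) = Nat.card {i // t ≤ w i}

/-- The sum, with multiplicity, of the weights of the flag induced on the subspace `L`: the weight `t`
has multiplicity `dim (F_t ∩ L) - dim (F_{>t} ∩ L)`. -/
def weight (F : WeightedFlag W) (L : Submodule ℂ W) : ℝ :=
  ∑ᶠ t : ℝ, t * ((Module.finrank ℂ (F.filt t ⊓ L : Submodule ℂ W) : ℝ)
    - Module.finrank ℂ (F.above t ⊓ L : Submodule ℂ W))

end WeightedFlag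

/-- The differential at `y` of the preferred coordinate centred at `x`, as a linear form on the
tangent space at `y`. -/
def dCoord (x y : RiemannSphere) (v : TangentSpace 𝓘(ℂ, ℂ) y) : ℂ :=
  NormedSpace.fromTangentSpace _ (mfderiv 𝓘(ℂ, ℂ) 𝓘(ℂ, ℂ) (chartAt ℂ x) y v)

/-- `φ` is a holomorphic section of `K(D) ⊗ Hom(E_•, F_•)`, where `D` is the sum of the points `pt j`
and `Hom(E_•, F_•)` is the bundle of (strongly) parabolic morphisms: a `Hom(E, F)`-valued `1`-form,
equal to `A dz` with `A` holomorphic near each point outside `D`, and to `A dz / z` near each point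
of `D` (where `z` is a coordinate centred at the point), the residue `A` at the point mapping vectors
of weight at least `t` to vectors of weight greater than `t`. The value of `φ` at the points of `D`
itself plays no role. -/
structure IsParabolicLogForm {m n s : ℕ} (pt : Fin s → RiemannSphere)
    (E : HolBundle.{u} m) (F : HolBundle.{v} n)
    (parE : ∀ j, WeightedFlag (E.fiber (pt j))) (parF : ∀ j, WeightedFlag (F.fiber (pt j)))
    (φ : ∀ y, TangentSpace 𝓘(ℂ, ℂ) y →ₗ[ℂ] E.fiber y →ₗ[ℂ] F.fiber y) : Prop where
  holomorphic : ∀ x, x ∉ Set.range pt → ∃ A : ∀ y, E.fiber y →ₗ[ℂ] F.fiber y,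
    E.HomHolAt F A x ∧ ∀ᶠ y in 𝓝 x, ∀ v, φ y v = dCoord x y v • A y
  residue : ∀ j, ∃ A : ∀ y, E.fiber y →ₗ[ℂ] F.fiber y,
    E.HomHolAt F A (pt j) ∧
    (∀ᶠ y in 𝓝[≠] (pt j), ∀ v, φ y v =
      (dCoord (pt j) y v / (chartAt ℂ (pt j) y - chartAt ℂ (pt j) (pt j))) • A y) ∧
    ∀ t, (parE j).filt t ≤ ((parF j).above t).comap (A (pt j))

/-- The data `(U_• ⊕ V_•, γ ⊕ δ)` of a parabolic `SU(p,q)` Higgs bundle over the sphere punctured at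
the points `pt j` (the condition on the determinant is `ParabolicHiggs.HasTrivialDet`). -/
structure ParabolicHiggs {s : ℕ} (p q : ℕ) (pt : Fin s → RiemannSphere) where
  U : HolBundle.{u} p
  V : HolBundle.{u} q
  parU : ∀ j, WeightedFlag (U.fiber (pt j))
  parV : ∀ j, WeightedFlag (V.fiber (pt j))
  γ : ∀ y, TangentSpace 𝓘(ℂ, ℂ) y →ₗ[ℂ] U.fiber y →ₗ[ℂ] V.fiber y
  δ : ∀ y, TangentSpace 𝓘(ℂ, ℂ) y →ₗ[ℂ] V.fiber y →ₗ[ℂ] U.fiber y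
  isParabolicLogForm_γ : IsParabolicLogForm pt U V parU parV γ
  isParabolicLogForm_δ : IsParabolicLogForm pt V U parV parU δ

namespace ParabolicHiggs

variable {s p q : ℕ} {pt : Fin s → RiemannSphere}

/-- The parabolic types of `U_•` and `V_•` are `α` and `β`. -/
def HasType (H : ParabolicHiggs.{u} p q pt) (α : Fin s → Fin p → ℝ) (β : Fin s → Fin q → ℝ) :
    Prop :=
  ∀ j, (H.parU j).HasType (α j) ∧ (H.parV j).HasType (β j)

open Classical in
/-- For a Higgs bundle of type `(α, β)`: `det U_• ⊗ det V_•` has trivial parabolic structure and is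
isomorphic to `𝒪`. The weight of this parabolic line bundle at `pt j` is the sum `k j` of all `α j i`
and `β j i`; so this says that the `k j` are integers and that the line bundle
`det U ⊗ det V ⊗ 𝒪(∑ k j • pt j)` has a nowhere vanishing holomorphic section, i.e. that
`det U ⊗ det V` has a meromorphic section with divisor `-∑ k j • pt j`. -/
def HasTrivialDet (H : ParabolicHiggs.{u} p q pt) (α : Fin s → Fin p → ℝ)
    (β : Fin s → Fin q → ℝ) : Prop :=
  ∃ D₁ D₂ : RiemannSphere →₀ ℤ,
    H.U.IsDetDivisor (fun _ => ⊤) p D₁ ∧ H.V.IsDetDivisor (fun _ => ⊤) q D₂ ∧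
    (∀ j, ∃ k : ℤ, ∑ i, α j i + ∑ i, β j i = k) ∧
    ∀ x, ((D₁ x + D₂ x : ℤ) : ℝ) =
      -∑ j, if pt j = x then ∑ i, α j i + ∑ i, β j i else 0

/-- The sub-bundle `U' ⊕ V'` is invariant under `γ ⊕ δ`. -/
def IsInvariant (H : ParabolicHiggs.{u} p q pt) {m n : ℕ} (U' : H.U.Subbundle m)
    (V' : H.V.Subbundle n) : Prop :=
  ∀ y, y ∉ Set.range pt → ∀ v : TangentSpace 𝓘(ℂ, ℂ) y,
    U'.toSubmodule y ≤ (V'.toSubmodule y).comap (H.γ y v) ∧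
    V'.toSubmodule y ≤ (U'.toSubmodule y).comap (H.δ y v)

/-- The parabolic degree of the sub-bundle `U' ⊕ V'`, with the induced parabolic structure. -/
def parDegree (H : ParabolicHiggs.{u} p q pt) {m n : ℕ} (U' : H.U.Subbundle m)
    (V' : H.V.Subbundle n) : ℝ :=
  H.U.subDegree U'.toSubmodule m + H.V.subDegree V'.toSubmodule n +
    ∑ j, ((H.parU j).weight (U'.toSubmodule (pt j)) + (H.parV j).weight (V'.toSubmodule (pt j)))

/-- Semistability. -/
def IsSemistable (H : ParabolicHiggs.{u} p q pt) : Prop :=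
  ∀ (m n : ℕ) (U' : H.U.Subbundle m) (V' : H.V.Subbundle n),
    H.IsInvariant U' V' → H.parDegree U' V' ≤ 0

/-- `H` is a semistable parabolic `SU(p,q)` Higgs bundle of type `(α, β)` with
`deg U - deg V = d`. The moduli space `ℳ(α, β, d)` parametrizes these objects; each of its points is
the class of a polystable (hence semistable) one. -/
structure RepresentsPointOfModuli (H : ParabolicHiggs.{u} p q pt) (α : Fin s → Fin p → ℝ)
    (β : Fin s → Fin q → ℝ) (d : ℤ) : Prop where
  hasType : H.HasType α β
  hasTrivialDet : H.HasTrivialDet α β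
  isSemistable : H.IsSemistable
  degree_sub : H.U.degree - H.V.degree = d

end ParabolicHiggs

/-- The `SU(p,q)`-multiweights at `s` points. -/
structure IsMultiweight {s p q : ℕ} (α : Fin s → Fin p → ℝ) (β : Fin s → Fin q → ℝ) : Prop where
  mem_left : ∀ j i, α j i ∈ Set.Ico (0 : ℝ) 1
  mem_right : ∀ j i, β j i ∈ Set.Ico (0 : ℝ) 1
  monotone_left : ∀ j, Monotone (α j)
  monotone_right : ∀ j, Monotone (β j)
  sum_mem : ∀ j, ∃ k : ℕ, ∑ i, α j i + ∑ i, β j i = k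

/-- The system of weights that are all equal to `a j` at the `j`-th point. -/
def constWeight {s : ℕ} (n : ℕ) (a : Fin s → ℝ) : Fin s → Fin n → ℝ := fun j _ => a j

/-- `‖α‖`, the sum of all weights. -/
def weightNorm {s n : ℕ} (α : Fin s → Fin n → ℝ) : ℝ := ∑ j, ∑ i, α j i

/-- For constant weights, `ε = |β| - |α|`. -/
def weightGap {s : ℕ} (α β : Fin s → ℝ) : ℝ := ∑ j, β j - ∑ j, α j

/-- The interval `J = (‖β‖ - ‖α‖, ‖β‖ - ‖α‖ + 2 - ε)` for the constant multiweight `(α, β)`. -/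
def intervalJ {s : ℕ} (p q : ℕ) (α β : Fin s → ℝ) : Set ℝ :=
  Set.Ioo (weightNorm (constWeight q β) - weightNorm (constWeight p α))
    (weightNorm (constWeight q β) - weightNorm (constWeight p α) + 2 - weightGap α β)

/-- `(α, β)` is a constant `SU(p,q)`-multiweight with `α j < β j`, with `ε` in
`((2pq - 2p - 2q) / (2pq - p - q), 1)` (for `p = q = 1` the lower end is read as `0`), with
`(q - p) a + p ∈ J`, and with `‖α‖ + ‖β‖ = (p + q) a - p`. -/
structure IsAdapted {s : ℕ} (p q : ℕ) (a : ℤ) (α β : Fin s → ℝ) : Prop where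
  isMultiweight : IsMultiweight (constWeight p α) (constWeight q β)
  lt : ∀ j, α j < β j
  gap_mem : weightGap α β ∈
    Set.Ioo ((2 * p * q - 2 * p - 2 * q : ℝ) / (2 * p * q - p - q)) 1
  mem_intervalJ : ((((q : ℤ) - p) * a + p : ℤ) : ℝ) ∈ intervalJ p q α β
  norm_add_norm : weightNorm (constWeight p α) + weightNorm (constWeight q β) = (p + q) * a - p

end

/-! The heart of the matter is that `δ` vanishes. All weights of `V` at `x_j` are `β^j`, so the
residue of `δ` must map the fibre of `V` to vectors of `U` of weight greater than `β^j > α^j`, and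
there are none: `δ` has no poles and is a morphism `V → U ⊗ K` with `K = 𝒪(-2)`. Let `N` be its
kernel and `I` its saturated image, of rank `r`; then `deg V ≤ deg N + deg I - 2r`. Both `0 ⊕ N` and
`I ⊕ V` are invariant. Adding the two semistability inequalities and using the values of `deg U +
deg V` and `deg U - deg V` gives `r (2 - ε) ≤ d - (q|β| - p|α|)`. The right side is less than `2 -
ε` for `d` in `J`, so `r = 0` (`ParabolicHiggs.δ_eq_zero`).

Once `δ = 0`, every sub-bundle of `V` is invariant, and so is `L ⊕ V` for every `L` in `U`. Split
`V` as a sum of `𝒪(v_i)`. Semistability gives `v_i + |β| ≤ 0`, while `d` in `J` says that the sum of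
these numbers lies in `(-1 + ε/2, 0)`. Integers `v_i` that differ would push the sum to `-1` or
below, so they all coincide; they are negative because the sum is
(`eq_of_nonpos_of_neg_one_lt_sum`).

In the second part, the prescribed `d` and norm force `deg V = -qa` and `deg U = p(1 - a)`. A
summand `𝒪(u)` of `U` with `u ≥ 2 - a` would violate semistability of `𝒪(u) ⊕ V`: this would require
`p + q ≤ (p - 1) q (1 - ε)`, which the lower bound on `ε` excludes. So every `u ≤ 1 - a`, with
equality by the total degree. The multiweights are constructed by choosing integers `k_j = pα^j +
qβ^j` of sum `(p + q)a - p` and then distributing a gap `ε` close enough to `1` over the points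
(`exists_isAdapted`).

The geometric input is the Birkhoff–Grothendieck splitting, obtained by hand. For a bundle with a
meromorphic section of its determinant, consider sections holomorphic on `ℂ` and of order at least
`e` at `∞`. Liouville's theorem bounds `e`, so the leading coefficients at `∞` form a finite
decreasing filtration of one fibre. Lifting an adapted basis of it gives a split frame: a zero of a
combination at a finite point could be divided out, which would raise its order at `∞` without
changing its leading coefficient (`HolBundle.exists_isSplitFrame`). The same theorem, applied to
sections lying generically in a kernel or an image, produces `N` and `I`. The degree inequality is
rank-nullity on these section spaces as `e → -∞` (`HolBundle.exists_ker_range_splitFrame`). -/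

/-! ### Holomorphic functions near a point of the sphere. -/

namespace RiemannSphere

/-- The inverse of the preferred chart at `x`, as a map `ℂ → ℂℙ¹`. -/
noncomputable def loc (x : RiemannSphere) (z : ℂ) : RiemannSphere := (chartAt ℂ x).symm z

/-- The position of `x` in the preferred chart at `x`. -/
noncomputable def pos (x : RiemannSphere) : ℂ := chartAt ℂ x x

theorem chartAt_coe (z : ℂ) : chartAt ℂ (z : RiemannSphere) = chartZero := by
  classical
  exact if_neg (OnePoint.coe_ne_infty z)

theorem chartAt_infty : chartAt ℂ (OnePoint.infty : RiemannSphere) = chartInfty := by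
  classical
  exact if_pos rfl

theorem loc_coe (z w : ℂ) : loc (z : RiemannSphere) w = (w : RiemannSphere) := by
  rw [loc, chartAt_coe]; rfl

theorem loc_infty (w : ℂ) : loc OnePoint.infty w = invFun (w : RiemannSphere) := by
  rw [loc, chartAt_infty]; rfl

@[simp] theorem pos_coe (z : ℂ) : pos (z : RiemannSphere) = z := by
  rw [pos, chartAt_coe]; rfl

@[simp] theorem pos_infty : pos OnePoint.infty = 0 := by
  rw [pos, chartAt_infty]; rfl

theorem chartAt_target (x : RiemannSphere) : (chartAt ℂ x).target = univ := by
  induction x using OnePoint.rec with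
  | infty =>
    rw [chartAt_infty]
    simp [chartInfty, chartZero, inversion]
  | coe z => rw [chartAt_coe]; rfl

theorem loc_pos (x : RiemannSphere) : loc x (pos x) = x :=
  (chartAt ℂ x).left_inv (mem_chart_source ℂ x)

theorem chartAt_loc (x : RiemannSphere) (z : ℂ) : chartAt ℂ x (loc x z) = z :=
  (chartAt ℂ x).right_inv (by rw [chartAt_target]; trivial)

theorem loc_injective (x : RiemannSphere) : Function.Injective (loc x) :=
  Function.LeftInverse.injective (chartAt_loc x)

theorem loc_eq_iff {x : RiemannSphere} {z : ℂ} : loc x z = x ↔ z = pos x :=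
  ⟨fun h => loc_injective x (h.trans (loc_pos x).symm), fun h => h ▸ loc_pos x⟩

theorem map_loc_nhds (x : RiemannSphere) : Filter.map (loc x) (𝓝 (pos x)) = 𝓝 x := by
  have := (chartAt ℂ x).symm.map_nhds_eq (x := pos x) (by
    simp [chartAt_target])
  rw [show (chartAt ℂ x).symm (pos x) = x from loc_pos x] at this
  exact this

theorem eventually_nhds_iff {x : RiemannSphere} {P : RiemannSphere → Prop} :
    (∀ᶠ y in 𝓝 x, P y) ↔ ∀ᶠ z in 𝓝 (pos x), P (loc x z) := by
  rw [← map_loc_nhds]; rfl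

theorem eventually_nhdsNE_iff {x : RiemannSphere} {P : RiemannSphere → Prop} :
    (∀ᶠ y in 𝓝[≠] x, P y) ↔ ∀ᶠ z in 𝓝[≠] (pos x), P (loc x z) := by
  rw [eventually_nhdsWithin_iff, eventually_nhdsWithin_iff, eventually_nhds_iff]
  simp only [mem_compl_iff, mem_singleton_iff, loc_eq_iff]

instance nhdsNE_neBot (x : RiemannSphere) : (𝓝[≠] x).NeBot := by
  refine ⟨fun h => ?_⟩
  have h1 : ∀ᶠ y in 𝓝[≠] x, False := by rw [h]; trivial
  rw [eventually_nhdsNE_iff] at h1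
  exact h1.exists.elim fun _ h => h

/-- Holomorphy at a point of a function on the Riemann sphere. -/
def HolAt {F : Type*} [NormedAddCommGroup F] [NormedSpace ℂ F] (g : RiemannSphere → F)
    (x : RiemannSphere) : Prop :=
  ContMDiffAt 𝓘(ℂ, ℂ) 𝓘(ℂ, F) ω g x

section HolAt

variable {F : Type*} [NormedAddCommGroup F] [NormedSpace ℂ F]

theorem holAt_iff [CompleteSpace F] {g : RiemannSphere → F} {x : RiemannSphere} :
    HolAt g x ↔ AnalyticAt ℂ (fun z => g (loc x z)) (pos x) := by
  rw [HolAt, contMDiffAt_iff_source]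
  simp only [mfld_simps, range_id, contMDiffWithinAt_univ, contMDiffAt_iff_contDiffAt]
  rw [ContDiffAt, contDiffWithinAt_omega_iff_analyticWithinAt, analyticWithinAt_univ]
  rfl

theorem HolAt.eventually {g : RiemannSphere → F} {x : RiemannSphere} (h : HolAt g x) :
    ∀ᶠ y in 𝓝 x, HolAt g y :=
  (contMDiffAt_iff_contMDiffAt_nhds (by simp)).1 h

theorem HolAt.congr {g g' : RiemannSphere → F} {x : RiemannSphere} (h : HolAt g x)
    (h' : ∀ᶠ y in 𝓝 x, g' y = g y) : HolAt g' x :=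
  ContMDiffAt.congr_of_eventuallyEq h h'

theorem HolAt.continuousAt {g : RiemannSphere → F} {x : RiemannSphere} (h : HolAt g x) :
    ContinuousAt g x :=
  ContMDiffAt.continuousAt h

theorem holAt_const (c : F) (x : RiemannSphere) : HolAt (fun _ => c) x := contMDiffAt_const

theorem HolAt.smul {c : RiemannSphere → ℂ} {g : RiemannSphere → F} {x : RiemannSphere}
    (hc : HolAt c x) (h : HolAt g x) : HolAt (fun y => c y • g y) x :=
  ContMDiffAt.smul hc h

theorem HolAt.add {g g' : RiemannSphere → F} {x : RiemannSphere}
    (h : HolAt g x) (h' : HolAt g' x) : HolAt (fun y => g y + g' y) x :=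
  ContMDiffAt.add h h'

theorem HolAt.mul {g g' : RiemannSphere → ℂ} {x : RiemannSphere}
    (h : HolAt g x) (h' : HolAt g' x) : HolAt (fun y => g y * g' y) x :=
  h.smul h'

theorem HolAt.sum {ι : Type*} {s : Finset ι} {g : ι → RiemannSphere → F} {x : RiemannSphere}
    (h : ∀ i ∈ s, HolAt (g i) x) : HolAt (fun y => ∑ i ∈ s, g i y) x := by
  classical
  induction s using Finset.induction_on with
  | empty => simpa using holAt_const 0 x
  | insert a s ha ih =>
    simp only [Finset.sum_insert ha]
    exact (h a (by simp)).add (ih fun i hi => h i (by simp [hi]))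

theorem HolAt.prod {ι : Type*} {s : Finset ι} {g : ι → RiemannSphere → ℂ} {x : RiemannSphere}
    (h : ∀ i ∈ s, HolAt (g i) x) : HolAt (fun y => ∏ i ∈ s, g i y) x := by
  classical
  induction s using Finset.induction_on with
  | empty => simpa using holAt_const 1 x
  | insert a s ha ih =>
    simp only [Finset.prod_insert ha]
    exact (h a (by simp)).mul (ih fun i hi => h i (by simp [hi]))

theorem HolAt.inv {g : RiemannSphere → ℂ} {x : RiemannSphere}
    (h : HolAt g x) (h0 : g x ≠ 0) : HolAt (fun y => (g y)⁻¹) x := by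
  rw [holAt_iff] at h ⊢
  exact h.inv (by rwa [loc_pos])

theorem holAt_pi {ι : Type*} [Fintype ι] {g : RiemannSphere → ι → ℂ} {x : RiemannSphere} :
    HolAt g x ↔ ∀ i, HolAt (fun y => g y i) x :=
  contMDiffAt_pi_space

theorem HolAt.det {n : ℕ} {M : RiemannSphere → Matrix (Fin n) (Fin n) ℂ} {x : RiemannSphere}
    (h : ∀ i j, HolAt (fun y => M y i j) x) : HolAt (fun y => (M y).det) x := by
  simp only [Matrix.det_apply']
  exact HolAt.sum fun σ _ => (holAt_const _ x).mul (HolAt.prod fun i _ => h _ _)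

theorem HolAt.adjugate {n : ℕ} {M : RiemannSphere → Matrix (Fin n) (Fin n) ℂ} {x : RiemannSphere}
    (h : ∀ i j, HolAt (fun y => M y i j) x) (i j : Fin n) :
    HolAt (fun y => (M y).adjugate i j) x := by
  simp only [Matrix.adjugate_apply]
  refine HolAt.det fun k l => ?_
  by_cases hk : k = j
  · subst hk; simpa using holAt_const _ x
  · simpa [Matrix.updateRow_ne hk] using h k l

theorem HolAt.matrix_inv {n : ℕ} {M : RiemannSphere → Matrix (Fin n) (Fin n) ℂ}
    {x : RiemannSphere} (h : ∀ i j, HolAt (fun y => M y i j) x) (h0 : (M x).det ≠ 0)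
    (i j : Fin n) : HolAt (fun y => (M y)⁻¹ i j) x := by
  have : (fun y => (M y)⁻¹ i j) = fun y => ((M y).det)⁻¹ * (M y).adjugate i j := by
    funext y
    rw [Matrix.inv_def]
    simp
  rw [this]
  exact ((HolAt.det h).inv h0).mul (HolAt.adjugate h i j)

/-- The coordinate `z` is holomorphic on `ℂ`. -/
theorem holAt_coord (z : ℂ) : HolAt coord (z : RiemannSphere) := by
  rw [holAt_iff]
  simp only [loc_coe, coord_coe]
  exact analyticAt_id

theorem HolAt.eq_zero_of_nhdsNE {g : RiemannSphere → F} {x : RiemannSphere} (h : HolAt g x)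
    (h0 : ∀ᶠ y in 𝓝[≠] x, g y = 0) : g x = 0 := by
  have h1 : Filter.Tendsto g (𝓝[≠] x) (𝓝 (g x)) := h.continuousAt.mono_left nhdsWithin_le_nhds
  exact tendsto_nhds_unique (h1.congr' h0) tendsto_const_nhds

/-- A function vanishing at a point is divisible by the local coordinate. -/
theorem HolAt.exists_div [CompleteSpace F] {g : RiemannSphere → F} {x : RiemannSphere}
    (h : HolAt g x) (h0 : g x = 0) :
    ∃ g', HolAt g' x ∧ ∀ᶠ y in 𝓝 x, g y = (chartAt ℂ x y - pos x) • g' y := by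
  rw [holAt_iff] at h
  have h1 : (1 : ℕ) ≤ analyticOrderAt (fun z => g (loc x z)) (pos x) := by
    rw [Nat.cast_one, Order.one_le_iff_ne_zero, analyticOrderAt_ne_zero]
    exact ⟨h, by rwa [loc_pos]⟩
  obtain ⟨k, hk, hk'⟩ := (natCast_le_analyticOrderAt h).1 h1
  refine ⟨fun y => k (chartAt ℂ x y), ?_, ?_⟩
  · rw [holAt_iff]
    simpa only [chartAt_loc] using hk
  · rw [eventually_nhds_iff]
    filter_upwards [hk'] with z hz
    rw [hz, chartAt_loc, pow_one]

end HolAt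

end RiemannSphere

/-! ### Local holomorphic sections and frames. -/

namespace HolBundle

open RiemannSphere

variable {m n r : ℕ}

theorem exists_local_equiv (E : HolBundle.{u} n) (x : RiemannSphere) :
    ∃ Φ : ∀ y, E.fiber y ≃ₗ[ℂ] (Fin n → ℂ), ∀ᶠ x' in 𝓝 x, ∀ s : ∀ y, E.fiber y,
      E.SectionHolAt s x' ↔ HolAt (fun y => Φ y (s y)) x' := by
  classical
  set e := trivializationAt (Fin n → ℂ) E.fiber x with he
  -- Away from the trivialising set any linear isomorphism will do: only germs near `x` matter.
  refine ⟨fun y => if hy : y ∈ e.baseSet then (e.continuousLinearEquivAt ℂ y hy).toLinearEquiv else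
    ((trivializationAt (Fin n → ℂ) E.fiber y).continuousLinearEquivAt ℂ y
      (FiberBundle.mem_baseSet_trivializationAt' y)).toLinearEquiv, ?_⟩
  filter_upwards [e.open_baseSet.mem_nhds (FiberBundle.mem_baseSet_trivializationAt' x)] with x' hx' s
  rw [SectionHolAt, e.contMDiffAt_section_iff hx']
  refine Filter.EventuallyEq.contMDiffAt_iff ?_
  filter_upwards [e.open_baseSet.mem_nhds hx'] with y hy
  simp [hy]

instance (E : HolBundle.{u} n) (x : RiemannSphere) : FiniteDimensional ℂ (E.fiber x) :=
  (E.exists_local_equiv x).choose x |>.symm.finiteDimensional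

theorem finrank_fiber (E : HolBundle.{u} n) (x : RiemannSphere) :
    Module.finrank ℂ (E.fiber x) = n := by
  rw [((E.exists_local_equiv x).choose x).finrank_eq]; simp

variable {E : HolBundle.{u} n} {x : RiemannSphere}

namespace SectionHolAt

theorem congr {s s' : ∀ y, E.fiber y} (h : E.SectionHolAt s x) (h' : ∀ᶠ y in 𝓝 x, s' y = s y) :
    E.SectionHolAt s' x := by
  obtain ⟨Φ, hΦ⟩ := E.exists_local_equiv x
  rw [hΦ.self_of_nhds] at h ⊢
  refine h.congr ?_
  filter_upwards [h'] with y hy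
  rw [hy]

theorem eventually {s : ∀ y, E.fiber y} (h : E.SectionHolAt s x) :
    ∀ᶠ y in 𝓝 x, E.SectionHolAt s y := by
  obtain ⟨Φ, hΦ⟩ := E.exists_local_equiv x
  rw [hΦ.self_of_nhds] at h
  filter_upwards [h.eventually, hΦ] with y hy h
  exact (h s).2 hy

theorem smul {c : RiemannSphere → ℂ} {s : ∀ y, E.fiber y} (hc : HolAt c x)
    (h : E.SectionHolAt s x) : E.SectionHolAt (fun y => c y • s y) x := by
  obtain ⟨Φ, hΦ⟩ := E.exists_local_equiv x
  rw [hΦ.self_of_nhds] at h ⊢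
  simpa only [map_smul] using hc.smul h

theorem add {s s' : ∀ y, E.fiber y} (h : E.SectionHolAt s x)
    (h' : E.SectionHolAt s' x) : E.SectionHolAt (fun y => s y + s' y) x := by
  obtain ⟨Φ, hΦ⟩ := E.exists_local_equiv x
  rw [hΦ.self_of_nhds] at h h' ⊢
  simpa only [map_add] using h.add h'

theorem zero : E.SectionHolAt (fun _ => 0) x := by
  obtain ⟨Φ, hΦ⟩ := E.exists_local_equiv x
  rw [hΦ.self_of_nhds]
  simpa only [map_zero] using holAt_const _ x

theorem sum {ι : Type*} {t : Finset ι} {s : ι → ∀ y, E.fiber y}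
    (h : ∀ i ∈ t, E.SectionHolAt (s i) x) : E.SectionHolAt (fun y => ∑ i ∈ t, s i y) x := by
  obtain ⟨Φ, hΦ⟩ := E.exists_local_equiv x
  rw [hΦ.self_of_nhds]
  simp only [hΦ.self_of_nhds] at h
  simpa only [map_sum] using HolAt.sum h

theorem eq_zero_of_nhdsNE {s : ∀ y, E.fiber y} (h : E.SectionHolAt s x)
    (h0 : ∀ᶠ y in 𝓝[≠] x, s y = 0) : s x = 0 := by
  obtain ⟨Φ, hΦ⟩ := E.exists_local_equiv x
  rw [hΦ.self_of_nhds] at h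
  have := h.eq_zero_of_nhdsNE (by filter_upwards [h0] with y hy; rw [hy, map_zero])
  simpa using this

theorem exists_div {s : ∀ y, E.fiber y} (h : E.SectionHolAt s x) (h0 : s x = 0) :
    ∃ s', E.SectionHolAt s' x ∧ ∀ᶠ y in 𝓝 x, s y = (chartAt ℂ x y - pos x) • s' y := by
  obtain ⟨Φ, hΦ⟩ := E.exists_local_equiv x
  rw [hΦ.self_of_nhds] at h
  obtain ⟨g, hg, hg'⟩ := h.exists_div (by rw [h0, map_zero])
  refine ⟨fun y => (Φ y).symm (g y), ?_, ?_⟩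
  · rw [hΦ.self_of_nhds]
    simpa using hg
  · filter_upwards [hg'] with y hy
    rw [← map_smul, ← hy, LinearEquiv.symm_apply_apply]

theorem const_extension (E : HolBundle.{u} n) (v : E.fiber x) :
    ∃ s, E.SectionHolAt s x ∧ s x = v := by
  obtain ⟨Φ, hΦ⟩ := E.exists_local_equiv x
  refine ⟨fun y => (Φ y).symm (Φ x v), ?_, by simp⟩
  rw [hΦ.self_of_nhds]
  simpa using holAt_const _ x

end SectionHolAt

/-- Local coordinates with respect to a holomorphic family of linearly independent vectors. -/
theorem exists_coordinates {f : Fin r → ∀ y, E.fiber y} (hf : ∀ i, E.SectionHolAt (f i) x)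
    (hli : LinearIndependent ℂ fun i => f i x) :
    ∃ κ : ∀ y, E.fiber y →ₗ[ℂ] (Fin r → ℂ),
      (∀ᶠ y in 𝓝 x, ∀ c : Fin r → ℂ, κ y (∑ i, c i • f i y) = c) ∧
      ∀ᶠ x' in 𝓝 x, ∀ s, E.SectionHolAt s x' → HolAt (fun y => κ y (s y)) x' := by
  obtain ⟨Φ, hΦ⟩ := E.exists_local_equiv x
  have hli' : LinearIndependent ℂ fun i => Φ x (f i x) :=
    hli.map' (Φ x).toLinearMap (LinearEquiv.ker _)
  obtain ⟨B, hB⟩ := ((Fintype.linearCombination ℂ fun i => Φ x (f i x))).exists_leftInverse_of_injective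
    (LinearMap.ker_eq_bot.2 (linearIndependent_iff_injective_fintypeLinearCombination.1 hli'))
  -- the coordinate matrix with respect to the constant projection `B`
  set M : RiemannSphere → Matrix (Fin r) (Fin r) ℂ := fun y i j => B (Φ y (f i y)) j with hM
  have hBhol : ∀ {x' : RiemannSphere} {g : RiemannSphere → Fin n → ℂ}, HolAt g x' →
      ∀ j, HolAt (fun y => B (g y) j) x' := by
    intro x' g hg j
    have : (fun y => B (g y) j) = fun y => ∑ k, g y k * B (Pi.single k 1) j := by
      funext y
      conv_lhs => rw [pi_eq_sum_univ' (g y)]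
      simp only [map_sum, Finset.sum_apply, map_smul, Pi.smul_apply, smul_eq_mul]
    rw [this]
    exact HolAt.sum fun k _ => (holAt_pi.1 hg k).mul (holAt_const _ _)
  have hMhol : ∀ᶠ x' in 𝓝 x, ∀ i j, HolAt (fun y => M y i j) x' := by
    have h1 : ∀ᶠ x' in 𝓝 x, ∀ i, E.SectionHolAt (f i) x' :=
      Filter.eventually_all.2 fun i => (hf i).eventually
    filter_upwards [h1, hΦ] with x' h1 h2 i j
    exact hBhol ((h2 _).1 (h1 i)) j
  -- The constant map `B` inverts the frame only at `x`. The error matrix `M` is the identity there,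
  -- hence invertible nearby, and its inverse corrects `B`.
  have hMx : M x = 1 := by
    ext i j
    have := congrFun (LinearMap.congr_fun hB (Pi.single i 1)) j
    simp only [LinearMap.comp_apply, Fintype.linearCombination_apply_single, one_smul,
      LinearMap.id_apply] at this
    rw [hM, Matrix.one_apply]
    simp only [this, Pi.single_apply, eq_comm]
  have hdet : ∀ᶠ y in 𝓝 x, (M y).det ≠ 0 := by
    have h1 : HolAt (fun y => (M y).det) x := HolAt.det hMhol.self_of_nhds
    exact h1.continuousAt.eventually_ne (by rw [hMx]; simp)
  refine ⟨fun y => (Matrix.toLin' (M y)⁻¹.transpose) ∘ₗ B ∘ₗ (Φ y).toLinearMap, ?_, ?_⟩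
  · filter_upwards [hdet] with y hy c
    have h1 : B (Φ y (∑ i, c i • f i y)) = Matrix.vecMul c (M y) := by
      ext j
      simp [hM, Matrix.vecMul, dotProduct]
    simp only [LinearMap.comp_apply, LinearEquiv.coe_coe, Matrix.toLin'_apply, h1,
      Matrix.mulVec_transpose, Matrix.vecMul_vecMul]
    rw [Matrix.mul_nonsing_inv _ (isUnit_iff_ne_zero.2 hy), Matrix.vecMul_one]
  · filter_upwards [hdet, hMhol, hΦ] with x' h1 h2 h3 s hs
    rw [holAt_pi]
    intro j
    simp only [LinearMap.comp_apply, LinearEquiv.coe_coe, Matrix.toLin'_apply,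
      Matrix.mulVec_transpose, Matrix.vecMul, dotProduct]
    exact HolAt.sum fun k _ => (hBhol ((h3 s).1 hs) k).mul (HolAt.matrix_inv h2 h1 k j)

theorem eventually_linearIndependent {f : Fin r → ∀ y, E.fiber y}
    (hf : ∀ i, E.SectionHolAt (f i) x) (hli : LinearIndependent ℂ fun i => f i x) :
    ∀ᶠ y in 𝓝 x, LinearIndependent ℂ fun i => f i y := by
  obtain ⟨κ, h1, -⟩ := exists_coordinates hf hli
  filter_upwards [h1] with y hy
  rw [Fintype.linearIndependent_iff]
  intro g hg i
  have := hy g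
  rw [hg, map_zero] at this
  rw [← this]; rfl

/-- A holomorphic family of subspaces is closed. -/
theorem mem_span_of_nhdsNE {f : Fin r → ∀ y, E.fiber y} (hf : ∀ i, E.SectionHolAt (f i) x)
    (hli : LinearIndependent ℂ fun i => f i x) {s : ∀ y, E.fiber y} (hs : E.SectionHolAt s x)
    (h : ∀ᶠ y in 𝓝[≠] x, s y ∈ Submodule.span ℂ (Set.range fun i => f i y)) :
    s x ∈ Submodule.span ℂ (Set.range fun i => f i x) := by
  obtain ⟨κ, h1, h2⟩ := exists_coordinates hf hli
  have h3 := h2.self_of_nhds s hs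
  -- The difference between `s` and its expansion in the frame is holomorphic and vanishes off `x`,
  -- hence also at `x`.
  have h4 : E.SectionHolAt (fun y => s y + (-1 : ℂ) • ∑ i, κ y (s y) i • f i y) x :=
    hs.add (SectionHolAt.smul (holAt_const _ _)
      (SectionHolAt.sum fun i _ => SectionHolAt.smul (holAt_pi.1 h3 i) (hf i)))
  have h5 := h4.eq_zero_of_nhdsNE (by
    filter_upwards [h, h1.filter_mono nhdsWithin_le_nhds] with y hy h1
    obtain ⟨c, hc⟩ := (Submodule.mem_span_range_iff_exists_fun ℂ).1 hy
    rw [← hc, h1, neg_one_smul, add_neg_cancel])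
  simp only [neg_one_smul] at h5
  rw [add_neg_eq_zero.1 h5]
  exact Submodule.sum_mem _ fun i _ => Submodule.smul_mem _ _ (Submodule.subset_span ⟨i, rfl⟩)

namespace IsFrameAt

variable {L : ∀ y, Submodule ℂ (E.fiber y)} {f : Fin r → ∀ y, E.fiber y}

theorem mk' (hol : ∀ i, E.SectionHolAt (f i) x) (hli : LinearIndependent ℂ fun i => f i x)
    (h : ∀ᶠ y in 𝓝 x, Submodule.span ℂ (Set.range fun i => f i y) = L y) : E.IsFrameAt L f x :=
  ⟨hol, eventually_linearIndependent hol hli, h⟩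

theorem mem_of_nhdsNE (h : E.IsFrameAt L f x) {s : ∀ y, E.fiber y} (hs : E.SectionHolAt s x)
    (h' : ∀ᶠ y in 𝓝[≠] x, s y ∈ L y) : s x ∈ L x := by
  rw [← h.span_eq.self_of_nhds]
  refine mem_span_of_nhdsNE h.hol h.linearIndependent.self_of_nhds hs ?_
  filter_upwards [h', h.span_eq.filter_mono nhdsWithin_le_nhds] with y hy h
  rwa [h]

theorem eventually (h : E.IsFrameAt L f x) : ∀ᶠ y in 𝓝 x, E.IsFrameAt L f y := by
  filter_upwards [Filter.eventually_all.2 fun i => (h.hol i).eventually,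
    h.linearIndependent.eventually_nhds, h.span_eq.eventually_nhds] with y h1 h2 h3
  exact ⟨h1, h2, h3⟩

end IsFrameAt

end HolBundle

/-! ### Bases adapted to a filtration. -/

section LinearAlgebra

variable {K F : Type*} [Field K] [AddCommGroup F] [Module K F]

theorem exists_coeff_of_mem_span_image {ι : Type*} [Fintype ι] {ℓ : ι → F} {S : Set ι} {v : F}
    (h : v ∈ Submodule.span K (ℓ '' S)) : ∃ c : ι → K, (∀ i, i ∉ S → c i = 0) ∧ v = ∑ i, c i • ℓ i := by
  classical
  induction h using Submodule.span_induction with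
  | mem x hx =>
    obtain ⟨i, hi, rfl⟩ := hx
    refine ⟨Pi.single i 1, fun j hj => ?_, ?_⟩
    · rw [Pi.single_apply, if_neg]
      rintro rfl
      exact hj hi
    · simp [Pi.single_apply]
  | zero => exact ⟨0, fun _ _ => rfl, by simp⟩
  | add x y _ _ hx hy =>
    obtain ⟨c, hc, rfl⟩ := hx
    obtain ⟨c', hc', rfl⟩ := hy
    exact ⟨c + c', fun i hi => by simp [hc i hi, hc' i hi], by
      simp [add_smul, Finset.sum_add_distrib]⟩
  | smul a x _ hx =>
    obtain ⟨c, hc, rfl⟩ := hx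
    exact ⟨a • c, fun i hi => by simp [hc i hi], by simp [Finset.smul_sum, mul_smul]⟩

theorem LinearIndependent.finrank_span_image {ι : Type*} [Fintype ι] {ℓ : ι → F}
    (h : LinearIndependent K ℓ) (P : ι → Prop) [DecidablePred P] :
    Module.finrank K (Submodule.span K (ℓ '' {i | P i})) =
      (Finset.univ.filter P).card := by
  have h1 : LinearIndependent K fun i : {i // P i} => ℓ i := h.comp _ Subtype.val_injective
  have h2 := finrank_span_eq_card h1
  rw [Fintype.card_subtype] at h2
  have h3 : (range fun i : {i // P i} => ℓ i) = ℓ '' {i | P i} := by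
    ext v
    simp only [mem_range, Subtype.exists, mem_image, mem_ofPred_eq, exists_prop]
  rw [← h2, h3]

/-- A basis adapted to a decreasing exhaustive filtration. -/
theorem exists_adapted_basis [FiniteDimensional K F] {Λ : ℤ → Submodule K F} (hΛ : Antitone Λ)
    {e₀ : ℤ} (h0 : ∀ e, e₀ ≤ e → Λ e = ⊥) :
    ∃ (r : ℕ) (ℓ : Fin r → F) (d : Fin r → ℤ), LinearIndependent K ℓ ∧
      ∀ e, Λ e = Submodule.span K (ℓ '' {i | e ≤ d i}) := by
  -- The basis is built downwards from `e₀`: stage `k + 1` adds a basis of a complement of `Λ (e' +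
  -- 1)` in `Λ e'`, placed in degree `e'`.
  have key : ∀ k : ℕ, ∃ (ι : Type) (_ : Fintype ι) (ℓ : ι → F) (d : ι → ℤ),
      LinearIndependent K ℓ ∧ (∀ i, e₀ - k ≤ d i) ∧
      ∀ e, e₀ - k ≤ e → Λ e = Submodule.span K (ℓ '' {i | e ≤ d i}) := by
    intro k
    induction k with
    | zero =>
      refine ⟨Empty, inferInstance, Empty.elim, Empty.elim, linearIndependent_empty_type,
        fun i => i.elim, fun e he => ?_⟩
      rw [h0 e (by simpa using he), Set.eq_empty_of_isEmpty {i : Empty | _}]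
      simp
    | succ k ih =>
      obtain ⟨ι, _, ℓ, d, hℓ, hd, hs⟩ := ih
      set e' : ℤ := e₀ - (k + 1 : ℕ) with he'
      have he'' : e' + 1 = e₀ - k := by rw [he']; push_cast; ring
      have hall : Λ (e' + 1) = Submodule.span K (Set.range ℓ) := by
        rw [hs _ he''.ge, ← Set.image_univ]
        congr 2
        ext i
        simpa [he''] using hd i
      obtain ⟨Q, hQ⟩ := Submodule.exists_isCompl (Λ (e' + 1))
      set C := Q ⊓ Λ e' with hC
      -- Modular law: cutting a complement `Q` by the larger space `Λ e'` leaves a complement inside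
      -- `Λ e'`.
      have hsup : Λ (e' + 1) ⊔ C = Λ e' := by
        rw [hC, ← sup_inf_assoc_of_le _ (hΛ (by lia)), hQ.sup_eq_top, top_inf_eq]
      let bC := Module.finBasis K C
      have hspanC : Submodule.span K (Set.range fun i => (bC i : F)) = C := by
        have := congrArg (Submodule.map C.subtype) bC.span_eq
        rw [Submodule.map_span, ← Set.range_comp, Submodule.map_top, Submodule.range_subtype] at this
        exact this
      refine ⟨ι ⊕ Fin (Module.finrank K C), inferInstance, Sum.elim ℓ fun i => (bC i : F),
        Sum.elim d fun _ => e', ?_, ?_, ?_⟩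
      · refine hℓ.sum_type (bC.linearIndependent.map' C.subtype (Submodule.ker_subtype C)) ?_
        rw [← hall]
        change Disjoint _ (Submodule.span K (Set.range fun i => (bC i : F)))
        rw [hspanC]
        exact hQ.disjoint.mono_right inf_le_left
      · rintro (i | i)
        · have := hd i
          simp only [Sum.elim_inl]; lia
        · simp
      · intro e he
        rcases he.eq_or_lt with rfl | hlt
        · have : {i : ι ⊕ Fin (Module.finrank K C) | e' ≤ Sum.elim d (fun _ => e') i} = univ := by
            ext i
            rcases i with i | i
            · have := hd i
              simp only [mem_ofPred_eq, Sum.elim_inl, mem_univ, iff_true]; lia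
            · simp
          rw [this, Set.image_univ, Set.Sum.elim_range, Submodule.span_union, ← hall, hspanC, hsup]
        · rw [hs e (by lia)]
          congr 1
          ext v
          simp only [mem_image, mem_ofPred_eq, Sum.exists, Sum.elim_inl, Sum.elim_inr]
          constructor
          · exact fun h => Or.inl h
          · rintro (h | ⟨i, hi, -⟩)
            · exact h
            · lia
  -- In finite dimension the filtration is eventually constant downwards, so finitely many stages
  -- serve every `e`.
  have hst : ∃ k : ℕ, ∀ j, k ≤ j → Λ (e₀ - k) = Λ (e₀ - j) := by
    have := (monotone_stabilizes_iff_noetherian (R := K) (M := F)).2 inferInstance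
      ⟨fun k : ℕ => Λ (e₀ - k), fun a b hab => hΛ (by lia)⟩
    exact this
  obtain ⟨k, hk⟩ := hst
  obtain ⟨ι, _, ℓ, d, hℓ, hd, hs⟩ := key k
  let eqv := Fintype.equivFin ι
  refine ⟨Fintype.card ι, ℓ ∘ eqv.symm, d ∘ eqv.symm, hℓ.comp _ eqv.symm.injective, fun e => ?_⟩
  have himg : (ℓ ∘ eqv.symm) '' {i | e ≤ (d ∘ eqv.symm) i} = ℓ '' {i | e ≤ d i} := by
    ext v
    simp only [mem_image, mem_ofPred_eq, Function.comp_apply]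
    exact ⟨fun ⟨i, h1, h2⟩ => ⟨_, h1, h2⟩,
        fun ⟨i, h1, h2⟩ => ⟨eqv i, by simpa using h1, by simpa using h2⟩⟩
  rw [himg]
  by_cases he : e₀ - k ≤ e
  · exact hs e he
  · have h1 := hk (e₀ - e).toNat (by lia)
    rw [show e₀ - ((e₀ - e).toNat : ℤ) = e by lia] at h1
    rw [← h1, hs _ le_rfl]
    congr 2
    ext i
    have := hd i
    simp only [mem_ofPred_eq]
    constructor <;> intro <;> lia

end LinearAlgebra

/-! ### The factors `z ^ e` and coordinates at infinity. -/

namespace RiemannSphere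

/-- The function `z ^ e` on `ℂ`, with the value `1` at `∞`. -/
noncomputable def twistFactor (e : ℤ) (x : RiemannSphere) : ℂ := x.elim 1 fun z => z ^ e

@[simp] theorem twistFactor_infty (e : ℤ) : twistFactor e OnePoint.infty = 1 := rfl
@[simp] theorem twistFactor_coe (e : ℤ) (z : ℂ) : twistFactor e (z : RiemannSphere) = z ^ e := rfl

theorem twistFactor_ne_zero (e : ℤ) {x : RiemannSphere} (hx : x ≠ ((0 : ℂ) : RiemannSphere)) :
    twistFactor e x ≠ 0 := by
  induction x using OnePoint.rec with
  | infty => simp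
  | coe z => exact zpow_ne_zero _ fun h => hx (by rw [h])

/-- The origin is excluded because the conventional values `0 ^ e` do not obey the exponent law. -/
theorem twistFactor_add (e e' : ℤ) {x : RiemannSphere} (hx : x ≠ ((0 : ℂ) : RiemannSphere)) :
    twistFactor (e + e') x = twistFactor e x * twistFactor e' x := by
  induction x using OnePoint.rec with
  | infty => simp
  | coe z => exact zpow_add₀ (fun h => hx (by rw [h])) _ _

theorem eventually_ne_zero_infty :
    ∀ᶠ y in 𝓝 (OnePoint.infty : RiemannSphere), y ≠ ((0 : ℂ) : RiemannSphere) :=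
  isOpen_ne.mem_nhds (OnePoint.infty_ne_coe 0)

theorem eventually_ne_infty (z : ℂ) :
    ∀ᶠ y in 𝓝 (z : RiemannSphere), y ≠ OnePoint.infty :=
  isOpen_ne.mem_nhds (OnePoint.coe_ne_infty z)

theorem holAt_twistFactor_natCast (k : ℕ) (z : ℂ) :
    HolAt (twistFactor k) (z : RiemannSphere) := by
  rw [holAt_iff]
  simp only [loc_coe, twistFactor_coe, zpow_natCast]
  exact analyticAt_id.pow k

theorem holAt_localCoord (x : RiemannSphere) : HolAt (fun y => chartAt ℂ x y - pos x) x := by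
  rw [holAt_iff]
  simp only [chartAt_loc]
  exact analyticAt_id.sub analyticAt_const

theorem chartAt_infty_coe {z : ℂ} (hz : z ≠ 0) :
    chartAt ℂ (OnePoint.infty : RiemannSphere) (z : RiemannSphere) = z⁻¹ := by
  rw [chartAt_infty, chartInfty_apply, invFun_coe hz, coord_coe]

theorem chartAt_infty_infty :
    chartAt ℂ (OnePoint.infty : RiemannSphere) (OnePoint.infty : RiemannSphere) = 0 := pos_infty

theorem chartAt_coe_coe (z w : ℂ) :
    chartAt ℂ (z : RiemannSphere) (w : RiemannSphere) = w := by
  rw [chartAt_coe]; rfl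

end RiemannSphere

/-! ### Sections on `ℂ` of bounded order at infinity. -/

namespace HolBundle

open RiemannSphere

variable {n r : ℕ} {E : HolBundle.{u} n} {W : ∀ y, Submodule ℂ (E.fiber y)} {e : ℤ}
  {m : ∀ y, E.fiber y}

/-- The section `z ^ e • m` on `ℂ`, with the value of `m` at `∞`. -/
noncomputable def twist (e : ℤ) (m : ∀ y, E.fiber y) : ∀ y, E.fiber y :=
  fun y => twistFactor e y • m y

theorem twist_apply (e : ℤ) (m : ∀ y, E.fiber y) (y : RiemannSphere) :
    twist e m y = twistFactor e y • m y := rfl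

@[simp] theorem twist_infty (e : ℤ) (m : ∀ y, E.fiber y) :
    twist e m OnePoint.infty = m OnePoint.infty := by simp [twist_apply]

variable (E W e) in
/-- The holomorphic sections of `E` on `ℂ` that have order at least `e` at `∞` and generically lie in
`W`; the value at `∞` is the leading coefficient. -/
def sectionSpace : Submodule ℂ (∀ y, E.fiber y) where
  carrier := {m | (∀ z : ℂ, E.SectionHolAt m z) ∧ E.SectionHolAt (twist e m) OnePoint.infty ∧
    ∀ᶠ y in Filter.cofinite, m y ∈ W y}
  add_mem' := by
    rintro a b ⟨h1, h2, h3⟩ ⟨h1', h2', h3'⟩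
    refine ⟨fun z => (h1 z).add (h1' z), ?_, ?_⟩
    · refine (h2.add h2').congr (Filter.Eventually.of_forall fun y => ?_)
      simp only [twist_apply, Pi.add_apply, smul_add]
    · filter_upwards [h3, h3'] with y h h' using add_mem h h'
  zero_mem' := by
    refine ⟨fun z => SectionHolAt.zero, ?_, Filter.Eventually.of_forall fun y => zero_mem _⟩
    have := SectionHolAt.zero (E := E) (x := OnePoint.infty)
    exact this.congr (Filter.Eventually.of_forall fun y => by simp [twist_apply])
  smul_mem' := by
    rintro c a ⟨h1, h2, h3⟩
    refine ⟨fun z => SectionHolAt.smul (holAt_const c _) (h1 z), ?_, ?_⟩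
    · refine (SectionHolAt.smul (holAt_const c _) h2).congr (Filter.Eventually.of_forall fun y => ?_)
      simp only [twist_apply, Pi.smul_apply, smul_comm c]
    · filter_upwards [h3] with y h using Submodule.smul_mem _ _ h

open Classical in
theorem update_mem_sectionSpace {e' : ℤ} (h : m ∈ E.sectionSpace W e) {v : E.fiber OnePoint.infty}
    (h' : E.SectionHolAt (twist e' (Function.update m OnePoint.infty v)) OnePoint.infty) :
    Function.update m OnePoint.infty v ∈ E.sectionSpace W e' := by
  refine ⟨fun z => (h.1 z).congr ?_, h', ?_⟩
  · filter_upwards [eventually_ne_infty z] with y hy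
    rw [Function.update_of_ne hy]
  · filter_upwards [h.2.2, (Set.finite_singleton (OnePoint.infty : RiemannSphere)).compl_mem_cofinite]
      with y hy hy'
    rwa [Function.update_of_ne hy']

-- If the leading coefficient is zero, the twisted section is divisible by `1 / z` at `∞`, and the
-- quotient is the twist of order one higher. Only the value at `∞` changes, since it records the
-- leading coefficient for the new order.
open Classical in
theorem exists_mem_sectionSpace_succ (h : m ∈ E.sectionSpace W e) (h0 : m OnePoint.infty = 0) :
    ∃ m' ∈ E.sectionSpace W (e + 1), ∀ z : ℂ, m' z = m z := by
  obtain ⟨s, hs, hs'⟩ := h.2.1.exists_div (by simpa using h0)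
  refine ⟨_, update_mem_sectionSpace (v := s OnePoint.infty) h (hs.congr ?_), fun z => ?_⟩
  · filter_upwards [hs', eventually_ne_zero_infty] with y hy h0
    induction y using OnePoint.rec with
    | infty => simp
    | coe z =>
      have hz : z ≠ 0 := fun h => h0 (by rw [h])
      rw [pos_infty, chartAt_infty_coe hz, sub_zero, twist_apply, twistFactor_coe] at hy
      rw [twist_apply, Function.update_of_ne (OnePoint.coe_ne_infty z), twistFactor_coe,
        zpow_add_one₀ hz, mul_comm, mul_smul, hy, smul_smul, mul_inv_cancel₀ hz, one_smul]
  · rw [Function.update_of_ne (OnePoint.coe_ne_infty z)]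

-- Regarding a section of order `e + k` as one of order `e` multiplies its twist by the `k`-th power
-- of the coordinate at `∞`. The factor `0 ^ k` covers both cases: the leading coefficient is kept
-- for `k = 0` and erased for `k > 0`.
open Classical in
theorem update_zero_pow_mem_sectionSpace (k : ℕ) (h : m ∈ E.sectionSpace W (e + k)) :
    Function.update m OnePoint.infty ((0 : ℂ) ^ k • m OnePoint.infty) ∈ E.sectionSpace W e := by
  refine update_mem_sectionSpace h ?_
  have h1 : HolAt (fun y => (chartAt ℂ OnePoint.infty y - pos OnePoint.infty) ^ k)
      OnePoint.infty := by
    have := HolAt.prod (s := Finset.range k) (fun i _ => holAt_localCoord OnePoint.infty)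
    simpa using this
  refine (SectionHolAt.smul h1 h.2.1).congr ?_
  filter_upwards [eventually_ne_zero_infty] with y h0
  induction y using OnePoint.rec with
  | infty => simp [chartAt_infty_infty]
  | coe z =>
    have hz : z ≠ 0 := fun h => h0 (by rw [h])
    rw [pos_infty, chartAt_infty_coe hz, sub_zero, twist_apply, twist_apply,
      Function.update_of_ne (OnePoint.coe_ne_infty z), smul_smul, twistFactor_coe, twistFactor_coe,
      zpow_add₀ hz, zpow_natCast, inv_pow, mul_comm, mul_assoc, mul_inv_cancel₀ (pow_ne_zero _ hz),
      mul_one]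

/-- Multiplication by `z ^ k` costs `k` orders at `∞` but keeps the leading coefficient; this is why
the leading spaces decrease. -/
theorem twist_mem_sectionSpace (k : ℕ) (h : m ∈ E.sectionSpace W (e + k)) :
    twist k m ∈ E.sectionSpace W e := by
  refine ⟨fun z => SectionHolAt.smul (holAt_twistFactor_natCast k z) (h.1 z), h.2.1.congr ?_, ?_⟩
  · filter_upwards [eventually_ne_zero_infty] with y h0
    rw [twist_apply, twist_apply, twist_apply, twistFactor_add _ _ h0, mul_smul]
  · filter_upwards [h.2.2] with y hy using Submodule.smul_mem _ _ hy

-- A zero at a finite point is traded for one more order at `∞`. Since `(z - z₀) / z` tends to `1`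
-- at `∞`, dividing by `z - z₀` leaves the leading coefficient unchanged. This exchange drives the
-- splitting theorem.
open Classical in
theorem exists_div_mem_sectionSpace {z₀ : ℂ} (h : m ∈ E.sectionSpace W e) (h0 : m z₀ = 0) :
    ∃ m' ∈ E.sectionSpace W (e + 1), m' OnePoint.infty = m OnePoint.infty := by
  obtain ⟨s, hs, hs'⟩ := (h.1 z₀).exists_div h0
  set m' : ∀ y, E.fiber y := fun y => if y = OnePoint.infty then m y else
    if y = z₀ then s y else (coord y - z₀)⁻¹ • m y with hm'
  have hgen : ∀ y, y ≠ OnePoint.infty → y ≠ z₀ → m' y = (coord y - z₀)⁻¹ • m y :=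
    fun y h1 h2 => by simp [hm', h1, h2]
  refine ⟨m', ⟨fun z => ?_, ?_, ?_⟩, by simp [hm']⟩
  · by_cases hz : z = z₀
    · subst hz
      refine hs.congr ?_
      filter_upwards [hs', eventually_ne_infty z] with y hy h1
      by_cases h2 : y = z
      · simp [hm', h2]
      · rw [hgen y h1 h2, hy]
        induction y using OnePoint.rec with
        | infty => exact absurd rfl h1
        | coe w =>
          have hw : w ≠ z := fun h => h2 (by rw [h])
          rw [chartAt_coe_coe, pos_coe, coord_coe, smul_smul, inv_mul_cancel₀ (sub_ne_zero.2 hw),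
            one_smul]
    · have h1 : HolAt (fun y => (coord y - z₀)⁻¹) (z : RiemannSphere) := by
        refine HolAt.inv ?_ (by simpa using sub_ne_zero.2 hz)
        simpa only [sub_eq_add_neg] using (holAt_coord z).add (holAt_const (-z₀) _)
      refine (SectionHolAt.smul h1 (h.1 z)).congr ?_
      filter_upwards [eventually_ne_infty z, isOpen_ne.mem_nhds (show (z : RiemannSphere) ≠ z₀ by simpa using hz)]
        with y h1 h2 using hgen y h1 h2
  · have h1 : HolAt (fun y => (1 + (-z₀) * (chartAt ℂ OnePoint.infty y - pos OnePoint.infty))⁻¹)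
        (OnePoint.infty : RiemannSphere) :=
      HolAt.inv ((holAt_const 1 _).add ((holAt_const (-z₀) _).mul (holAt_localCoord _)))
        (by simp [chartAt_infty_infty])
    refine (SectionHolAt.smul h1 h.2.1).congr ?_
    filter_upwards [eventually_ne_zero_infty,
      isOpen_ne.mem_nhds (show (OnePoint.infty : RiemannSphere) ≠ z₀ by simp)] with y h0 h2
    induction y using OnePoint.rec with
    | infty => simp [chartAt_infty_infty, hm']
    | coe z =>
      have hz : z ≠ 0 := fun h => h0 (by rw [h])
      have hz' : z - z₀ ≠ 0 := fun h => h2 (by rw [sub_eq_zero.1 h])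
      rw [twist_apply, twist_apply, hgen _ (OnePoint.coe_ne_infty z) h2, pos_infty,
        chartAt_infty_coe hz, smul_smul, smul_smul, twistFactor_coe, twistFactor_coe, coord_coe,
        zpow_add_one₀ hz]
      congr 1
      have : 1 + -z₀ * (z⁻¹ - 0) = (z - z₀) * z⁻¹ := by field_simp; ring
      rw [this, mul_inv, inv_inv]
      ring
  · filter_upwards [h.2.2, (Set.finite_singleton (OnePoint.infty : RiemannSphere)).compl_mem_cofinite,
      (Set.finite_singleton (z₀ : RiemannSphere)).compl_mem_cofinite] with y hy h1 h2
    rw [hgen y h1 h2]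
    exact Submodule.smul_mem _ _ hy

theorem cofinite_le_nhdsNE (x : RiemannSphere) : 𝓝[≠] x ≤ Filter.cofinite :=
  nhdsNE_le_cofinite x

theorem sectionSpace_eq_zero (h : m ∈ E.sectionSpace W e)
    (h0 : ∀ᶠ y in Filter.cofinite, m y = 0) : m = 0 := by
  funext y
  induction y using OnePoint.rec with
  | infty =>
    have := h.2.1.eq_zero_of_nhdsNE (by
      filter_upwards [h0.filter_mono (cofinite_le_nhdsNE _)] with y hy
      rw [twist_apply, hy, smul_zero])
    simpa using this
  | coe z => exact (h.1 z).eq_zero_of_nhdsNE (h0.filter_mono (cofinite_le_nhdsNE _))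

theorem sectionSpace_eq_zero_of_coe (h : m ∈ E.sectionSpace W e)
    (h0 : ∀ z : ℂ, m z = 0) : m = 0 := by
  refine sectionSpace_eq_zero h ?_
  filter_upwards [(Set.finite_singleton (OnePoint.infty : RiemannSphere)).compl_mem_cofinite] with y hy
  induction y using OnePoint.rec with
  | infty => exact absurd rfl hy
  | coe z => exact h0 z

end HolBundle

/-! ### Split frames and the splitting theorem. -/

namespace HolBundle

open RiemannSphere

variable {n r : ℕ}

/-- `b` is a holomorphic frame of `L` on `ℂ`, and the sections `z ^ d i • b i` form one at `∞`: so `L`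
is the direct sum of the line bundles `𝒪(d i)` spanned by the `b i`. -/
structure IsSplitFrame (E : HolBundle.{u} n) (L : ∀ y, Submodule ℂ (E.fiber y))
    (b : Fin r → ∀ y, E.fiber y) (d : Fin r → ℤ) : Prop where
  coe : ∀ z : ℂ, E.IsFrameAt L b z
  infty : E.IsFrameAt L (fun i => twist (d i) (b i)) OnePoint.infty

theorem isSplitFrame_span {E : HolBundle.{u} n} {b : Fin r → ∀ y, E.fiber y} {d : Fin r → ℤ}
    (h1 : ∀ i (z : ℂ), E.SectionHolAt (b i) z)
    (h2 : ∀ i, E.SectionHolAt (twist (d i) (b i)) OnePoint.infty)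
    (h3 : ∀ y, LinearIndependent ℂ fun i => b i y) :
    E.IsSplitFrame (fun y => Submodule.span ℂ (Set.range fun i => b i y)) b d := by
  refine ⟨fun z => IsFrameAt.mk' (fun i => h1 i z) (h3 z) (Filter.Eventually.of_forall fun y => rfl),
    IsFrameAt.mk' h2 (by simpa using h3 OnePoint.infty) ?_⟩
  filter_upwards [eventually_ne_zero_infty] with y hy
  refine le_antisymm (Submodule.span_le.2 ?_) (Submodule.span_le.2 ?_)
  · rintro _ ⟨i, rfl⟩
    exact Submodule.smul_mem _ _ (Submodule.subset_span ⟨i, rfl⟩)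
  · rintro _ ⟨i, rfl⟩
    have : b i y = (twistFactor (d i) y)⁻¹ • twist (d i) (b i) y := by
      rw [twist_apply, smul_smul, inv_mul_cancel₀ (twistFactor_ne_zero _ hy), one_smul]
    change b i y ∈ _
    rw [this]
    exact Submodule.smul_mem _ _ (Submodule.subset_span ⟨i, rfl⟩)

theorem IsSplitFrame.linearIndependent {E : HolBundle.{u} n} {L : ∀ y, Submodule ℂ (E.fiber y)}
    {b : Fin r → ∀ y, E.fiber y} {d : Fin r → ℤ} (h : E.IsSplitFrame L b d) (y : RiemannSphere) :
    LinearIndependent ℂ fun i => b i y := by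
  induction y using OnePoint.rec with
  | infty => simpa using h.infty.linearIndependent.self_of_nhds
  | coe z => exact (h.coe z).linearIndependent.self_of_nhds

theorem IsSplitFrame.span_eq {E : HolBundle.{u} n} {L : ∀ y, Submodule ℂ (E.fiber y)}
    {b : Fin r → ∀ y, E.fiber y} {d : Fin r → ℤ} (h : E.IsSplitFrame L b d) (y : RiemannSphere) :
    Submodule.span ℂ (Set.range fun i => b i y) = L y := by
  induction y using OnePoint.rec with
  | infty => simpa using h.infty.span_eq.self_of_nhds
  | coe z => exact (h.coe z).span_eq.self_of_nhds

theorem IsSplitFrame.finrank_eq {E : HolBundle.{u} n} {L : ∀ y, Submodule ℂ (E.fiber y)}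
    {b : Fin r → ∀ y, E.fiber y} {d : Fin r → ℤ} (h : E.IsSplitFrame L b d) (y : RiemannSphere) :
    Module.finrank ℂ (L y) = r := by
  rw [← h.span_eq, finrank_span_eq_card (h.linearIndependent y), Fintype.card_fin]

/-- The line bundle spanned by one member of a split frame. -/
theorem IsSplitFrame.single {E : HolBundle.{u} n} {L : ∀ y, Submodule ℂ (E.fiber y)}
    {b : Fin r → ∀ y, E.fiber y} {d : Fin r → ℤ} (h : E.IsSplitFrame L b d) (i : Fin r) :
    E.IsSplitFrame (fun y => Submodule.span ℂ (Set.range fun _ : Fin 1 => b i y))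
      (fun _ : Fin 1 => b i) (fun _ => d i) :=
  isSplitFrame_span (fun _ z => (h.coe z).hol i) (fun _ => h.infty.hol i)
    fun y => (h.linearIndependent y).comp (fun _ : Fin 1 => i) (Function.injective_of_subsingleton _)

theorem isSplitFrame_bot (E : HolBundle.{u} n) :
    E.IsSplitFrame (fun _ => ⊥) (fun i : Fin 0 => i.elim0) (fun i => i.elim0) := by
  have := isSplitFrame_span (E := E) (b := fun i : Fin 0 => i.elim0) (d := fun i => i.elim0)
    (fun i => i.elim0) (fun i => i.elim0) (fun y => linearIndependent_empty_type)
  simpa using this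

/-- The sub-bundle with a given split frame. -/
def IsSplitFrame.subbundle {E : HolBundle.{u} n} {L : ∀ y, Submodule ℂ (E.fiber y)}
    {b : Fin r → ∀ y, E.fiber y} {d : Fin r → ℤ} (h : E.IsSplitFrame L b d) : E.Subbundle r where
  toSubmodule := L
  exists_frame x := by
    induction x using OnePoint.rec with
    | infty => exact ⟨_, h.infty⟩
    | coe z => exact ⟨_, h.coe z⟩

section Splitting

variable (E : HolBundle.{u} n) (W : ∀ y, Submodule ℂ (E.fiber y)) (e : ℤ)

/-- The space of leading coefficients at `∞`. -/
def leadingSpace : Submodule ℂ (E.fiber OnePoint.infty) :=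
  (E.sectionSpace W e).map (LinearMap.proj OnePoint.infty)

variable {E W e}

theorem antitone_leadingSpace : Antitone (E.leadingSpace W) := by
  intro e e' he
  rintro v ⟨m, hm, rfl⟩
  refine ⟨twist (e' - e).toNat m, twist_mem_sectionSpace _ ?_, by simp⟩
  rwa [show e + ((e' - e).toNat : ℤ) = e' by lia]

variable (E W e) in
open Classical in
/-- The inclusion of the sections of order at least `e + 1` in those of order at least `e`. -/
noncomputable def sectionInclusion : E.sectionSpace W (e + 1) →ₗ[ℂ] E.sectionSpace W e where
  toFun m := ⟨Function.update m.1 OnePoint.infty 0, by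
    have := update_zero_pow_mem_sectionSpace (E := E) (W := W) (e := e) (m := m.1) 1 (by simp)
    simpa using this⟩
  map_add' a b := by
    ext y
    by_cases hy : y = OnePoint.infty
    · subst hy; simp
    · simp [Function.update_of_ne hy]
  map_smul' a b := by
    ext y
    by_cases hy : y = OnePoint.infty
    · subst hy; simp
    · simp [Function.update_of_ne hy]

theorem sectionInclusion_coe (m : E.sectionSpace W (e + 1)) (z : ℂ) :
    (E.sectionInclusion W e m).1 z = m.1 z := by
  simp [sectionInclusion]

theorem sectionInclusion_infty (m : E.sectionSpace W (e + 1)) :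
    (E.sectionInclusion W e m).1 OnePoint.infty = 0 := by
  simp [sectionInclusion]

theorem sectionInclusion_injective : Function.Injective (E.sectionInclusion W e) := by
  rw [← LinearMap.ker_eq_bot, LinearMap.ker_eq_bot']
  intro m hm
  refine Subtype.ext (sectionSpace_eq_zero_of_coe m.2 fun z => ?_)
  rw [← sectionInclusion_coe, hm]; rfl

/-- The sections of order at least `e + 1` are exactly the kernel of the leading-coefficient map on
those of order at least `e`. -/
theorem finrank_sectionSpace_succ [FiniteDimensional ℂ (E.sectionSpace W (e + 1))] :
    FiniteDimensional ℂ (E.sectionSpace W e) ∧ Module.finrank ℂ (E.sectionSpace W e) =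
      Module.finrank ℂ (E.sectionSpace W (e + 1)) + Module.finrank ℂ (E.leadingSpace W e) := by
  set ev : E.sectionSpace W e →ₗ[ℂ] E.fiber OnePoint.infty :=
    (LinearMap.proj OnePoint.infty).comp (E.sectionSpace W e).subtype with hev
  have hrange : LinearMap.range ev = E.leadingSpace W e := by
    rw [hev, LinearMap.range_comp, Submodule.range_subtype]; rfl
  have hker : LinearMap.range (E.sectionInclusion W e) = LinearMap.ker ev := by
    ext m
    rw [LinearMap.mem_range, LinearMap.mem_ker]
    constructor
    · rintro ⟨m', rfl⟩
      exact sectionInclusion_infty m'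
    · intro h0
      obtain ⟨m', h1, h2⟩ := exists_mem_sectionSpace_succ m.2 h0
      refine ⟨⟨m', h1⟩, Subtype.ext (funext fun y => ?_)⟩
      induction y using OnePoint.rec with
      | infty => exact (sectionInclusion_infty _).trans h0.symm
      | coe z => exact (sectionInclusion_coe _ _).trans (h2 z)
  have h3 := LinearMap.finrank_range_of_inj (sectionInclusion_injective (E := E) (W := W) (e := e))
  rw [hker] at h3
  have h4 : FiniteDimensional ℂ (LinearMap.ker ev) := by
    rw [← hker]; infer_instance
  have h5 : FiniteDimensional ℂ (E.sectionSpace W e) := by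
    have h6 : FiniteDimensional ℂ (E.sectionSpace W e ⧸ LinearMap.ker ev) :=
      ev.quotKerEquivRange.symm.finiteDimensional
    exact Module.Finite.of_submodule_quotient (LinearMap.ker ev)
  refine ⟨h5, ?_⟩
  rw [← hrange, ← h3, add_comm, LinearMap.finrank_range_add_finrank_ker]

open Classical in
/-- The splitting theorem: if the order at `∞` of the nonzero sections is bounded, the sections are
spanned by a split frame of a sub-bundle. -/
theorem exists_isSplitFrame {e₀ : ℤ} (h0 : ∀ e, e₀ ≤ e → E.sectionSpace W e = ⊥) :
    ∃ (r : ℕ) (b : Fin r → ∀ y, E.fiber y) (d : Fin r → ℤ) (L : ∀ y, Submodule ℂ (E.fiber y)),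
      E.IsSplitFrame L b d ∧ (∀ i, b i ∈ E.sectionSpace W (d i)) ∧
      (∀ e, ∀ m ∈ E.sectionSpace W e, ∀ y, m y ∈ L y) ∧
      (∀ e, FiniteDimensional ℂ (E.sectionSpace W e)) ∧
      ∀ e, Module.finrank ℂ (E.sectionSpace W e) = ∑ i, (d i - e + 1).toNat := by
  have hL0 : ∀ e, e₀ ≤ e → E.leadingSpace W e = ⊥ := fun e he => by
    rw [leadingSpace, h0 e he, Submodule.map_bot]
  obtain ⟨r, ℓ, d, hℓ, hΛ⟩ := exists_adapted_basis (E.antitone_leadingSpace (W := W)) hL0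
  have hmem : ∀ i, ℓ i ∈ E.leadingSpace W (d i) := fun i => by
    rw [hΛ]; exact Submodule.subset_span ⟨i, le_refl (d i), rfl⟩
  choose b hb hbℓ using hmem
  replace hbℓ : ∀ i, b i OnePoint.infty = ℓ i := hbℓ
  obtain ⟨κ, hκ⟩ := (Fintype.linearCombination ℂ ℓ).exists_leftInverse_of_injective
    (LinearMap.ker_eq_bot.2 (linearIndependent_iff_injective_fintypeLinearCombination.1 hℓ))
  have hκ' : ∀ c : Fin r → ℂ, κ (∑ i, c i • ℓ i) = c := fun c => by
    have := LinearMap.congr_fun hκ c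
    simpa [Fintype.linearCombination_apply] using this
  have hli : ∀ z : ℂ, LinearIndependent ℂ fun i => b i z := by
    intro z
    rw [Fintype.linearIndependent_iff]
    by_contra! hcon
    obtain ⟨c, hc, i₁, hi₁⟩ := hcon
    -- Choose a term of least degree in a nontrivial relation at `z`. The combination is then a
    -- section of order at least `d i₀` vanishing at `z`, whose leading coefficient involves only
    -- the terms of degree exactly `d i₀`.
    obtain ⟨i₀, hi₀, hmin⟩ := Finset.exists_min_image (Finset.univ.filter fun i => c i ≠ 0) d
      ⟨i₁, by simpa using hi₁⟩
    simp only [Finset.mem_filter, Finset.mem_univ, true_and] at hi₀ hmin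
    set k : Fin r → ℕ := fun i => (d i - d i₀).toNat with hk
    set B : Fin r → ∀ y, E.fiber y := fun i =>
      Function.update (b i) OnePoint.infty ((0 : ℂ) ^ k i • b i OnePoint.infty) with hB
    have hs : ∑ i, c i • B i ∈ E.sectionSpace W (d i₀) := by
      refine Submodule.sum_mem _ fun i _ => ?_
      by_cases hi : c i = 0
      · rw [hi, zero_smul]; exact zero_mem _
      · refine Submodule.smul_mem _ _ (update_zero_pow_mem_sectionSpace _ ?_)
        have := hmin i hi
        rw [show d i₀ + ((k i : ℕ) : ℤ) = d i by rw [hk]; simp only; lia]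
        exact hb i
    have hsz : (∑ i, c i • B i) z = 0 := by
      rw [Finset.sum_apply, ← hc]
      refine Finset.sum_congr rfl fun i _ => ?_
      rw [Pi.smul_apply, hB]
      simp only
      rw [Function.update_of_ne (OnePoint.coe_ne_infty z)]
    -- Dividing out the zero puts this leading coefficient into the next leading space, spanned by
    -- the `ℓ i` of degree greater than `d i₀`. Its coefficient on `ℓ i₀` is nevertheless `c i₀`,
    -- which is nonzero.
    obtain ⟨m', hm', hm'inf⟩ := exists_div_mem_sectionSpace hs hsz
    have h1 : (∑ i, c i • B i) OnePoint.infty = ∑ i, (c i * 0 ^ k i) • ℓ i := by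
      rw [Finset.sum_apply]
      refine Finset.sum_congr rfl fun i _ => ?_
      rw [Pi.smul_apply, hB]
      simp only
      rw [Function.update_self, mul_smul, hbℓ]
    have h2 : (∑ i, (c i * 0 ^ k i) • ℓ i) ∈ E.leadingSpace W (d i₀ + 1) :=
      ⟨m', hm', hm'inf.trans h1⟩
    rw [hΛ] at h2
    obtain ⟨c', hc', heq⟩ := exists_coeff_of_mem_span_image h2
    have h3 := congrFun ((hκ' _).symm.trans ((congrArg κ heq).trans (hκ' _))) i₀
    rw [hc' i₀ (by simp)] at h3
    have : k i₀ = 0 := by simp [hk]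
    rw [this, pow_zero, mul_one] at h3
    exact hi₀ h3
  refine ⟨r, b, d, fun y => Submodule.span ℂ (Set.range fun i => b i y), ?_, hb, ?_, ?_⟩
  · refine isSplitFrame_span (fun i => (hb i).1) (fun i => (hb i).2.1) fun y => ?_
    induction y using OnePoint.rec with
    | infty =>
      have : (fun i => b i OnePoint.infty) = ℓ := funext hbℓ
      rw [this]; exact hℓ
    | coe z => exact hli z
  · have key : ∀ k : ℕ, ∀ m ∈ E.sectionSpace W (e₀ - k), ∀ y,
        m y ∈ Submodule.span ℂ (Set.range fun i => b i y) := by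
      intro k
      induction k with
      | zero =>
        intro m hm y
        rw [h0 _ (by simp), Submodule.mem_bot] at hm
        rw [hm]; exact zero_mem _
      | succ k ih =>
        intro m hm y
        set e : ℤ := e₀ - (k + 1 : ℕ) with he
        have h1 : m OnePoint.infty ∈ E.leadingSpace W e := ⟨m, hm, rfl⟩
        rw [hΛ] at h1
        obtain ⟨c, hc, heq⟩ := exists_coeff_of_mem_span_image h1
        set s := ∑ i, c i • twist (d i - e).toNat (b i) with hs
        have hsm : s ∈ E.sectionSpace W e := by
          refine Submodule.sum_mem _ fun i _ => ?_
          by_cases hi : e ≤ d i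
          · refine Submodule.smul_mem _ _ (twist_mem_sectionSpace _ ?_)
            rw [show e + ((d i - e).toNat : ℤ) = d i by lia]
            exact hb i
          · rw [hc i hi, zero_smul]; exact zero_mem _
        have hsL : ∀ y, s y ∈ Submodule.span ℂ (Set.range fun i => b i y) := by
          intro y
          rw [hs, Finset.sum_apply]
          exact Submodule.sum_mem _ fun i _ => Submodule.smul_mem _ _
            (Submodule.smul_mem _ _ (Submodule.subset_span ⟨i, rfl⟩))
        have hsinf : (m - s) OnePoint.infty = 0 := by
          rw [Pi.sub_apply, heq, hs, Finset.sum_apply, sub_eq_zero]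
          refine Finset.sum_congr rfl fun i _ => ?_
          rw [Pi.smul_apply, twist_infty, hbℓ]
        obtain ⟨m', hm', hm'z⟩ := exists_mem_sectionSpace_succ (sub_mem hm hsm) hsinf
        have hm'' : m' ∈ E.sectionSpace W (e₀ - k) := by
          rwa [show e₀ - (k : ℤ) = e + 1 by rw [he]; push_cast; ring]
        have hsplit : m y = (m - s) y + s y := by simp
        rw [hsplit]
        refine add_mem ?_ (hsL y)
        induction y using OnePoint.rec with
        | infty => rw [hsinf]; exact zero_mem _
        | coe z => rw [← hm'z]; exact ih m' hm'' z
    intro e m hm y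
    by_cases he : e₀ ≤ e
    · rw [h0 e he, Submodule.mem_bot] at hm
      rw [hm]; exact zero_mem _
    · exact key (e₀ - e).toNat m (by rwa [show e₀ - ((e₀ - e).toNat : ℤ) = e by lia]) y
  · have hd0 : ∀ i, d i < e₀ := by
      intro i
      by_contra! h
      have h1 : ℓ i ∈ E.leadingSpace W (d i) := by
        rw [hΛ]; exact Submodule.subset_span ⟨i, le_refl (d i), rfl⟩
      rw [hL0 _ h, Submodule.mem_bot] at h1
      exact hℓ.ne_zero i h1
    have hcard : ∀ e, Module.finrank ℂ (E.leadingSpace W e) =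
        (Finset.univ.filter fun i => e ≤ d i).card := fun e => by
      rw [hΛ, hℓ.finrank_span_image fun i => e ≤ d i]
    -- Each step down in `e` adds the dimension of a leading space, that is, the number of `i` with
    -- `e ≤ d i`.
    have key : ∀ k : ℕ, FiniteDimensional ℂ (E.sectionSpace W (e₀ - k)) ∧
        Module.finrank ℂ (E.sectionSpace W (e₀ - k)) = ∑ i, (d i - (e₀ - k) + 1).toNat := by
      intro k
      induction k with
      | zero =>
        rw [h0 _ (by simp)]
        refine ⟨inferInstance, ?_⟩
        rw [finrank_bot]
        refine (Finset.sum_eq_zero fun i _ => ?_).symm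
        have := hd0 i
        simp only [Nat.cast_zero]
        lia
      | succ k ih =>
        have he : e₀ - ((k + 1 : ℕ) : ℤ) + 1 = e₀ - k := by push_cast; ring
        rw [← he] at ih
        obtain ⟨ih1, ih2⟩ := ih
        obtain ⟨h1, h2⟩ := finrank_sectionSpace_succ (E := E) (W := W) (e := e₀ - ((k + 1 : ℕ) : ℤ))
        refine ⟨h1, ?_⟩
        rw [h2, ih2, hcard, Finset.card_filter, ← Finset.sum_add_distrib]
        refine Finset.sum_congr rfl fun i _ => ?_
        split_ifs <;> lia
    have key' : ∀ e, FiniteDimensional ℂ (E.sectionSpace W e) ∧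
        Module.finrank ℂ (E.sectionSpace W e) = ∑ i, (d i - e + 1).toNat := by
      intro e
      by_cases he : e₀ ≤ e
      · rw [h0 e he]
        refine ⟨inferInstance, ?_⟩
        rw [finrank_bot]
        refine (Finset.sum_eq_zero fun i _ => ?_).symm
        have := hd0 i
        lia
      · have := key (e₀ - e).toNat
        rwa [show e₀ - ((e₀ - e).toNat : ℤ) = e by lia] at this
    exact ⟨fun e => (key' e).1, fun e => (key' e).2⟩

end Splitting

end HolBundle

/-! ### Liouville's theorem for meromorphic functions. -/

section Liouville

/-- A meromorphic function on `ℂ` without poles that vanishes at `∞` is zero. -/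
theorem meromorphicOrderAt_eq_top_of_nonneg {h : ℂ → ℂ} (hm : ∀ z, MeromorphicAt h z)
    (h0 : ∀ z, 0 ≤ meromorphicOrderAt h z)
    (hinf : 0 < meromorphicOrderAt (fun w => h w⁻¹) 0) (z : ℂ) : meromorphicOrderAt h z = ⊤ := by
  have hmU : MeromorphicOn h univ := fun z _ => hm z
  -- The normal form removes the removable singularities; it is entire and tends to `0` at infinity.
  set k := toMeromorphicNFOn h univ with hk
  have hkh : ∀ z, ∀ᶠ w in 𝓝[≠] z, k w = h w := fun z =>
    hmU.toMeromorphicNFOn_eq_self_on_nhdsNE (mem_univ z)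
  have hka : ∀ z, AnalyticAt ℂ k z := fun z => by
    have h1 : MeromorphicNFAt k z := meromorphicNFOn_toMeromorphicNFOn h univ (mem_univ z)
    rw [← h1.meromorphicOrderAt_nonneg_iff_analyticAt, meromorphicOrderAt_congr (hkh z)]
    exact h0 z
  have hkd : Differentiable ℂ k := fun z => (hka z).differentiableAt
  have hlim : Filter.Tendsto h (Bornology.cobounded ℂ) (𝓝 0) := by
    have h1 := (tendsto_zero_of_meromorphicOrderAt_pos hinf).comp
      (Filter.tendsto_inv₀_cobounded' (α := ℂ))
    simpa [Function.comp_def] using h1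
  have hklim : Filter.Tendsto k (Filter.cocompact ℂ) (𝓝 0) := by
    rw [← Metric.cobounded_eq_cocompact, Metric.tendsto_nhds]
    intro ε hε
    have h1 := (Metric.tendsto_nhds.1 hlim) (ε / 2) (half_pos hε)
    obtain ⟨R, hR⟩ := (Filter.hasBasis_cobounded_norm (E := ℂ)).mem_iff.1 h1
    obtain ⟨-, hR⟩ := hR
    refine (Filter.hasBasis_cobounded_norm (E := ℂ)).mem_iff.2 ⟨R + 1, trivial, fun z hz => ?_⟩
    have hz' : R + 1 ≤ ‖z‖ := hz
    -- At `z` itself the values of `k` and `h` may differ, so the bound on `h` reaches `k z` as a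
    -- limit along nearby points. This costs a little room: radius `R + 1` and the non-strict bound
    -- `ε / 2`.
    have h2 : ∀ᶠ w in 𝓝[≠] z, dist (k w) 0 ≤ ε / 2 := by
      have h3 : ∀ᶠ w in 𝓝 z, R ≤ ‖w‖ := by
        filter_upwards [(isOpen_lt continuous_const continuous_norm).mem_nhds
          (show R < ‖z‖ by linarith)] with w hw using le_of_lt hw
      filter_upwards [h3.filter_mono nhdsWithin_le_nhds, hkh z] with w hw hw'
      rw [hw']
      exact le_of_lt (hR hw)
    have h4 : Filter.Tendsto (fun w => dist (k w) 0) (𝓝[≠] z) (𝓝 (dist (k z) 0)) :=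
      ((hka z).continuousAt.dist continuousAt_const).mono_left nhdsWithin_le_nhds
    exact lt_of_le_of_lt (le_of_tendsto h4 h2) (by linarith)
  rw [meromorphicOrderAt_eq_top_iff]
  filter_upwards [hkh z] with w hw
  rw [← hw, hkd.apply_eq_of_tendsto_cocompact w hklim]

theorem meromorphicOrderAt_inv_sub (x : ℂ) :
    meromorphicOrderAt (fun w : ℂ => w⁻¹ - x) 0 = (-1 : ℤ) := by
  have hm : MeromorphicAt (fun w : ℂ => w⁻¹ - x) 0 := by fun_prop
  rw [meromorphicOrderAt_eq_int_iff hm]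
  refine ⟨fun w => 1 - x * w, by fun_prop, by simp, ?_⟩
  filter_upwards [self_mem_nhdsWithin] with w hw
  have hw' : w ≠ 0 := hw
  simp only [sub_zero, zpow_neg, zpow_one, smul_eq_mul]
  field_simp

/-- A meromorphic function on `ℂℙ¹` whose divisor is bounded below by a divisor of positive degree
is zero. -/
theorem meromorphicOrderAt_eq_top_of_divisor {g : ℂ → ℂ} (hm : ∀ z, MeromorphicAt g z)
    (k : ℂ →₀ ℤ) (hk : ∀ z, ((-k z : ℤ) : WithTop ℤ) ≤ meromorphicOrderAt g z)
    (hminf : MeromorphicAt (fun w => g w⁻¹) 0)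
    (hinf : ((k.sum fun _ n => n : ℤ) : WithTop ℤ) < meromorphicOrderAt (fun w => g w⁻¹) 0) (z : ℂ) :
    meromorphicOrderAt g z = ⊤ := by
  classical
  -- `P` is the rational function with divisor `k` on `ℂ`, of order `-deg k` at `∞`. Hence `g * P`
  -- has no poles on `ℂ` and vanishes at `∞`.
  set P : ℂ → ℂ := fun z => ∏ x ∈ k.support, (z - x) ^ k x with hP
  have hfac : ∀ x z : ℂ, MeromorphicAt (fun z => (z - x) ^ k x) z := fun x z => by
    have : MeromorphicAt (fun z => z - x) z := by fun_prop
    exact this.zpow _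
  have hPm : ∀ z, MeromorphicAt P z := fun z => MeromorphicAt.fun_prod fun x _ => hfac x z
  have hPo : ∀ z, meromorphicOrderAt P z = (k z : ℤ) := by
    intro z
    rw [hP, meromorphicOrderAt_fun_prod fun x _ => hfac x z]
    have h1 : ∀ x ∈ k.support, meromorphicOrderAt (fun z => (z - x) ^ k x) z =
        (((if x = z then k x else 0 : ℤ)) : WithTop ℤ) := by
      intro x _
      split_ifs with h
      · subst h; exact fun_meromorphicOrderAt_zpow_id_sub_const
      · have h2 : AnalyticAt ℂ (fun z : ℂ => z - x) z := by fun_prop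
        have h3 : (z - x) ≠ 0 := sub_ne_zero.2 (Ne.symm h)
        have h4 := (h2.zpow (n := k x) h3)
        have h5 : (fun z : ℂ => (z - x) ^ k x) z ≠ 0 := zpow_ne_zero _ h3
        have h6 := (h4.meromorphicNFAt.meromorphicOrderAt_eq_zero_iff).2 h5
        exact h6
    rw [Finset.sum_congr rfl h1]
    by_cases hz : z ∈ k.support
    · have : ∑ x ∈ k.support, (((if x = z then k x else 0 : ℤ)) : WithTop ℤ) =
          ((∑ x ∈ k.support, (if x = z then k x else 0) : ℤ) : WithTop ℤ) := by norm_cast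
      rw [this, Finset.sum_ite_eq' k.support z k, if_pos hz]
    · rw [Finset.sum_eq_zero, Finsupp.notMem_support_iff.1 hz]
      · rfl
      · intro x hx
        rw [if_neg]
        · rfl
        · rintro rfl; exact hz hx
  have hfac' : ∀ x : ℂ, MeromorphicAt (fun w : ℂ => (w⁻¹ - x) ^ k x) 0 := fun x => by
    have : MeromorphicAt (fun w : ℂ => w⁻¹ - x) 0 := by fun_prop
    exact this.zpow _
  have hPinf : meromorphicOrderAt (fun w => P w⁻¹) 0 = ((-(k.sum fun _ n => n) : ℤ) : WithTop ℤ) := by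
    rw [hP]
    simp only
    rw [meromorphicOrderAt_fun_prod fun x _ => hfac' x]
    have h1 : ∀ x ∈ k.support, meromorphicOrderAt (fun w : ℂ => (w⁻¹ - x) ^ k x) 0 =
        ((-k x : ℤ) : WithTop ℤ) := by
      intro x _
      rw [fun_meromorphicOrderAt_zpow (by fun_prop), meromorphicOrderAt_inv_sub]
      norm_cast
      rw [show Int.negSucc 0 = -1 from rfl, mul_neg, mul_one]
    rw [Finset.sum_congr rfl h1, Finsupp.sum, ← Finset.sum_neg_distrib]
    norm_cast
  have hPinfm : MeromorphicAt (fun w => P w⁻¹) 0 := MeromorphicAt.fun_prod fun x _ => hfac' x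
  have key := meromorphicOrderAt_eq_top_of_nonneg (h := fun z => g z * P z)
    (fun z => (hm z).mul (hPm z)) (fun z => ?_) ?_ z
  · rw [fun_meromorphicOrderAt_mul (hm z) (hPm z), hPo z] at key
    by_contra h
    obtain ⟨a, ha⟩ := WithTop.ne_top_iff_exists.1 h
    rw [← ha, ← WithTop.coe_add] at key
    exact WithTop.coe_ne_top key
  · rw [fun_meromorphicOrderAt_mul (hm z) (hPm z), hPo z]
    calc (0 : WithTop ℤ) = ((-k z : ℤ) : WithTop ℤ) + (k z : ℤ) := by norm_cast; simp
      _ ≤ _ := by gcongr; exact hk z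
  · rw [fun_meromorphicOrderAt_mul hminf hPinfm, hPinf]
    by_cases h : meromorphicOrderAt (fun w => g w⁻¹) 0 = ⊤
    · rw [h, WithTop.top_add]
      exact WithTop.coe_lt_top 0
    · obtain ⟨a, ha⟩ := WithTop.ne_top_iff_exists.1 h
      rw [← ha] at hinf ⊢
      have h1 : (k.sum fun _ n => n) < a := by exact_mod_cast hinf
      have h2 : 0 < a + -(k.sum fun _ n => n) := by linarith
      exact_mod_cast h2

end Liouville

/-! ### Divisors of meromorphic functions on the sphere. -/

namespace HolBundle

open RiemannSphere

theorem merAt_coe_iff {g : RiemannSphere → ℂ} {z : ℂ} :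
    MerAt g z ↔ MeromorphicAt (fun w : ℂ => g w) z := by
  have h1 : MerAt g z ↔ MeromorphicAt (fun w => g (loc z w)) (pos z) := Iff.rfl
  simp only [h1, loc_coe, pos_coe]

theorem orderAt_coe (g : RiemannSphere → ℂ) (z : ℂ) :
    orderAt g z = meromorphicOrderAt (fun w : ℂ => g w) z := by
  have h1 : orderAt g z = meromorphicOrderAt (fun w => g (loc z w)) (pos z) := rfl
  simp only [h1, loc_coe, pos_coe]

theorem loc_infty_eventuallyEq (g : RiemannSphere → ℂ) :
    (fun w => g (loc OnePoint.infty w)) =ᶠ[𝓝[≠] 0] fun w : ℂ => g ((w⁻¹ : ℂ) : RiemannSphere) := by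
  filter_upwards [self_mem_nhdsWithin] with w hw
  rw [loc_infty, invFun_coe hw]

theorem merAt_infty_iff {g : RiemannSphere → ℂ} :
    MerAt g OnePoint.infty ↔ MeromorphicAt (fun w : ℂ => g ((w⁻¹ : ℂ) : RiemannSphere)) 0 := by
  have h1 : MerAt g OnePoint.infty ↔
    MeromorphicAt (fun w => g (loc OnePoint.infty w)) (pos OnePoint.infty) := Iff.rfl
  rw [h1, pos_infty]
  exact MeromorphicAt.meromorphicAt_congr (loc_infty_eventuallyEq g)

theorem orderAt_infty (g : RiemannSphere → ℂ) :
    orderAt g OnePoint.infty =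
      meromorphicOrderAt (fun w : ℂ => g ((w⁻¹ : ℂ) : RiemannSphere)) 0 := by
  have h1 : orderAt g OnePoint.infty =
    meromorphicOrderAt (fun w => g (loc OnePoint.infty w)) (pos OnePoint.infty) := rfl
  rw [h1, pos_infty]
  exact meromorphicOrderAt_congr (loc_infty_eventuallyEq g)

theorem sum_comapDomain_coe_add (k : RiemannSphere →₀ ℤ) :
    ((k.comapDomain ((↑) : ℂ → RiemannSphere) OnePoint.coe_injective.injOn).sum fun _ n => n) +
      k OnePoint.infty = k.sum fun _ n => n := by
  classical
  have h1 : k = Finsupp.single OnePoint.infty (k OnePoint.infty) +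
      (k.comapDomain ((↑) : ℂ → RiemannSphere) OnePoint.coe_injective.injOn).mapDomain (↑) := by
    ext x
    rw [Finsupp.add_apply]
    induction x using OnePoint.rec with
    | infty =>
      rw [Finsupp.single_eq_same, Finsupp.mapDomain_of_notMem_range _ _ (by simp), add_zero]
    | coe z =>
      rw [Finsupp.single_eq_of_ne (by simp), Finsupp.mapDomain_apply OnePoint.coe_injective, zero_add]
      rfl
  conv_rhs => rw [h1]
  rw [Finsupp.sum_add_index' (by simp) (by simp), Finsupp.sum_single_index rfl,
    Finsupp.sum_mapDomain_index (by simp) (by simp), add_comm]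

/-- A line bundle of negative degree has no nonzero section. The point `∞` is split off from `k`,
and the affine version applies. -/
theorem orderAt_eq_top_of_divisor {g : RiemannSphere → ℂ} (hm : ∀ x, MerAt g x)
    (k : RiemannSphere →₀ ℤ) (hk : ∀ x, ((-k x : ℤ) : WithTop ℤ) ≤ orderAt g x)
    (hsum : (k.sum fun _ n => n) < 0) (z : ℂ) : orderAt g z = ⊤ := by
  rw [orderAt_coe]
  refine meromorphicOrderAt_eq_top_of_divisor (g := fun w : ℂ => g w)
    (fun w => merAt_coe_iff.1 (hm w))
    (k.comapDomain (↑) OnePoint.coe_injective.injOn) (fun w => ?_) (merAt_infty_iff.1 (hm _)) ?_ z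
  · rw [← orderAt_coe]; exact hk w
  · rw [← orderAt_infty]
    refine lt_of_lt_of_le ?_ (hk OnePoint.infty)
    have := sum_comapDomain_coe_add k
    have h2 : ((k.comapDomain ((↑) : ℂ → RiemannSphere) OnePoint.coe_injective.injOn).sum
      fun _ n => n) < -k OnePoint.infty := by linarith
    exact_mod_cast h2

/-- The divisor of a meromorphic function has degree zero. -/
theorem sum_orderAt_eq_zero {g : RiemannSphere → ℂ} (hm : ∀ x, MerAt g x)
    (D : RiemannSphere →₀ ℤ) (hD : ∀ x, orderAt g x = D x) : (D.sum fun _ n => n) = 0 := by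
  by_contra h
  -- If the degree is negative then `1 / g`, and if it is positive then `g`, would have its poles
  -- bounded by a divisor of negative degree and so vanish, although its order is finite.
  rcases lt_or_gt_of_ne h with h | h
  · have h1 := orderAt_eq_top_of_divisor (g := fun y => (g y)⁻¹) (fun x => (hm x).inv) D
      (fun x => le_of_eq ?_) h 0
    · have h2 : orderAt (fun y => (g y)⁻¹) ((0 : ℂ) : RiemannSphere) =
        -orderAt g ((0 : ℂ) : RiemannSphere) := meromorphicOrderAt_inv
      rw [h2, hD] at h1
      exact absurd h1 (by rw [← WithTop.LinearOrderedAddCommGroup.coe_neg]; exact WithTop.coe_ne_top)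
    · have h2 : orderAt (fun y => (g y)⁻¹) x = -orderAt g x := meromorphicOrderAt_inv
      rw [h2, hD, WithTop.LinearOrderedAddCommGroup.coe_neg]
  · have h1 := orderAt_eq_top_of_divisor hm (-D) (fun x => by rw [hD]; simp)
      (by rw [Finsupp.sum_neg_index (by simp), Finsupp.sum, Finset.sum_neg_distrib]
          rw [Finsupp.sum] at h
          linarith) 0
    rw [hD] at h1
    exact absurd h1 WithTop.coe_ne_top

end HolBundle

/-! ### Determinant divisors and the degree of a split bundle. -/

namespace HolBundle

open RiemannSphere

section Meromorphic

variable {x : RiemannSphere} {g g' : RiemannSphere → ℂ}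

theorem merAt_iff_loc : MerAt g x ↔ MeromorphicAt (fun z => g (loc x z)) (pos x) := Iff.rfl

theorem orderAt_eq_loc (g : RiemannSphere → ℂ) (x : RiemannSphere) :
    orderAt g x = meromorphicOrderAt (fun z => g (loc x z)) (pos x) := rfl

theorem HolAt.merAt (h : HolAt g x) : MerAt g x := (holAt_iff.1 h).meromorphicAt

theorem MerAt.congr (h : MerAt g x) (h' : ∀ᶠ y in 𝓝[≠] x, g y = g' y) : MerAt g' x :=
  MeromorphicAt.congr h (eventually_nhdsNE_iff.1 h')

theorem orderAt_congr (h' : ∀ᶠ y in 𝓝[≠] x, g y = g' y) : orderAt g x = orderAt g' x :=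
  meromorphicOrderAt_congr (eventually_nhdsNE_iff.1 h')

theorem orderAt_mul (h : MerAt g x) (h' : MerAt g' x) :
    orderAt (fun y => g y * g' y) x = orderAt g x + orderAt g' x :=
  fun_meromorphicOrderAt_mul h h'

theorem orderAt_inv (g : RiemannSphere → ℂ) (x : RiemannSphere) :
    orderAt (fun y => (g y)⁻¹) x = -orderAt g x :=
  fun_meromorphicOrderAt_inv

theorem MerAt.mul (h : MerAt g x) (h' : MerAt g' x) : MerAt (fun y => g y * g' y) x :=
  MeromorphicAt.mul h h'

theorem MerAt.inv (h : MerAt g x) : MerAt (fun y => (g y)⁻¹) x :=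
  MeromorphicAt.inv h

theorem MerAt.sum {ι : Type*} {s : Finset ι} {g : ι → RiemannSphere → ℂ}
    (h : ∀ i ∈ s, MerAt (g i) x) : MerAt (fun y => ∑ i ∈ s, g i y) x :=
  MeromorphicAt.fun_sum h

theorem MerAt.prod {ι : Type*} {s : Finset ι} {g : ι → RiemannSphere → ℂ}
    (h : ∀ i ∈ s, MerAt (g i) x) : MerAt (fun y => ∏ i ∈ s, g i y) x :=
  MeromorphicAt.fun_prod h

theorem MerAt.det {n : ℕ} {M : RiemannSphere → Matrix (Fin n) (Fin n) ℂ}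
    (h : ∀ i j, MerAt (fun y => M y i j) x) : MerAt (fun y => (M y).det) x := by
  simp only [Matrix.det_apply']
  exact MerAt.sum fun σ _ => (HolAt.merAt (holAt_const _ x)).mul (MerAt.prod fun i _ => h _ _)

theorem MerAt.adjugate {n : ℕ} {M : RiemannSphere → Matrix (Fin n) (Fin n) ℂ}
    (h : ∀ i j, MerAt (fun y => M y i j) x) (i j : Fin n) :
    MerAt (fun y => (M y).adjugate i j) x := by
  simp only [Matrix.adjugate_apply]
  refine MerAt.det fun k l => ?_
  by_cases hk : k = j
  · subst hk; simpa using HolAt.merAt (holAt_const _ x)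
  · simpa [Matrix.updateRow_ne hk] using h k l

theorem MerAt.matrix_inv {n : ℕ} {M : RiemannSphere → Matrix (Fin n) (Fin n) ℂ}
    (h : ∀ i j, MerAt (fun y => M y i j) x) (i j : Fin n) : MerAt (fun y => (M y)⁻¹ i j) x := by
  have : (fun y => (M y)⁻¹ i j) = fun y => ((M y).det)⁻¹ * (M y).adjugate i j := by
    funext y
    rw [Matrix.inv_def]
    simp
  rw [this]
  exact (MerAt.det h).inv.mul (MerAt.adjugate h i j)

theorem HolAt.orderAt_eq_zero (h : HolAt g x) (h0 : g x ≠ 0) : orderAt g x = 0 := by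
  have h1 := (holAt_iff.1 h).meromorphicNFAt.meromorphicOrderAt_eq_zero_iff
  exact h1.2 (by simpa only [loc_pos] using h0)

theorem HolAt.orderAt_nonneg (h : HolAt g x) : 0 ≤ orderAt g x :=
  (holAt_iff.1 h).meromorphicOrderAt_nonneg

theorem MerAt.eventually_ne_zero (h : MerAt g x) (h0 : orderAt g x ≠ ⊤) :
    ∀ᶠ y in 𝓝[≠] x, g y ≠ 0 :=
  eventually_nhdsNE_iff.2 ((meromorphicOrderAt_ne_top_iff_eventually_ne_zero h).1 h0)

/-- A meromorphic function is the quotient of a holomorphic function by a power of the local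
coordinate. -/
theorem MerAt.exists_holAt (h : MerAt g x) : ∃ (k : ℕ) (g' : RiemannSphere → ℂ), HolAt g' x ∧
    ∀ y, g' y = (chartAt ℂ x y - pos x) ^ k * g (loc x (chartAt ℂ x y)) := by
  obtain ⟨k, hk⟩ := h
  refine ⟨k, _, ?_, fun y => rfl⟩
  rw [holAt_iff]
  simp only [chartAt_loc]
  exact hk

theorem eventually_loc_chartAt (x : RiemannSphere) : ∀ᶠ y in 𝓝 x, loc x (chartAt ℂ x y) = y := by
  rw [eventually_nhds_iff]
  exact Filter.Eventually.of_forall fun z => by rw [chartAt_loc]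

theorem MerAt.exists_holAt_uniform {ι : Type*} [Finite ι] {g : ι → RiemannSphere → ℂ}
    (h : ∀ i, MerAt (g i) x) : ∃ k : ℕ, ∀ i, ∃ g' : RiemannSphere → ℂ, HolAt g' x ∧
      ∀ᶠ y in 𝓝 x, g' y = (chartAt ℂ x y - pos x) ^ k * g i y := by
  have := Fintype.ofFinite ι
  choose k g' hg' hk using fun i => (h i).exists_holAt
  refine ⟨∑ i, k i, fun i => ⟨fun y => (∏ j ∈ Finset.range (∑ i, k i - k i),
    (chartAt ℂ x y - pos x)) * g' i y, (HolAt.prod fun _ _ => holAt_localCoord x).mul (hg' i), ?_⟩⟩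
  filter_upwards [eventually_loc_chartAt x] with y hy
  rw [hk, hy, Finset.prod_const, Finset.card_range, ← mul_assoc, ← pow_add, Nat.sub_add_cancel]
  exact Finset.single_le_sum (f := k) (fun _ _ => Nat.zero_le _) (Finset.mem_univ i)

theorem eventually_localCoord_ne_zero (x : RiemannSphere) :
    ∀ᶠ y in 𝓝[≠] x, chartAt ℂ x y - pos x ≠ 0 := by
  rw [eventually_nhdsNE_iff]
  filter_upwards [self_mem_nhdsWithin] with z hz
  rw [chartAt_loc]
  exact sub_ne_zero.2 hz

theorem orderAt_localCoord_pow (x : RiemannSphere) (k : ℕ) :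
    orderAt (fun y => (chartAt ℂ x y - pos x) ^ k) x = (k : ℤ) := by
  rw [orderAt_eq_loc]
  simp only [chartAt_loc]
  have := fun_meromorphicOrderAt_zpow_id_sub_const (x := pos x) (n := (k : ℤ))
  simpa only [zpow_natCast] using this

theorem merAt_localCoord_pow (x : RiemannSphere) (k : ℕ) :
    MerAt (fun y => (chartAt ℂ x y - pos x) ^ k) x := by
  have := HolAt.merAt (HolAt.prod (s := Finset.range k) fun _ _ => holAt_localCoord x)
  simpa only [Finset.prod_const, Finset.card_range] using this

theorem twistFactor_loc_infty (e : ℤ) {w : ℂ} (hw : w ≠ 0) :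
    twistFactor e (loc OnePoint.infty w) = (w - 0) ^ (-e) := by
  rw [loc_infty, invFun_coe hw, twistFactor_coe, inv_zpow', sub_zero]

theorem orderAt_twistFactor (e : ℤ) : orderAt (twistFactor e) OnePoint.infty = (-e : ℤ) := by
  rw [orderAt_eq_loc, pos_infty, ← fun_meromorphicOrderAt_zpow_id_sub_const (x := (0 : ℂ))]
  refine meromorphicOrderAt_congr ?_
  filter_upwards [self_mem_nhdsWithin] with w hw using twistFactor_loc_infty e hw

theorem merAt_twistFactor (e : ℤ) : MerAt (twistFactor e) OnePoint.infty := by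
  rw [merAt_iff_loc, pos_infty]
  have h1 : MeromorphicAt (fun w : ℂ => w - 0) 0 := by fun_prop
  refine (h1.zpow (-e)).congr ?_
  filter_upwards [self_mem_nhdsWithin] with w hw using (twistFactor_loc_infty e hw).symm

end Meromorphic

variable {n r : ℕ} {E : HolBundle.{u} n} {L : ∀ y, Submodule ℂ (E.fiber y)}

/-- Two frames differ by a holomorphic matrix with nonvanishing determinant, which does not affect
the order of the determinant. -/
theorem HasDetOrderAt.exists_of_frame {s : Fin r → ∀ y, E.fiber y} {x : RiemannSphere} {k : ℤ}
    (h : E.HasDetOrderAt L s x k) {f : Fin r → ∀ y, E.fiber y} (hf : E.IsFrameAt L f x) :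
    ∃ M : RiemannSphere → Matrix (Fin r) (Fin r) ℂ, (∀ i j, MerAt (fun y => M y i j) x) ∧
      (∀ᶠ y in 𝓝[≠] x, ∀ i, s i y = ∑ j, M y i j • f j y) ∧ orderAt (fun y => (M y).det) x = k := by
  obtain ⟨f', M, hf', hM, hs, ho⟩ := h
  obtain ⟨κ, h1, h2⟩ := exists_coordinates hf.hol hf.linearIndependent.self_of_nhds
  set H : RiemannSphere → Matrix (Fin r) (Fin r) ℂ := fun y i j => κ y (f' i y) j with hH
  have hHhol : ∀ i j, HolAt (fun y => H y i j) x := fun i j =>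
    holAt_pi.1 (h2.self_of_nhds _ (hf'.hol i)) j
  have hfH : ∀ᶠ y in 𝓝 x, ∀ i, f' i y = ∑ j, H y i j • f j y := by
    filter_upwards [h1, hf.span_eq, hf'.span_eq] with y h1 h2 h3 i
    have h4 : f' i y ∈ Submodule.span ℂ (Set.range fun i => f i y) := by
      rw [h2, ← h3]; exact Submodule.subset_span ⟨i, rfl⟩
    obtain ⟨c, hc⟩ := (Submodule.mem_span_range_iff_exists_fun ℂ).1 h4
    have h5 : κ y (f' i y) = c := by rw [← hc, h1]
    rw [← hc]
    simp only [hH, h5]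
  have hdet : (H x).det ≠ 0 := by
    intro h0
    obtain ⟨v, hv, hv0⟩ := Matrix.exists_vecMul_eq_zero_iff.2 h0
    refine hv (funext fun i => ?_)
    refine Fintype.linearIndependent_iff.1 hf'.linearIndependent.self_of_nhds v ?_ i
    calc ∑ i, v i • f' i x = ∑ i, ∑ j, (v i * H x i j) • f j x := by
          refine Finset.sum_congr rfl fun i _ => ?_
          rw [hfH.self_of_nhds i, Finset.smul_sum]
          simp only [mul_smul]
      _ = ∑ j, (Matrix.vecMul v (H x) j) • f j x := by
          rw [Finset.sum_comm]
          refine Finset.sum_congr rfl fun j _ => ?_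
          rw [← Finset.sum_smul]; rfl
      _ = 0 := by simp [hv0]
  refine ⟨fun y => M y * H y, fun i j => ?_, ?_, ?_⟩
  · simp only [Matrix.mul_apply]
    exact MerAt.sum fun l _ => (hM i l).mul (HolAt.merAt (hHhol l j))
  · filter_upwards [hs, hfH.filter_mono nhdsWithin_le_nhds] with y h3 h4 i
    rw [h3 i]
    simp only [Matrix.mul_apply, Finset.sum_smul]
    rw [Finset.sum_comm]
    refine Finset.sum_congr rfl fun l _ => ?_
    rw [h4 l, Finset.smul_sum]
    simp only [mul_smul]
  · simp only [Matrix.det_mul]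
    rw [orderAt_mul (MerAt.det hM) (HolAt.merAt (HolAt.det hHhol)), ho,
      HolAt.orderAt_eq_zero (HolAt.det hHhol) hdet, add_zero]

theorem exists_leftInverse_family {F : Type*} [AddCommGroup F] [Module ℂ F] {b : Fin r → F}
    (h : LinearIndependent ℂ b) : ∃ κ : F →ₗ[ℂ] (Fin r → ℂ), ∀ c, κ (∑ i, c i • b i) = c := by
  obtain ⟨κ, hκ⟩ := (Fintype.linearCombination ℂ b).exists_leftInverse_of_injective
    (LinearMap.ker_eq_bot.2 (linearIndependent_iff_injective_fintypeLinearCombination.1 h))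
  refine ⟨κ, fun c => ?_⟩
  have := LinearMap.congr_fun hκ c
  simpa [Fintype.linearCombination_apply] using this

/-- The determinant of `t` in the global frame `b` is a meromorphic function on the sphere. Its
divisor is `D` minus `∑ i, d i` times the point `∞`, and has degree zero. In particular the degree
does not depend on the chosen meromorphic section. -/
theorem IsSplitFrame.sum_eq {b : Fin r → ∀ y, E.fiber y} {d : Fin r → ℤ}
    (h : E.IsSplitFrame L b d) {D : RiemannSphere →₀ ℤ} (hD : E.IsDetDivisor L r D) :
    (D.sum fun _ k => k) = ∑ i, d i := by
  classical
  obtain ⟨t, ht⟩ := hD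
  choose κ hκ using fun y => exists_leftInverse_family (h.linearIndependent y)
  set G : RiemannSphere → Matrix (Fin r) (Fin r) ℂ := fun y i j => κ y (t i y) j with hG
  have hcoe : ∀ z : ℂ, MerAt (fun y => (G y).det) z ∧ orderAt (fun y => (G y).det) z = D z := by
    intro z
    obtain ⟨M, hM, hs, ho⟩ := (ht z).exists_of_frame (h.coe z)
    have hGM : ∀ᶠ y in 𝓝[≠] (z : RiemannSphere), (M y).det = (G y).det := by
      filter_upwards [hs] with y hy
      congr 1
      ext i j
      rw [hG]
      simp only
      rw [hy i, hκ]
    exact ⟨(MerAt.det hM).congr hGM, by rw [← orderAt_congr hGM, ho]⟩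
  have hinf : MerAt (fun y => (G y).det) OnePoint.infty ∧
      orderAt (fun y => (G y).det) OnePoint.infty = ((D OnePoint.infty - ∑ i, d i : ℤ) : WithTop ℤ) := by
    obtain ⟨M, hM, hs, ho⟩ := (ht _).exists_of_frame h.infty
    have hprod : (fun y => ∏ i, twistFactor (d i) y) =ᶠ[𝓝[≠] OnePoint.infty]
        twistFactor (∑ i, d i) := by
      filter_upwards [eventually_ne_zero_infty.filter_mono nhdsWithin_le_nhds] with y hy
      have : ∀ s : Finset (Fin r), ∏ i ∈ s, twistFactor (d i) y = twistFactor (∑ i ∈ s, d i) y := by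
        intro s
        induction s using Finset.induction_on with
        | empty =>
          induction y using OnePoint.rec with
          | infty => simp
          | coe z => simp
        | insert a s ha ih =>
          rw [Finset.prod_insert ha, Finset.sum_insert ha, ih, twistFactor_add _ _ hy]
      exact this _
    have hGM : ∀ᶠ y in 𝓝[≠] (OnePoint.infty : RiemannSphere),
        (M y).det * twistFactor (∑ i, d i) y = (G y).det := by
      filter_upwards [hs, hprod] with y hy hp
      rw [← hp]
      have : G y = M y * Matrix.diagonal fun i => twistFactor (d i) y := by
        ext i j
        rw [Matrix.mul_diagonal, hG]
        simp only
        rw [hy i]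
        simp only [twist_apply, smul_smul]
        rw [hκ]
      rw [this, Matrix.det_mul, Matrix.det_diagonal]
    refine ⟨((MerAt.det hM).mul (merAt_twistFactor _)).congr hGM, ?_⟩
    rw [← orderAt_congr hGM, orderAt_mul (MerAt.det hM) (merAt_twistFactor _), ho,
      orderAt_twistFactor, sub_eq_add_neg]
    norm_cast
  have key := sum_orderAt_eq_zero (g := fun y => (G y).det) (fun x => by
    induction x using OnePoint.rec with
    | infty => exact hinf.1
    | coe z => exact (hcoe z).1) (D - Finsupp.single OnePoint.infty (∑ i, d i)) (fun x => by
    induction x using OnePoint.rec with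
    | infty => rw [hinf.2, Finsupp.sub_apply, Finsupp.single_eq_same]
    | coe z => rw [(hcoe z).2, Finsupp.sub_apply, Finsupp.single_eq_of_ne (by simp), sub_zero])
  rw [Finsupp.sum_sub_index (by simp), Finsupp.sum_single_index rfl] at key
  linarith

theorem IsSplitFrame.isDetDivisor {b : Fin r → ∀ y, E.fiber y} {d : Fin r → ℤ}
    (h : E.IsSplitFrame L b d) :
    E.IsDetDivisor L r (Finsupp.single OnePoint.infty (∑ i, d i)) := by
  classical
  refine ⟨b, fun x => ?_⟩
  induction x using OnePoint.rec with
  | infty =>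
    refine ⟨_, fun y => Matrix.diagonal fun i => twistFactor (-d i) y, h.infty, fun i j => ?_, ?_, ?_⟩
    · by_cases hij : i = j
      · subst hij
        simpa using merAt_twistFactor (-d i)
      · simpa [Matrix.diagonal_apply_ne _ hij] using HolAt.merAt (holAt_const (0 : ℂ) OnePoint.infty)
    · filter_upwards [eventually_ne_zero_infty.filter_mono nhdsWithin_le_nhds] with y hy i
      rw [Finset.sum_eq_single i (fun j _ hj => by
        rw [Matrix.diagonal_apply_ne _ (Ne.symm hj), zero_smul]) (by simp), Matrix.diagonal_apply_eq,
        twist_apply, smul_smul, ← twistFactor_add _ _ hy, neg_add_cancel]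
      have : twistFactor 0 y = 1 := by
        induction y using OnePoint.rec with
        | infty => rfl
        | coe z => simp
      rw [this, one_smul]
    · simp only [Matrix.det_diagonal]
      rw [Finsupp.single_eq_same]
      have : orderAt (fun y => ∏ i, twistFactor (-d i) y) OnePoint.infty =
          ∑ i, orderAt (twistFactor (-d i)) OnePoint.infty :=
        meromorphicOrderAt_fun_prod fun i _ => merAt_twistFactor _
      rw [this]
      simp only [orderAt_twistFactor, neg_neg]
      norm_cast
  | coe z =>
    refine ⟨b, fun _ => 1, h.coe z, fun i j => HolAt.merAt (holAt_const _ _),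
      Filter.Eventually.of_forall fun y i => ?_, ?_⟩
    · change b i y = ∑ j, (1 : Matrix (Fin r) (Fin r) ℂ) i j • b j y
      rw [Finset.sum_eq_single i (fun j _ hj => by
        rw [Matrix.one_apply_ne (Ne.symm hj), zero_smul]) (by simp), Matrix.one_apply_eq, one_smul]
    · simp only [Matrix.det_one]
      rw [Finsupp.single_eq_of_ne (by simp)]
      exact HolAt.orderAt_eq_zero (holAt_const 1 _) one_ne_zero

theorem IsSplitFrame.subDegree_eq {b : Fin r → ∀ y, E.fiber y} {d : Fin r → ℤ}
    (h : E.IsSplitFrame L b d) : E.subDegree L r = ∑ i, d i := by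
  have hex : ∃ D, E.IsDetDivisor L r D := ⟨_, h.isDetDivisor⟩
  rw [subDegree, dif_pos hex]
  exact h.sum_eq hex.choose_spec

end HolBundle

/-! ### Birkhoff–Grothendieck from a meromorphic section of the determinant. -/

namespace HolBundle

open RiemannSphere

variable {n r : ℕ} {E : HolBundle.{u} n}

theorem eventually_nhdsNE_nhds {x : RiemannSphere} {P : RiemannSphere → Prop}
    (h : ∀ᶠ y in 𝓝[≠] x, P y) : ∀ᶠ y in 𝓝[≠] x, ∀ᶠ y' in 𝓝 y, P y' := by
  have h1 := eventually_eventually_nhdsWithin.2 h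
  filter_upwards [h1, self_mem_nhdsWithin] with y hy hy'
  rwa [isOpen_compl_singleton.nhdsWithin_eq hy'] at hy

theorem SectionHolAt.eq_of_nhdsNE {x : RiemannSphere} {s s' : ∀ y, E.fiber y}
    (h : E.SectionHolAt s x) (h' : E.SectionHolAt s' x) (heq : ∀ᶠ y in 𝓝[≠] x, s y = s' y) :
    s x = s' x := by
  have h1 := (h.add (SectionHolAt.smul (holAt_const (-1) _) h')).eq_zero_of_nhdsNE (by
    filter_upwards [heq] with y hy
    rw [hy, neg_one_smul, add_neg_cancel])
  rwa [neg_one_smul, add_neg_eq_zero] at h1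

theorem holAt_twistFactor (e : ℤ) {z : ℂ} (hz : z ≠ 0) :
    HolAt (twistFactor e) (z : RiemannSphere) := by
  rw [holAt_iff]
  simp only [loc_coe, twistFactor_coe, pos_coe]
  exact analyticAt_id.zpow hz

/-- A section with removable singularities extends. -/
theorem exists_patch {s₀ : ∀ y, E.fiber y} (e : ℤ)
    (h : ∀ z : ℂ, ∃ σ, E.SectionHolAt σ z ∧ ∀ᶠ y in 𝓝[≠] (z : RiemannSphere), σ y = s₀ y)
    (hinf : ∃ σ, E.SectionHolAt σ OnePoint.infty ∧
      ∀ᶠ y in 𝓝[≠] OnePoint.infty, σ y = twistFactor e y • s₀ y) :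
    ∃ m : ∀ y, E.fiber y, (∀ z : ℂ, E.SectionHolAt m z) ∧
      E.SectionHolAt (twist e m) OnePoint.infty ∧ (∀ x, ∀ᶠ y in 𝓝[≠] x, m y = s₀ y) ∧
      ∀ z : ℂ, E.SectionHolAt s₀ z → m z = s₀ z := by
  classical
  have hall : ∀ x : RiemannSphere, ∃ σ, E.SectionHolAt σ x ∧ ∀ᶠ y in 𝓝[≠] x,
      σ y = (if x = OnePoint.infty then twistFactor e y else 1) • s₀ y := by
    intro x
    induction x using OnePoint.rec with
    | infty => simpa using hinf
    | coe z => simpa using h z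
  choose σ hσ hσ' using hall
  have hσz : ∀ z : ℂ, ∀ᶠ y in 𝓝[≠] (z : RiemannSphere), σ z y = s₀ y := fun z => by
    simpa using hσ' z
  have hσinf : ∀ᶠ y in 𝓝[≠] OnePoint.infty, σ OnePoint.infty y = twistFactor e y • s₀ y := by
    simpa using hσ' OnePoint.infty
  -- The patched section takes at `y` the value of the extension chosen at `y` itself. Near `z` this
  -- agrees with the single extension chosen at `z`, since two holomorphic extensions of the same
  -- punctured germ coincide.
  have hmz : ∀ z : ℂ, ∀ᶠ y in 𝓝 (z : RiemannSphere), σ y y = σ z y := by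
    intro z
    have h1 : ∀ᶠ y in 𝓝[≠] (z : RiemannSphere), σ y y = σ z y := by
      filter_upwards [eventually_nhdsNE_nhds (hσz z),
        (hσ z).eventually.filter_mono nhdsWithin_le_nhds,
        (eventually_ne_infty z).filter_mono nhdsWithin_le_nhds] with y hy1 hy2 hy3
      induction y using OnePoint.rec with
      | infty => exact absurd rfl hy3
      | coe w =>
        refine (hσ w).eq_of_nhdsNE hy2 ?_
        filter_upwards [hσz w, hy1.filter_mono nhdsWithin_le_nhds] with y h h'
        rw [h, h']
    rw [eventually_nhdsWithin_iff] at h1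
    filter_upwards [h1] with y hy
    by_cases hyz : y = z
    · rw [hyz]
    · exact hy hyz
  have hminf : ∀ᶠ y in 𝓝[≠] OnePoint.infty, twistFactor e y • σ y y = σ OnePoint.infty y := by
    filter_upwards [eventually_nhdsNE_nhds hσinf,
      (hσ OnePoint.infty).eventually.filter_mono nhdsWithin_le_nhds, self_mem_nhdsWithin,
      eventually_ne_zero_infty.filter_mono nhdsWithin_le_nhds] with y hy1 hy2 hy3 hy4
    induction y using OnePoint.rec with
    | infty => exact absurd rfl hy3
    | coe w =>
      have hw : w ≠ 0 := fun h => hy4 (by rw [h])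
      refine (SectionHolAt.smul (holAt_twistFactor e hw) (hσ w)).eq_of_nhdsNE hy2 ?_
      filter_upwards [hσz w, hy1.filter_mono nhdsWithin_le_nhds] with y h h'
      rw [h, h']
  refine ⟨fun y => σ y y, fun z => (hσ z).congr (hmz z), (hσ OnePoint.infty).congr ?_, fun x => ?_,
    fun z hz => (hσ z).eq_of_nhdsNE hz (hσz z)⟩
  · rw [eventually_nhdsWithin_iff] at hminf
    filter_upwards [hminf] with y hy
    by_cases hy' : y = OnePoint.infty
    · subst hy'; simp
    · exact hy hy'
  · induction x using OnePoint.rec with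
    | infty =>
      filter_upwards [hminf, hσinf, eventually_ne_zero_infty.filter_mono nhdsWithin_le_nhds]
        with y h1 h2 h3
      rw [h2] at h1
      exact smul_right_injective _ (twistFactor_ne_zero e h3) h1
    | coe z =>
      filter_upwards [(hmz z).filter_mono nhdsWithin_le_nhds, hσz z] with y h1 h2
      rw [h1, h2]

/-- The set has no accumulation point, and the sphere is compact. -/
theorem finite_of_eventually_notMem {S : Set RiemannSphere}
    (h : ∀ x, ∀ᶠ y in 𝓝[≠] x, y ∉ S) : S.Finite := by
  have h' : ∀ x, {y | y ≠ x → y ∉ S} ∈ 𝓝 x := fun x => eventually_nhdsWithin_iff.1 (h x)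
  obtain ⟨t, ht⟩ := CompactSpace.elim_nhds_subcover _ h'
  refine t.finite_toSet.subset fun x hx => ?_
  have h1 : x ∈ ⋃ a ∈ t, {y | y ≠ a → y ∉ S} := by rw [ht]; trivial
  simp only [mem_iUnion, exists_prop] at h1
  obtain ⟨a, ha, hxa⟩ := h1
  have : x = a := by
    by_contra hne
    exact hxa hne hx
  rw [this]; exact ha

/-- The matrix rows form a linearly independent family. -/
theorem linearIndependent_of_det_ne_zero {F : Type*} [AddCommGroup F] [Module ℂ F]
    {f t : Fin r → F} {M : Matrix (Fin r) (Fin r) ℂ} (hf : LinearIndependent ℂ f)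
    (ht : ∀ i, t i = ∑ j, M i j • f j) (hM : M.det ≠ 0) : LinearIndependent ℂ t := by
  rw [Fintype.linearIndependent_iff]
  intro v hv
  have h1 : ∑ j, (Matrix.vecMul v M j) • f j = 0 := by
    rw [← hv]
    simp only [ht, Finset.smul_sum, smul_smul]
    rw [Finset.sum_comm]
    refine Finset.sum_congr rfl fun j _ => ?_
    rw [← Finset.sum_smul]; rfl
  have h2 : Matrix.vecMul v M = 0 := funext (Fintype.linearIndependent_iff.1 hf _ h1)
  exact congrFun (Matrix.eq_zero_of_vecMul_eq_zero hM h2)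

section MeromorphicFrame

variable {t : Fin n → ∀ y, E.fiber y} {x : RiemannSphere} {k : ℤ}

theorem MerAt.eventually_holAt {g : RiemannSphere → ℂ} (h : MerAt g x) :
    ∀ᶠ y in 𝓝[≠] x, HolAt g y := by
  obtain ⟨k, hk⟩ := MerAt.exists_holAt_uniform (ι := Unit) (g := fun _ => g) fun _ => h
  obtain ⟨g', hg', hg''⟩ := hk ()
  have hζ : ∀ᶠ y in 𝓝 x, HolAt (fun y => ((chartAt ℂ x y - pos x) ^ k : ℂ)) y := by
    have := (HolAt.prod (s := Finset.range k) fun _ _ => holAt_localCoord x).eventually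
    simpa only [Finset.prod_const, Finset.card_range] using this
  filter_upwards [hg'.eventually.filter_mono nhdsWithin_le_nhds,
    hζ.filter_mono nhdsWithin_le_nhds, eventually_localCoord_ne_zero x,
    eventually_nhdsNE_nhds (eventually_localCoord_ne_zero x),
    eventually_nhdsNE_nhds (hg''.filter_mono nhdsWithin_le_nhds)] with y h1 h2 h3 h4 h5
  refine ((h2.inv (pow_ne_zero _ h3)).mul h1).congr ?_
  filter_upwards [h4, h5] with y' h4 h5
  rw [h5, ← mul_assoc, inv_mul_cancel₀ (pow_ne_zero _ h4), one_mul]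

theorem HasDetOrderAt.eventually_frame (h : E.HasDetOrderAt (fun _ => ⊤) t x k) :
    ∀ᶠ y in 𝓝[≠] x, (∀ i, E.SectionHolAt (t i) y) ∧ LinearIndependent ℂ fun i => t i y := by
  obtain ⟨f, M, hf, hM, hs, ho⟩ := h
  have hdet : ∀ᶠ y in 𝓝[≠] x, (M y).det ≠ 0 :=
    MerAt.eventually_ne_zero (MerAt.det hM) (by rw [ho]; exact WithTop.coe_ne_top)
  have hMhol : ∀ᶠ y in 𝓝[≠] x, ∀ i j, HolAt (fun y => M y i j) y :=
    Filter.eventually_all.2 fun i => Filter.eventually_all.2 fun j =>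
      MerAt.eventually_holAt (hM i j)
  filter_upwards [hdet, hMhol, hs, eventually_nhdsNE_nhds hs,
    hf.eventually.filter_mono nhdsWithin_le_nhds] with y h1 h2 h3 h4 h5
  refine ⟨fun i => ?_, linearIndependent_of_det_ne_zero h5.linearIndependent.self_of_nhds h3 h1⟩
  refine (SectionHolAt.sum (t := Finset.univ) fun j _ => SectionHolAt.smul (h2 i j) (h5.hol j)).congr ?_
  filter_upwards [h4] with y' h4 using h4 i

theorem HasDetOrderAt.exists_pow_smul (h : E.HasDetOrderAt (fun _ => ⊤) t x k) :
    ∃ k : ℕ, ∀ i, ∃ σ, E.SectionHolAt σ x ∧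
      ∀ᶠ y in 𝓝[≠] x, σ y = ((chartAt ℂ x y - pos x) ^ k : ℂ) • t i y := by
  obtain ⟨f, M, hf, hM, hs, ho⟩ := h
  obtain ⟨k, hk⟩ := MerAt.exists_holAt_uniform (g := fun (ij : Fin n × Fin n) y => M y ij.1 ij.2)
    fun ij => hM ij.1 ij.2
  choose N hN hN' using hk
  refine ⟨k, fun i => ⟨fun y => ∑ j, N (i, j) y • f j y,
    SectionHolAt.sum fun j _ => SectionHolAt.smul (hN _) (hf.hol j), ?_⟩⟩
  filter_upwards [hs, (Filter.eventually_all.2 hN').filter_mono nhdsWithin_le_nhds] with y h1 h2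
  rw [h1, Finset.smul_sum]
  refine Finset.sum_congr rfl fun j _ => ?_
  rw [h2, mul_smul]

/-- The exponent `k` bounds the poles of the inverse coefficient matrix, so one `k` serves all
holomorphic `s`. This uniformity is what bounds the orders at `∞`. -/
theorem HasDetOrderAt.exists_pow_mul_coordinates (h : E.HasDetOrderAt (fun _ => ⊤) t x k)
    {Ψ : ∀ y, E.fiber y →ₗ[ℂ] (Fin n → ℂ)}
    (hΨ : ∀ y, (LinearIndependent ℂ fun i => t i y) → ∀ c : Fin n → ℂ, Ψ y (∑ i, c i • t i y) = c) :
    ∃ k : ℕ, ∀ s, E.SectionHolAt s x → ∀ i, ∃ g : RiemannSphere → ℂ, HolAt g x ∧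
      ∀ᶠ y in 𝓝[≠] x, g y = (chartAt ℂ x y - pos x) ^ k * Ψ y (s y) i := by
  have hli := h.eventually_frame
  obtain ⟨f, M, hf, hM, hs, ho⟩ := h
  have hdet : ∀ᶠ y in 𝓝[≠] x, (M y).det ≠ 0 :=
    MerAt.eventually_ne_zero (MerAt.det hM) (by rw [ho]; exact WithTop.coe_ne_top)
  obtain ⟨κ, h1, h2⟩ := exists_coordinates hf.hol hf.linearIndependent.self_of_nhds
  obtain ⟨k, hk⟩ := MerAt.exists_holAt_uniform
    (g := fun (ij : Fin n × Fin n) y => (M y)⁻¹ ij.1 ij.2) fun ij => MerAt.matrix_inv hM ij.1 ij.2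
  choose N hN hN' using hk
  refine ⟨k, fun s hs' i => ⟨fun y => ∑ j, κ y (s y) j * N (j, i) y,
    HolAt.sum fun j _ => (holAt_pi.1 (h2.self_of_nhds s hs') j).mul (hN _), ?_⟩⟩
  filter_upwards [hs, hdet, hli, h1.filter_mono nhdsWithin_le_nhds,
    hf.span_eq.filter_mono nhdsWithin_le_nhds,
    (Filter.eventually_all.2 hN').filter_mono nhdsWithin_le_nhds] with y h1 h2 h3 h4 h5 h6
  have hmem : s y ∈ Submodule.span ℂ (Set.range fun i => f i y) := by rw [h5]; trivial
  obtain ⟨c, hc⟩ := (Submodule.mem_span_range_iff_exists_fun ℂ).1 hmem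
  have hκ : κ y (s y) = c := by rw [← hc, h4]
  have hst : s y = ∑ i, Matrix.vecMul c (M y)⁻¹ i • t i y := by
    have h7 : ∑ i, Matrix.vecMul c (M y)⁻¹ i • t i y =
        ∑ j, Matrix.vecMul (Matrix.vecMul c (M y)⁻¹) (M y) j • f j y := by
      simp only [h1, Finset.smul_sum, smul_smul]
      rw [Finset.sum_comm]
      refine Finset.sum_congr rfl fun j _ => ?_
      rw [← Finset.sum_smul]; rfl
    rw [h7, Matrix.vecMul_vecMul, Matrix.nonsing_inv_mul _ (isUnit_iff_ne_zero.2 h2),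
      Matrix.vecMul_one, hc]
  have hΨs : Ψ y (s y) = Matrix.vecMul c (M y)⁻¹ := by rw [hst, hΨ y h3.2]
  rw [hΨs, hκ, Matrix.vecMul, dotProduct, Finset.mul_sum]
  refine Finset.sum_congr rfl fun j _ => ?_
  rw [h6]
  ring

theorem le_orderAt_of_mul {g φ c : RiemannSphere → ℂ} {a : ℤ} (hg : HolAt g x) (hφ : MerAt φ x)
    (ha : orderAt φ x = a) (h : ∀ᶠ y in 𝓝[≠] x, g y = φ y * c y) :
    MerAt c x ∧ ((-a : ℤ) : WithTop ℤ) ≤ orderAt c x := by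
  have h1 : ∀ᶠ y in 𝓝[≠] x, (φ y)⁻¹ * g y = c y := by
    filter_upwards [h, MerAt.eventually_ne_zero hφ (by rw [ha]; exact WithTop.coe_ne_top)] with y h h'
    rw [h, ← mul_assoc, inv_mul_cancel₀ h', one_mul]
  refine ⟨(hφ.inv.mul (HolAt.merAt hg)).congr h1, ?_⟩
  rw [← orderAt_congr h1, orderAt_mul (MerAt.inv hφ) (HolAt.merAt hg), orderAt_inv, ha,
    WithTop.LinearOrderedAddCommGroup.coe_neg]
  exact le_add_of_nonneg_right (HolAt.orderAt_nonneg hg)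

theorem span_range_eq_top_of_linearIndependent {y : RiemannSphere} {v : Fin n → E.fiber y}
    (h : LinearIndependent ℂ v) : Submodule.span ℂ (Set.range v) = ⊤ := by
  refine Submodule.eq_top_of_finrank_eq ?_
  rw [finrank_span_eq_card h, Fintype.card_fin, finrank_fiber]

/-- If `det E` has a meromorphic section, the order at `∞` of the nonzero sections of `E` on `ℂ` is
bounded. -/
theorem exists_order_bound {D : RiemannSphere →₀ ℤ} (hD : E.IsDetDivisor (fun _ => ⊤) n D) :
    ∃ e₀ : ℤ, ∀ W e, e₀ ≤ e → E.sectionSpace W e = ⊥ := by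
  classical
  obtain ⟨t, ht⟩ := hD
  have hexΨ : ∀ y, ∃ Ψ : E.fiber y →ₗ[ℂ] (Fin n → ℂ), (LinearIndependent ℂ fun i => t i y) →
      ∀ c : Fin n → ℂ, Ψ (∑ i, c i • t i y) = c := by
    intro y
    by_cases h : LinearIndependent ℂ fun i => t i y
    · obtain ⟨κ, hκ⟩ := exists_leftInverse_family h
      exact ⟨κ, fun _ => hκ⟩
    · exact ⟨0, fun h' => absurd h' h⟩
  choose Ψ hΨ using hexΨ
  choose k hk using fun x => (ht x).exists_pow_mul_coordinates hΨ
  have hfin := finite_of_eventually_notMem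
    (S := {y | ¬ ((∀ i, E.SectionHolAt (t i) y) ∧ LinearIndependent ℂ fun i => t i y)}) (fun x => by
      filter_upwards [(ht x).eventually_frame] with y hy h using h hy)
  set T : Finset RiemannSphere := insert OnePoint.infty hfin.toFinset with hT
  -- `K` bounds the poles of the coordinates in the frame `t`. For a section of order at least `e`
  -- at `∞` the bound improves to `K - e • ∞`, which has negative degree as soon as `e` exceeds `deg
  -- K`; then all coordinates vanish.
  set K : RiemannSphere →₀ ℤ := Finsupp.onFinset T (fun x => if x ∈ T then (k x : ℤ) else 0)
    (fun x hx => by by_contra h; simp [h] at hx) with hK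
  refine ⟨(K.sum fun _ n => n) + 1, fun W e he => (Submodule.eq_bot_iff _).2 fun m hm => ?_⟩
  set c : Fin n → RiemannSphere → ℂ := fun i y => Ψ y (m y) i with hc
  set Ke : RiemannSphere →₀ ℤ := K - Finsupp.single OnePoint.infty e with hKe
  have hKesum : (Ke.sum fun _ n => n) < 0 := by
    rw [hKe, Finsupp.sum_sub_index (by simp), Finsupp.sum_single_index rfl]
    linarith
  have horder : ∀ i x, MerAt (c i) x ∧ ((-Ke x : ℤ) : WithTop ℤ) ≤ orderAt (c i) x := by
    intro i x
    induction x using OnePoint.rec with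
    | infty =>
      obtain ⟨g, hg, hg'⟩ := hk OnePoint.infty (twist e m) hm.2.1 i
      have h1 := le_orderAt_of_mul (c := c i) (a := (k OnePoint.infty : ℤ) + -e) hg
        ((merAt_localCoord_pow OnePoint.infty (k OnePoint.infty)).mul (merAt_twistFactor e))
        (by rw [orderAt_mul (merAt_localCoord_pow _ _) (merAt_twistFactor e),
              orderAt_localCoord_pow, orderAt_twistFactor]; norm_cast) (by
          filter_upwards [hg'] with y hy
          rw [hy, twist_apply, map_smul, Pi.smul_apply, smul_eq_mul, mul_assoc])
      have h2 : Ke OnePoint.infty = (k OnePoint.infty : ℤ) + -e := by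
        simp [hKe, hK, hT, sub_eq_add_neg]
      rw [h2]
      exact h1
    | coe z =>
      have h2 : Ke z = if (z : RiemannSphere) ∈ T then (k z : ℤ) else 0 := by
        simp [hKe, hK]
      rw [h2]
      split_ifs with hz
      · obtain ⟨g, hg, hg'⟩ := hk z m (hm.1 z) i
        exact le_orderAt_of_mul hg (merAt_localCoord_pow _ _) (orderAt_localCoord_pow _ _) hg'
      · have hgood : (∀ i, E.SectionHolAt (t i) z) ∧ LinearIndependent ℂ fun i => t i z := by
          by_contra h
          exact hz (Finset.mem_insert_of_mem (hfin.mem_toFinset.2 h))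
        obtain ⟨κ, h3, h4⟩ := exists_coordinates hgood.1 hgood.2
        have h5 : HolAt (c i) z := by
          refine (holAt_pi.1 (h4.self_of_nhds m (hm.1 z)) i).congr ?_
          filter_upwards [h3, eventually_linearIndependent hgood.1 hgood.2] with y h3 h6
          have hmem : m y ∈ Submodule.span ℂ (Set.range fun i => t i y) := by
            rw [span_range_eq_top_of_linearIndependent h6]; trivial
          obtain ⟨a, ha⟩ := (Submodule.mem_span_range_iff_exists_fun ℂ).1 hmem
          simp only [hc]
          rw [← ha, h3, hΨ y h6]
        exact ⟨HolAt.merAt h5, by simpa using HolAt.orderAt_nonneg h5⟩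
  have hzero : ∀ (i : Fin n) (z : ℂ), ∀ᶠ y in 𝓝[≠] (z : RiemannSphere), c i y = 0 := by
    intro i z
    have h1 := orderAt_eq_top_of_divisor (fun x => (horder i x).1) Ke (fun x => (horder i x).2) hKesum z
    rw [orderAt_eq_loc, meromorphicOrderAt_eq_top_iff] at h1
    exact eventually_nhdsNE_iff.2 h1
  refine sectionSpace_eq_zero_of_coe hm fun z => (hm.1 z).eq_zero_of_nhdsNE ?_
  filter_upwards [Filter.eventually_all.2 fun i => hzero i z, (ht z).eventually_frame] with y h1 h2
  have hmem : m y ∈ Submodule.span ℂ (Set.range fun i => t i y) := by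
    rw [span_range_eq_top_of_linearIndependent h2.2]; trivial
  obtain ⟨a, ha⟩ := (Submodule.mem_span_range_iff_exists_fun ℂ).1 hmem
  have h3 : Ψ y (m y) = a := by rw [← ha, hΨ y h2.2]
  rw [← ha]
  refine Finset.sum_eq_zero fun i _ => ?_
  rw [← h3]
  have := h1 i
  simp only [hc] at this
  rw [this, zero_smul]

/-- If `det E` has a meromorphic section, `E` is generically spanned by sections on `ℂ` that are
meromorphic at `∞`. -/
theorem exists_generic_frame {D : RiemannSphere →₀ ℤ} (hD : E.IsDetDivisor (fun _ => ⊤) n D) :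
    ∃ (e : ℤ) (m : Fin n → ∀ y, E.fiber y), (∀ i, m i ∈ E.sectionSpace (fun _ => ⊤) e) ∧
      ∃ y, LinearIndependent ℂ fun i => m i y := by
  classical
  obtain ⟨t, ht⟩ := hD
  have hfin := finite_of_eventually_notMem
    (S := {y | ¬ ((∀ i, E.SectionHolAt (t i) y) ∧ LinearIndependent ℂ fun i => t i y)}) (fun x => by
      filter_upwards [(ht x).eventually_frame] with y hy h using h hy)
  have hfin' := hfin.preimage (f := ((↑) : ℂ → RiemannSphere)) OnePoint.coe_injective.injOn
  set T : Finset ℂ := hfin'.toFinset with hT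
  choose k hk using fun x => (ht x).exists_pow_smul
  choose σ hσ hσ' using hk
  have hpow : ∀ (j : ℕ) (a z : ℂ), HolAt (fun y => (coord y - a) ^ j) (z : RiemannSphere) := by
    intro j a z
    have := HolAt.prod (s := Finset.range j) fun _ _ => (holAt_coord z).add (holAt_const (-a) _)
    simpa only [Finset.prod_const, Finset.card_range, ← sub_eq_add_neg] using this
  -- The polynomial `Q` clears the poles of the `t i` on `ℂ`. It has a pole of order `N` at `∞`;
  -- together with the poles of the `t i` there, this accounts for the order `e`.
  set Q : RiemannSphere → ℂ := fun y => ∏ a ∈ T, (coord y - a) ^ k a with hQ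
  set N : ℕ := ∑ a ∈ T, k a with hN
  set e : ℤ := -(N : ℤ) + -(k OnePoint.infty : ℤ) with he
  have hpatch : ∀ i, ∃ m : ∀ y, E.fiber y, (∀ z : ℂ, E.SectionHolAt m z) ∧
      E.SectionHolAt (twist e m) OnePoint.infty ∧ (∀ x, ∀ᶠ y in 𝓝[≠] x, m y = Q y • t i y) ∧
      ∀ z : ℂ, E.SectionHolAt (fun y => Q y • t i y) z → m z = Q z • t i z := by
    intro i
    refine exists_patch (s₀ := fun y => Q y • t i y) e (fun z => ?_) ?_
    · by_cases hz : z ∈ T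
      · refine ⟨fun y => (∏ a ∈ T.erase z, (coord y - a) ^ k a) • σ z i y,
          SectionHolAt.smul (HolAt.prod fun a _ => hpow _ a z) (hσ z i), ?_⟩
        filter_upwards [hσ' z i] with y hy
        have hcoord : chartAt ℂ (z : RiemannSphere) y = coord y := by rw [chartAt_coe]; rfl
        rw [hy, smul_smul, hcoord, pos_coe, hQ]
        simp only
        rw [← Finset.prod_erase_mul _ _ hz]
      · have hgood : (∀ i, E.SectionHolAt (t i) z) := by
          by_contra h
          exact hz (by simp [hT, h])
        exact ⟨_, SectionHolAt.smul (HolAt.prod fun a _ => hpow _ a z) (hgood i),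
          Filter.Eventually.of_forall fun y => rfl⟩
    · have hu : HolAt (fun y => ∏ a ∈ T, ∏ _j ∈ Finset.range (k a),
          (1 + (-a) * (chartAt ℂ OnePoint.infty y - pos OnePoint.infty))) OnePoint.infty :=
        HolAt.prod fun a _ => HolAt.prod fun _ _ =>
          (holAt_const 1 _).add ((holAt_const (-a) _).mul (holAt_localCoord _))
      refine ⟨_, SectionHolAt.smul hu (hσ OnePoint.infty i), ?_⟩
      filter_upwards [hσ' OnePoint.infty i, self_mem_nhdsWithin,
        eventually_ne_zero_infty.filter_mono nhdsWithin_le_nhds] with y h1 h2 h3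
      induction y using OnePoint.rec with
      | infty => exact absurd rfl h2
      | coe w =>
        have hw : w ≠ 0 := fun h => h3 (by rw [h])
        rw [h1, smul_smul, smul_smul, he, twistFactor_add _ _ h3, pos_infty, chartAt_infty_coe hw]
        congr 1
        simp only [Finset.prod_const, Finset.card_range, twistFactor_coe, zpow_neg, zpow_natCast,
          sub_zero, inv_pow, hQ, coord_coe]
        have hterm : ∏ a ∈ T, (1 + -a * w⁻¹) ^ k a = (w ^ N)⁻¹ * ∏ a ∈ T, (w - a) ^ k a := by
          rw [hN, ← Finset.prod_pow_eq_pow_sum, ← Finset.prod_inv_distrib, ← Finset.prod_mul_distrib]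
          refine Finset.prod_congr rfl fun a _ => ?_
          rw [← inv_pow, ← mul_pow]
          congr 1
          field_simp
          ring
        rw [hterm]
        ring
  choose m hm1 hm2 hm3 _ using hpatch
  refine ⟨e, m, fun i => ⟨hm1 i, hm2 i, Filter.Eventually.of_forall fun _ => trivial⟩, ?_⟩
  have hQ0 : ∀ᶠ y in 𝓝[≠] ((0 : ℂ) : RiemannSphere), Q y ≠ 0 := by
    have h1 : ∀ᶠ y in Filter.cofinite, y ∉ (((↑) : ℂ → RiemannSphere) '' T) ∪ {OnePoint.infty} :=
      (((T.finite_toSet.image _).union (Set.finite_singleton _)).compl_mem_cofinite)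
    filter_upwards [h1.filter_mono (cofinite_le_nhdsNE _)] with y hy
    induction y using OnePoint.rec with
    | infty => exact absurd (Or.inr rfl) hy
    | coe w =>
      rw [hQ]
      simp only [coord_coe]
      refine Finset.prod_ne_zero_iff.2 fun a ha => pow_ne_zero _ (sub_ne_zero.2 ?_)
      rintro rfl
      exact hy (Or.inl ⟨w, ha, rfl⟩)
  obtain ⟨y, hy1, hy2, hy3⟩ := (hQ0.and ((Filter.eventually_all.2 fun i => hm3 i _).and
    (ht ((0 : ℂ) : RiemannSphere)).eventually_frame)).exists
  refine ⟨y, ?_⟩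
  have : (fun i => m i y) = fun i => Units.mk0 (Q y) hy1 • t i y := funext fun i => hy2 i
  rw [this]
  exact hy3.2.units_smul fun _ => Units.mk0 (Q y) hy1

/-- **Birkhoff–Grothendieck** for a bundle whose determinant has a meromorphic section. -/
theorem exists_isSplitFrame_top {D : RiemannSphere →₀ ℤ} (hD : E.IsDetDivisor (fun _ => ⊤) n D) :
    ∃ (b : Fin n → ∀ y, E.fiber y) (d : Fin n → ℤ), E.IsSplitFrame (fun _ => ⊤) b d ∧
      (∀ e, FiniteDimensional ℂ (E.sectionSpace (fun _ => ⊤) e)) ∧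
      ∀ e, Module.finrank ℂ (E.sectionSpace (fun _ => ⊤) e) = ∑ i, (d i - e + 1).toNat := by
  obtain ⟨e₀, he₀⟩ := exists_order_bound hD
  obtain ⟨r, b, d, L, hb, -, hL, hf⟩ := exists_isSplitFrame (he₀ fun _ => ⊤)
  obtain ⟨e, m, hm, y, hy⟩ := exists_generic_frame hD
  -- The generic frame consists of sections of `L`, so `L` has full rank.
  have h1 : n ≤ r := by
    have h2 : LinearIndependent ℂ fun i => (⟨m i y, hL e _ (hm i) y⟩ : L y) :=
      LinearIndependent.of_comp (L y).subtype hy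
    have := h2.fintype_card_le_finrank
    rwa [Fintype.card_fin, hb.finrank_eq] at this
  have h3 : r ≤ n := by
    have := Submodule.finrank_le (L y)
    rwa [hb.finrank_eq, finrank_fiber] at this
  obtain rfl : r = n := le_antisymm h3 h1
  have hLtop : L = fun _ => ⊤ := funext fun y =>
    Submodule.eq_top_of_finrank_eq (by rw [hb.finrank_eq, finrank_fiber])
  subst hLtop
  exact ⟨b, d, hb, hf⟩

end MeromorphicFrame

end HolBundle

/-! ### The model bundles and isomorphism of split bundles. -/

namespace HolBundle

open RiemannSphere

variable {n : ℕ}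

section Split

variable (d : Fin n → ℤ)

/-- The standard sections of `𝒪(d₁) ⊕ ⋯ ⊕ 𝒪(dₙ)`. -/
def splitSection (i : Fin n) (y : RiemannSphere) : (split d).fiber y := (Pi.single i 1 : Fin n → ℂ)

variable {d}

theorem sectionHolAt_split_iff {s : RiemannSphere → Fin n → ℂ} {x : RiemannSphere} {i : Bool}
    (hx : x ∈ (splitCore d).baseSet i) : (split d).SectionHolAt s x ↔
      HolAt (fun y k => coord y ^ ((chartIndex ((splitCore d).indexAt y) - chartIndex i) * d k) *
        s y k) x := by
  have hm : MemTrivializationAtlas ((splitCore d).localTriv i) := ⟨⟨i, rfl⟩⟩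
  exact Bundle.Trivialization.contMDiffAt_section_iff (E := (splitCore d).Fiber) (IB := 𝓘(ℂ, ℂ))
    (n := ω) (s := s) ((splitCore d).localTriv i) hx

theorem splitCore_indexAt_coe (z : ℂ) : (splitCore d).indexAt (z : RiemannSphere) = false := by
  classical
  exact decide_eq_false (OnePoint.coe_ne_infty z)

theorem splitCore_indexAt_infty : (splitCore d).indexAt OnePoint.infty = true := by
  classical
  exact decide_eq_true rfl

theorem splitSection_hol (i : Fin n) (z : ℂ) : (split d).SectionHolAt (splitSection d i) z := by
  have hz : (z : RiemannSphere) ∈ (splitCore d).baseSet false := OnePoint.coe_ne_infty z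
  refine (sectionHolAt_split_iff hz).2 ?_
  refine (holAt_const (Pi.single i 1 : Fin n → ℂ) (z : RiemannSphere)).congr ?_
  filter_upwards [eventually_ne_infty z] with y hy
  induction y using OnePoint.rec with
  | infty => exact absurd rfl hy
  | coe w =>
    ext k
    rw [splitCore_indexAt_coe, sub_self, zero_mul, zpow_zero, one_mul]
    rfl

theorem twist_splitSection_hol (i : Fin n) :
    (split d).SectionHolAt (twist (d i) (splitSection d i)) OnePoint.infty := by
  have hz : (OnePoint.infty : RiemannSphere) ∈ (splitCore d).baseSet true := by
    change _ ∈ chartInfty.source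
    rw [chartInfty_source]
    simp
  refine (sectionHolAt_split_iff (s := fun y => twistFactor (d i) y • Pi.single i 1) hz).2 ?_
  refine (holAt_const (Pi.single i 1 : Fin n → ℂ) OnePoint.infty).congr ?_
  filter_upwards [eventually_ne_zero_infty] with y hy
  ext k
  rw [Pi.smul_apply]
  induction y using OnePoint.rec with
  | infty =>
    rw [splitCore_indexAt_infty]
    simp
  | coe w =>
    have hw : w ≠ 0 := fun h => hy (by rw [h])
    rw [splitCore_indexAt_coe, Pi.single_apply]
    split_ifs with hk
    · subst hk
      simp only [chartIndex, coord_coe, twistFactor_coe, smul_eq_mul, mul_one]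
      rw [← zpow_add₀ hw]
      simp
    · simp

variable (d) in
theorem isSplitFrame_split :
    (split d).IsSplitFrame (fun _ => ⊤) (splitSection d) d := by
  have hli : ∀ y, LinearIndependent ℂ fun i => splitSection d i y := fun y =>
    Pi.linearIndependent_single_one (Fin n) ℂ
  have h := isSplitFrame_span (E := split d) (fun i z => splitSection_hol i z)
    (fun i => twist_splitSection_hol i) hli
  have h2 : (fun y => Submodule.span ℂ (Set.range fun i => splitSection d i y)) = fun _ => ⊤ :=
    funext fun y => span_range_eq_top_of_linearIndependent (hli y)
  rwa [h2] at h

end Split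

theorem homHolAt_of_frame {E : HolBundle.{u} n} {F : HolBundle.{v} n}
    {f : Fin n → ∀ y, E.fiber y} {f' : Fin n → ∀ y, F.fiber y} {x : RiemannSphere}
    (A : ∀ y, E.fiber y →ₗ[ℂ] F.fiber y) (hf : E.IsFrameAt (fun _ => ⊤) f x)
    (hf' : ∀ i, F.SectionHolAt (f' i) x) (hA : ∀ y i, A y (f i y) = f' i y) :
    HomHolAt E F A x := by
  intro s hs
  obtain ⟨κ, h1, h2⟩ := exists_coordinates hf.hol hf.linearIndependent.self_of_nhds
  refine (SectionHolAt.sum (t := Finset.univ) fun i _ =>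
    SectionHolAt.smul (holAt_pi.1 (h2.self_of_nhds s hs) i) (hf' i)).congr ?_
  filter_upwards [h1, hf.span_eq] with y h3 h4
  have hmem : s y ∈ Submodule.span ℂ (Set.range fun i => f i y) := by rw [h4]; trivial
  obtain ⟨c, hc⟩ := (Submodule.mem_span_range_iff_exists_fun ℂ).1 hmem
  rw [← hc, h3, map_sum]
  simp only [map_smul, hA]

theorem IsSplitFrame.homHolAt {E : HolBundle.{u} n} {F : HolBundle.{v} n}
    {b : Fin n → ∀ y, E.fiber y} {b' : Fin n → ∀ y, F.fiber y} {d : Fin n → ℤ}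
    (h : E.IsSplitFrame (fun _ => ⊤) b d) (h' : F.IsSplitFrame (fun _ => ⊤) b' d)
    (A : ∀ y, E.fiber y →ₗ[ℂ] F.fiber y) (hA : ∀ y i, A y (b i y) = b' i y) (x : RiemannSphere) :
    HomHolAt E F A x := by
  induction x using OnePoint.rec with
  | infty =>
    refine homHolAt_of_frame _ h.infty h'.infty.hol fun y i => ?_
    rw [twist_apply, twist_apply, map_smul, hA]
  | coe z => exact homHolAt_of_frame _ (h.coe z) (h'.coe z).hol hA

/-- Bundles with split frames of the same degrees are isomorphic. -/
theorem IsSplitFrame.isIsomorphic {E : HolBundle.{u} n} {F : HolBundle.{v} n}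
    {b : Fin n → ∀ y, E.fiber y} {b' : Fin n → ∀ y, F.fiber y} {d : Fin n → ℤ}
    (h : E.IsSplitFrame (fun _ => ⊤) b d) (h' : F.IsSplitFrame (fun _ => ⊤) b' d) :
    E.IsIsomorphic F := by
  let B : ∀ y, Module.Basis (Fin n) ℂ (E.fiber y) := fun y =>
    Module.Basis.mk (h.linearIndependent y) (h.span_eq y).ge
  let B' : ∀ y, Module.Basis (Fin n) ℂ (F.fiber y) := fun y =>
    Module.Basis.mk (h'.linearIndependent y) (h'.span_eq y).ge
  have hB : ∀ y i, B y i = b i y := fun y i => by simp [B]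
  have hB' : ∀ y i, B' y i = b' i y := fun y i => by simp [B']
  have hA : ∀ y i, ((B y).equiv (B' y) (Equiv.refl _)) (b i y) = b' i y := fun y i => by
    rw [← hB, Module.Basis.equiv_apply, hB']; rfl
  refine ⟨fun y => (B y).equiv (B' y) (Equiv.refl _), h.homHolAt h' _ hA, h'.homHolAt h _ ?_⟩
  intro y i
  exact (LinearEquiv.symm_apply_eq _).2 (hA y i).symm

theorem IsSplitFrame.isIsomorphic_split {E : HolBundle.{u} n} {b : Fin n → ∀ y, E.fiber y}
    {d : Fin n → ℤ} (h : E.IsSplitFrame (fun _ => ⊤) b d) : E.IsIsomorphic (split d) :=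
  h.isIsomorphic (isSplitFrame_split d)

end HolBundle

/-- The coordinate vector field `∂/∂z` on `ℂ`. -/
def coordTangent (y : RiemannSphere) : TangentSpace 𝓘(ℂ, ℂ) y := (1 : ℂ)

/-! ### The differentials of the two coordinates. -/

section DCoord

open RiemannSphere

theorem dCoord_eq_fderiv {x y : RiemannSphere} (hy : y ∈ (chartAt ℂ x).source) :
    dCoord x y (coordTangent y) = fderiv ℂ (fun z => chartAt ℂ x (loc y z)) (pos y) 1 := by
  have h := mfderiv_chartAt_eq_tangentCoordChange (I := 𝓘(ℂ, ℂ)) hy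
  have h2 : dCoord x y (coordTangent y) = tangentCoordChange 𝓘(ℂ, ℂ) y x y (1 : ℂ) := by
    rw [dCoord, h]; rfl
  rw [h2, tangentCoordChange_def]
  simp only [mfld_simps, range_id, fderivWithin_univ]
  rfl

theorem dCoord_coe_coe (x z : ℂ) : dCoord (x : RiemannSphere) z (coordTangent z) = 1 := by
  rw [dCoord_eq_fderiv (by rw [chartAt_coe]; exact OnePoint.coe_ne_infty z)]
  simp only [loc_coe, chartAt_coe_coe]
  simp

/-- From `w = 1 / z` one gets `dw = -dz / z ^ 2`: this is the degree `-2` of the canonical bundle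
and the source of every `2` below. -/
theorem dCoord_infty_coe {z : ℂ} (hz : z ≠ 0) :
    dCoord OnePoint.infty (z : RiemannSphere) (coordTangent z) = -(z ^ 2)⁻¹ := by
  rw [dCoord_eq_fderiv (by
    rw [chartAt_infty, chartInfty_source]
    simpa using hz)]
  simp only [loc_coe, pos_coe]
  have h : (fun w : ℂ => chartAt ℂ (OnePoint.infty : RiemannSphere) (w : RiemannSphere)) =ᶠ[𝓝 z]
      fun w => w⁻¹ := by
    filter_upwards [isOpen_ne.mem_nhds hz] with w hw using chartAt_infty_coe hw
  rw [h.fderiv_eq, fderiv_inv]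
  simp

end DCoord

/-! ### Kernel and image of a form with vanishing residues. -/

namespace HolBundle

open RiemannSphere

variable {m n s : ℕ} {pt : Fin s → RiemannSphere} {E : HolBundle.{u} m} {F : HolBundle.{v} n}
  {parE : ∀ j, WeightedFlag (E.fiber (pt j))} {parF : ∀ j, WeightedFlag (F.fiber (pt j))}
  {φ : ∀ y, TangentSpace 𝓘(ℂ, ℂ) y →ₗ[ℂ] E.fiber y →ₗ[ℂ] F.fiber y}

/-- Near a regular point, a form is a nonvanishing multiple of a holomorphic homomorphism. -/
theorem exists_homHolAt_of_notMem (h : IsParabolicLogForm pt E F parE parF φ) {x : RiemannSphere}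
    (hx : x ∉ Set.range pt) : ∃ A : ∀ y, E.fiber y →ₗ[ℂ] F.fiber y, E.HomHolAt F A x ∧
      (∀ v, φ x v = dCoord x x v • A x) ∧
      ∀ᶠ y in 𝓝[≠] x, ∃ c : ℂ, c ≠ 0 ∧ φ y (coordTangent y) = c • A y := by
  obtain ⟨A, hA, hA'⟩ := h.holomorphic x hx
  refine ⟨A, hA, hA'.self_of_nhds, ?_⟩
  induction x using OnePoint.rec with
  | infty =>
    filter_upwards [hA'.filter_mono nhdsWithin_le_nhds, self_mem_nhdsWithin,
      eventually_ne_zero_infty.filter_mono nhdsWithin_le_nhds] with y h1 h2 h3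
    induction y using OnePoint.rec with
    | infty => exact absurd rfl h2
    | coe w =>
      have hw : w ≠ 0 := fun h => h3 (by rw [h])
      exact ⟨_, neg_ne_zero.2 (inv_ne_zero (pow_ne_zero 2 hw)), by rw [h1, dCoord_infty_coe hw]⟩
  | coe z =>
    filter_upwards [hA'.filter_mono nhdsWithin_le_nhds,
      (eventually_ne_infty z).filter_mono nhdsWithin_le_nhds] with y h1 h2
    induction y using OnePoint.rec with
    | infty => exact absurd rfl h2
    | coe w => exact ⟨1, one_ne_zero, by rw [h1, dCoord_coe_coe]⟩

/-- Sub-bundles are closed, so an inclusion tested with `∂/∂z` off `x` persists at `x` for every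
tangent vector. This is what reaches `∞`, where `coordTangent` is not the value of `∂/∂z`. -/
theorem form_mem_of_nhdsNE (h : IsParabolicLogForm pt E F parE parF φ) {x : RiemannSphere}
    (hx : x ∉ Set.range pt) {r : ℕ} {L : ∀ y, Submodule ℂ (F.fiber y)}
    {f : Fin r → ∀ y, F.fiber y} (hf : F.IsFrameAt L f x) {s : ∀ y, E.fiber y}
    (hs : E.SectionHolAt s x)
    (hL : ∀ᶠ y in 𝓝[≠] x, φ y (coordTangent y) (s y) ∈ L y) (v : TangentSpace 𝓘(ℂ, ℂ) x) :
    φ x v (s x) ∈ L x := by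
  obtain ⟨A, hA, hA', hA''⟩ := exists_homHolAt_of_notMem h hx
  rw [hA', LinearMap.smul_apply]
  refine Submodule.smul_mem _ _ (hf.mem_of_nhdsNE (s := fun y => A y (s y)) (hA s hs) ?_)
  filter_upwards [hL, hA''] with y h1 ⟨c, hc, h2⟩
  rw [h2, LinearMap.smul_apply] at h1
  exact (Submodule.smul_mem_iff _ hc).1 h1

theorem exists_isFrameAt_bot (F : HolBundle.{v} n) (x : RiemannSphere) :
    F.IsFrameAt (fun _ => ⊥) (fun i : Fin 0 => i.elim0) x :=
  ⟨fun i => i.elim0, Filter.Eventually.of_forall fun _ => linearIndependent_empty_type,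
    Filter.Eventually.of_forall fun y => by simp⟩

/-- The residues of the form vanish for reasons of weight. -/
def ResidueVanish (parE : ∀ j, WeightedFlag (E.fiber (pt j)))
    (parF : ∀ j, WeightedFlag (F.fiber (pt j))) : Prop :=
  ∀ j, ∃ t, (parE j).filt t = ⊤ ∧ (parF j).above t = ⊥

/-- At a marked point the residue maps the whole fibre into `⊥`. Hence `A` applied to `s` vanishes
there and is divisible by the local coordinate, which cancels the simple pole. -/
theorem form_extends_coe (h : IsParabolicLogForm pt E F parE parF φ)
    (hres : ResidueVanish parE parF) {s : ∀ y, E.fiber y} {z : ℂ} (hs : E.SectionHolAt s z) :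
    ∃ σ, F.SectionHolAt σ z ∧
      ∀ᶠ y in 𝓝[≠] (z : RiemannSphere), σ y = φ y (coordTangent y) (s y) := by
  by_cases hz : (z : RiemannSphere) ∈ Set.range pt
  · obtain ⟨j, hj⟩ := hz
    obtain ⟨A, hA, hA', ht⟩ := h.residue j
    obtain ⟨t, ht1, ht2⟩ := hres j
    have hA0 : A (pt j) (s (pt j)) = 0 := by
      have := ht t (show s (pt j) ∈ (parE j).filt t by rw [ht1]; trivial)
      rw [ht2] at this
      exact this
    rw [hj] at hA hA' hA0
    obtain ⟨σ, hσ, hσ'⟩ := (hA s hs).exists_div hA0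
    refine ⟨σ, hσ, ?_⟩
    filter_upwards [hA', hσ'.filter_mono nhdsWithin_le_nhds, eventually_localCoord_ne_zero _,
      (eventually_ne_infty z).filter_mono nhdsWithin_le_nhds] with y h1 h2 h3 h4
    induction y using OnePoint.rec with
    | infty => exact absurd rfl h4
    | coe w =>
      rw [h1, dCoord_coe_coe, LinearMap.smul_apply, h2, smul_smul]
      change _ = (1 / (chartAt ℂ (z : RiemannSphere) w - pos z) * _) • _
      rw [one_div, inv_mul_cancel₀ h3, one_smul]
  · obtain ⟨A, hA, hA'⟩ := h.holomorphic z hz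
    refine ⟨_, hA s hs, ?_⟩
    filter_upwards [hA'.filter_mono nhdsWithin_le_nhds,
      (eventually_ne_infty z).filter_mono nhdsWithin_le_nhds] with y h1 h2
    induction y using OnePoint.rec with
    | infty => exact absurd rfl h2
    | coe w => rw [h1, dCoord_coe_coe, one_smul]

theorem form_holAt_coe (h : IsParabolicLogForm pt E F parE parF φ) {s : ∀ y, E.fiber y} {z : ℂ}
    (hz : (z : RiemannSphere) ∉ Set.range pt) (hs : E.SectionHolAt s z) :
    F.SectionHolAt (fun y => φ y (coordTangent y) (s y)) z := by
  obtain ⟨A, hA, hA'⟩ := h.holomorphic z hz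
  refine SectionHolAt.congr (hA s hs) ?_
  filter_upwards [hA', eventually_ne_infty z] with y h1 h2
  induction y using OnePoint.rec with
  | infty => exact absurd rfl h2
  | coe w => rw [h1, dCoord_coe_coe, one_smul]

theorem form_extends_infty (h : IsParabolicLogForm pt E F parE parF φ)
    (hres : ResidueVanish parE parF) {s : ∀ y, E.fiber y} (hs : E.SectionHolAt s OnePoint.infty) :
    ∃ σ, F.SectionHolAt σ OnePoint.infty ∧
      ∀ᶠ y in 𝓝[≠] OnePoint.infty, σ y = twistFactor 2 y • φ y (coordTangent y) (s y) := by
  by_cases hz : OnePoint.infty ∈ Set.range pt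
  · obtain ⟨j, hj⟩ := hz
    obtain ⟨A, hA, hA', ht⟩ := h.residue j
    obtain ⟨t, ht1, ht2⟩ := hres j
    have hA0 : A (pt j) (s (pt j)) = 0 := by
      have := ht t (show s (pt j) ∈ (parE j).filt t by rw [ht1]; trivial)
      rw [ht2] at this
      exact this
    rw [hj] at hA hA' hA0
    obtain ⟨σ, hσ, hσ'⟩ := (hA s hs).exists_div hA0
    -- The sign is that of `dw = -dz / z ^ 2`.
    refine ⟨_, SectionHolAt.smul (holAt_const (-1) _) hσ, ?_⟩
    filter_upwards [hA', hσ'.filter_mono nhdsWithin_le_nhds, self_mem_nhdsWithin,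
      eventually_ne_zero_infty.filter_mono nhdsWithin_le_nhds] with y h1 h2 h3 h4
    induction y using OnePoint.rec with
    | infty => exact absurd rfl h3
    | coe w =>
      have hw : w ≠ 0 := fun h => h4 (by rw [h])
      rw [h1, dCoord_infty_coe hw, LinearMap.smul_apply, h2, smul_smul, smul_smul]
      rw [show chartAt ℂ (OnePoint.infty : RiemannSphere) OnePoint.infty = pos OnePoint.infty from rfl,
        pos_infty, chartAt_infty_coe hw]
      congr 1
      rw [twistFactor_coe, show (2 : ℤ) = ((2 : ℕ) : ℤ) from rfl, zpow_natCast]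
      field_simp
  · obtain ⟨A, hA, hA'⟩ := h.holomorphic OnePoint.infty hz
    refine ⟨_, SectionHolAt.smul (holAt_const (-1) _) (hA s hs), ?_⟩
    filter_upwards [hA'.filter_mono nhdsWithin_le_nhds, self_mem_nhdsWithin,
      eventually_ne_zero_infty.filter_mono nhdsWithin_le_nhds] with y h1 h2 h4
    induction y using OnePoint.rec with
    | infty => exact absurd rfl h2
    | coe w =>
      have hw : w ≠ 0 := fun h => h4 (by rw [h])
      rw [h1, dCoord_infty_coe hw, LinearMap.smul_apply, smul_smul]
      congr 1
      rw [twistFactor_coe, show (2 : ℤ) = ((2 : ℕ) : ℤ) from rfl, zpow_natCast]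
      field_simp

/-- A form with vanishing residues raises the order at `∞` by two. -/
theorem exists_form_mem_sectionSpace (h : IsParabolicLogForm pt E F parE parF φ)
    (hres : ResidueVanish parE parF) {e : ℤ} {W : ∀ y, Submodule ℂ (E.fiber y)}
    {s : ∀ y, E.fiber y} (hs : s ∈ E.sectionSpace W e) :
    ∃ s' ∈ F.sectionSpace (fun y => LinearMap.range (φ y (coordTangent y))) (e + 2),
      ∀ z : ℂ, (z : RiemannSphere) ∉ Set.range pt → s' z = φ z (coordTangent z) (s z) := by
  obtain ⟨s', h1, h2, h3, h4⟩ := exists_patch (s₀ := fun y => φ y (coordTangent y) (s y)) (e + 2)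
    (fun z => form_extends_coe h hres (hs.1 z)) (by
      obtain ⟨σ, hσ, hσ'⟩ := form_extends_infty h hres hs.2.1
      refine ⟨σ, hσ, ?_⟩
      filter_upwards [hσ', eventually_ne_zero_infty.filter_mono nhdsWithin_le_nhds] with y hy h0
      rw [hy, twist_apply, map_smul, smul_smul, add_comm e 2, twistFactor_add _ _ h0])
  refine ⟨s', ⟨h1, h2, ?_⟩, fun z hz => h4 z (form_holAt_coe h hz (hs.1 z))⟩
  have hfin := finite_of_eventually_notMem
    (S := {y | s' y ∉ LinearMap.range (φ y (coordTangent y))}) (fun x => by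
      filter_upwards [h3 x] with y hy hy'
      exact hy' ⟨_, hy.symm⟩)
  filter_upwards [hfin.compl_mem_cofinite] with y hy
  by_contra hy'
  exact hy hy'

theorem IsSplitFrame.mem_sectionSpace {E : HolBundle.{u} m} {L : ∀ y, Submodule ℂ (E.fiber y)}
    {r : ℕ} {b : Fin r → ∀ y, E.fiber y} {d : Fin r → ℤ} (h : E.IsSplitFrame L b d) (i : Fin r) :
    b i ∈ E.sectionSpace L (d i) :=
  ⟨fun z => (h.coe z).hol i, h.infty.hol i, Filter.Eventually.of_forall fun y => by
    rw [← h.span_eq y]; exact Submodule.subset_span ⟨i, rfl⟩⟩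

/-- This is rank-nullity for `s ↦ φ (∂/∂z) s`. A section in its kernel lies generically in the
kernel of `φ`, and the image of a section extends to a section of order at least `e + 2` lying
generically in the image of `φ`. -/
theorem finrank_sectionSpace_le_add (h : IsParabolicLogForm pt E F parE parF φ)
    (hres : ResidueVanish parE parF) (e : ℤ)
    [FiniteDimensional ℂ (E.sectionSpace (fun _ => ⊤) e)]
    [FiniteDimensional ℂ (E.sectionSpace (fun y => LinearMap.ker (φ y (coordTangent y))) e)]
    [FiniteDimensional ℂ (F.sectionSpace (fun y => LinearMap.range (φ y (coordTangent y))) (e + 2))] :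
    Module.finrank ℂ (E.sectionSpace (fun _ => ⊤) e) ≤
      Module.finrank ℂ (E.sectionSpace (fun y => LinearMap.ker (φ y (coordTangent y))) e) +
      Module.finrank ℂ
        (F.sectionSpace (fun y => LinearMap.range (φ y (coordTangent y))) (e + 2)) := by
  -- Images are compared only over the finite unmarked points: at the marked points and at `∞` the
  -- extended section is not given by the value of `φ`.
  let T : E.sectionSpace (fun _ => ⊤) e →ₗ[ℂ]
      (∀ z : {z : ℂ // (z : RiemannSphere) ∉ Set.range pt}, F.fiber (z : ℂ)) :=
    LinearMap.pi fun z => (φ (z : ℂ) (coordTangent (z : ℂ))) ∘ₗ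
      LinearMap.proj ((z : ℂ) : RiemannSphere) ∘ₗ
      (E.sectionSpace (fun _ => ⊤) e).subtype
  let R : F.sectionSpace (fun y => LinearMap.range (φ y (coordTangent y))) (e + 2) →ₗ[ℂ]
      (∀ z : {z : ℂ // (z : RiemannSphere) ∉ Set.range pt}, F.fiber (z : ℂ)) :=
    LinearMap.pi fun z => LinearMap.proj ((z : ℂ) : RiemannSphere) ∘ₗ
      (F.sectionSpace (fun y => LinearMap.range (φ y (coordTangent y))) (e + 2)).subtype
  have hTR : LinearMap.range T ≤ LinearMap.range R := by
    rintro _ ⟨a, rfl⟩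
    obtain ⟨s', hs', hs''⟩ := exists_form_mem_sectionSpace h hres a.2
    exact ⟨⟨s', hs'⟩, funext fun z => hs'' z z.2⟩
  have h1 : Module.finrank ℂ (LinearMap.range T) ≤ Module.finrank ℂ
      (F.sectionSpace (fun y => LinearMap.range (φ y (coordTangent y))) (e + 2)) :=
    (Submodule.finrank_mono hTR).trans (LinearMap.finrank_range_le R)
  have hker : ∀ a ∈ LinearMap.ker T,
      a.1 ∈ E.sectionSpace (fun y => LinearMap.ker (φ y (coordTangent y))) e := by
    intro a ha
    refine ⟨a.2.1, a.2.2.1, ?_⟩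
    filter_upwards [(Set.finite_range pt).compl_mem_cofinite,
      (Set.finite_singleton (OnePoint.infty : RiemannSphere)).compl_mem_cofinite] with y hy hy'
    induction y using OnePoint.rec with
    | infty => exact absurd rfl hy'
    | coe z => exact congrFun (LinearMap.mem_ker.1 ha) ⟨z, hy⟩
  let S : LinearMap.ker T →ₗ[ℂ] E.sectionSpace (fun y => LinearMap.ker (φ y (coordTangent y))) e :=
    LinearMap.codRestrict _ ((E.sectionSpace (fun _ => ⊤) e).subtype ∘ₗ (LinearMap.ker T).subtype)
      fun a => hker a.1 a.2
  have hS : Function.Injective S := fun a b hab =>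
    Subtype.ext (Subtype.ext (congrArg (fun c => c.1) hab))
  have h2 := LinearMap.finrank_le_finrank_of_injective hS
  rw [← LinearMap.finrank_range_add_finrank_ker T, add_comm]
  exact Nat.add_le_add h2 h1

/-- Kernel and image of a form with vanishing residues. -/
theorem exists_ker_range_splitFrame (h : IsParabolicLogForm pt E F parE parF φ)
    (hres : ResidueVanish parE parF) {DE DF : RiemannSphere →₀ ℤ}
    (hDE : E.IsDetDivisor (fun _ => ⊤) m DE) (hDF : F.IsDetDivisor (fun _ => ⊤) n DF)
    {b : Fin m → ∀ y, E.fiber y} {d : Fin m → ℤ} (hb : E.IsSplitFrame (fun _ => ⊤) b d)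
    (hfin : ∀ e, FiniteDimensional ℂ (E.sectionSpace (fun _ => ⊤) e))
    (hdim : ∀ e, Module.finrank ℂ (E.sectionSpace (fun _ => ⊤) e) = ∑ i, (d i - e + 1).toNat) :
    ∃ (rN : ℕ) (bN : Fin rN → ∀ y, E.fiber y) (dN : Fin rN → ℤ) (N : ∀ y, Submodule ℂ (E.fiber y))
      (rI : ℕ) (bI : Fin rI → ∀ y, F.fiber y) (dI : Fin rI → ℤ) (I : ∀ y, Submodule ℂ (F.fiber y)),
      E.IsSplitFrame N bN dN ∧ F.IsSplitFrame I bI dI ∧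
      (∀ y, y ∉ Set.range pt → ∀ v, N y ≤ LinearMap.ker (φ y v)) ∧
      (∀ y, y ∉ Set.range pt → ∀ v, LinearMap.range (φ y v) ≤ I y) ∧
      rN + rI = m ∧ ∑ i, d i ≤ ∑ i, dN i + ∑ i, dI i - 2 * rI := by
  obtain ⟨eE, heE⟩ := exists_order_bound hDE
  obtain ⟨eF, heF⟩ := exists_order_bound hDF
  obtain ⟨rN, bN, dN, N, hN, hNmem, hNall, hNfin, hNdim⟩ :=
    exists_isSplitFrame (heE fun y => LinearMap.ker (φ y (coordTangent y)))
  obtain ⟨rI, bI, dI, I, hI, hImem, hIall, hIfin, hIdim⟩ :=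
    exists_isSplitFrame (heF fun y => LinearMap.range (φ y (coordTangent y)))
  have hrange : ∀ z : ℂ, (z : RiemannSphere) ∉ Set.range pt →
      LinearMap.range (φ z (coordTangent z)) ≤ I z := by
    intro z hz
    rw [LinearMap.range_eq_map, ← hb.span_eq z, Submodule.map_span_le]
    rintro _ ⟨i, rfl⟩
    obtain ⟨s', hs', hs''⟩ := exists_form_mem_sectionSpace h hres (hb.mem_sectionSpace i)
    simp only
    rw [← hs'' z hz]
    exact hIall _ s' hs' _
  have hcof : ∀ᶠ y in Filter.cofinite, y ∉ Set.range pt ∧ y ≠ OnePoint.infty := by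
    filter_upwards [(Set.finite_range pt).compl_mem_cofinite,
      (Set.finite_singleton (OnePoint.infty : RiemannSphere)).compl_mem_cofinite] with y h1 h2
    exact ⟨h1, h2⟩
  have hpt : ∀ x, ∀ᶠ y in 𝓝[≠] x, y ∉ Set.range pt ∧ y ≠ OnePoint.infty := fun x =>
    hcof.filter_mono (cofinite_le_nhdsNE x)
  -- Pointwise rank-nullity at a generic point gives one inequality; the reverse one comes from the
  -- growth of the section spaces.
  have hsum : rN + rI ≤ m := by
    have h1 : ∀ᶠ y in Filter.cofinite, (∀ i, bN i y ∈ LinearMap.ker (φ y (coordTangent y))) ∧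
        ∀ i, bI i y ∈ LinearMap.range (φ y (coordTangent y)) :=
      (Filter.eventually_all.2 fun i => (hNmem i).2.2).and
        (Filter.eventually_all.2 fun i => (hImem i).2.2)
    obtain ⟨y, hy1, hy2⟩ := (h1.filter_mono (cofinite_le_nhdsNE OnePoint.infty)).exists
    have h2 : N y ≤ LinearMap.ker (φ y (coordTangent y)) := by
      rw [← hN.span_eq y, Submodule.span_le]
      rintro _ ⟨i, rfl⟩
      exact hy1 i
    have h3 : I y ≤ LinearMap.range (φ y (coordTangent y)) := by
      rw [← hI.span_eq y, Submodule.span_le]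
      rintro _ ⟨i, rfl⟩
      exact hy2 i
    have h4 := Submodule.finrank_mono h2
    have h5 := Submodule.finrank_mono h3
    have h6 := LinearMap.finrank_range_add_finrank_ker (φ y (coordTangent y))
    rw [hN.finrank_eq] at h4
    rw [hI.finrank_eq] at h5
    rw [finrank_fiber] at h6
    lia
  have hineq : ∀ e, ∑ i, (d i - e + 1).toNat ≤ ∑ i, (dN i - e + 1).toNat +
      ∑ i, (dI i - (e + 2) + 1).toNat := by
    intro e
    have h1 := hfin e
    have h2 := hNfin e
    have h3 := hIfin (e + 2)
    have := finrank_sectionSpace_le_add h hres e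
    rwa [hdim, hNdim, hIdim] at this
  have hlow : ∀ {r : ℕ} (a : Fin r → ℤ), ∃ B : ℤ, ∀ i, B ≤ a i := fun a => by
    obtain ⟨B, hB⟩ := (Set.finite_range a).bddBelow
    exact ⟨B, fun i => hB ⟨i, rfl⟩⟩
  obtain ⟨B1, hB1⟩ := hlow d
  obtain ⟨B2, hB2⟩ := hlow dN
  obtain ⟨B3, hB3⟩ := hlow dI
  -- For `e` small enough no truncation occurs and the dimension inequality is affine in `e`. Its
  -- slope compares the ranks; once these agree, the constant terms give the degree inequality.
  have hineq' : ∀ e : ℤ, e ≤ B1 → e ≤ B2 → e ≤ B3 - 2 →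
      ∑ i, d i + m * (1 - e) ≤ ∑ i, dN i + rN * (1 - e) + (∑ i, dI i + rI * (-1 - e)) := by
    intro e h1 h2 h3
    have h4 : ((∑ i, (d i - e + 1).toNat : ℕ) : ℤ) ≤ ((∑ i, (dN i - e + 1).toNat +
      ∑ i, (dI i - (e + 2) + 1).toNat : ℕ) : ℤ) := by exact_mod_cast hineq e
    push_cast at h4
    have e1 : ∑ i, max (d i - e + 1) 0 = ∑ i, d i + m * (1 - e) := by
      rw [Finset.sum_congr rfl fun i _ => show max (d i - e + 1) 0 = d i + (1 - e) by
        have := hB1 i; rw [max_eq_left (by lia)]; ring]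
      rw [Finset.sum_add_distrib]; simp; ring
    have e2 : ∑ i, max (dN i - e + 1) 0 = ∑ i, dN i + rN * (1 - e) := by
      rw [Finset.sum_congr rfl fun i _ => show max (dN i - e + 1) 0 = dN i + (1 - e) by
        have := hB2 i; rw [max_eq_left (by lia)]; ring]
      rw [Finset.sum_add_distrib]; simp; ring
    have e3 : ∑ i, max (dI i - (e + 2) + 1) 0 = ∑ i, dI i + rI * (-1 - e) := by
      rw [Finset.sum_congr rfl fun i _ => show max (dI i - (e + 2) + 1) 0 = dI i + (-1 - e) by
        have := hB3 i; rw [max_eq_left (by lia)]; ring]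
      rw [Finset.sum_add_distrib]; simp; ring
    simp only [Int.toNat_eq_max] at h4
    rwa [e1, e2, e3] at h4
  have heq : rN + rI = m := by
    by_contra hne
    have hlt : rN + rI + 1 ≤ m := by lia
    set C := ∑ i, dN i + ∑ i, dI i - 2 * rI - ∑ i, d i with hC
    -- A deficit in rank would force `1 - e ≤ C`, contradicting `e ≤ -C`.
    set e : ℤ := min (min B1 B2) (min (B3 - 2) (min (-C) 0)) with he
    have h1 := hineq' e (by lia) (by lia) (by lia)
    have h2 : ((rN : ℤ) + rI + 1) * (1 - e) ≤ m * (1 - e) := by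
      have : ((rN : ℤ) + rI + 1) ≤ m := by exact_mod_cast hlt
      exact mul_le_mul_of_nonneg_right this (by lia)
    have h3 : e ≤ -C := by lia
    nlinarith
  refine ⟨rN, bN, dN, N, rI, bI, dI, I, hN, hI, ?_, ?_, heq, ?_⟩
  · intro y hy v
    have hcof : ∀ i, ∀ᶠ y' in 𝓝[≠] y, φ y' (coordTangent y') (bN i y') = 0 := fun i =>
      ((hNmem i).2.2).filter_mono (cofinite_le_nhdsNE y)
    rw [← hN.span_eq y, Submodule.span_le]
    rintro _ ⟨i, rfl⟩
    have hbot := exists_isFrameAt_bot F y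
    induction y using OnePoint.rec with
    | infty =>
      have := form_mem_of_nhdsNE h hy hbot (hN.infty.hol i) (by
        filter_upwards [hcof i] with y' h'
        rw [twist_apply, map_smul, h', smul_zero]; exact zero_mem _) v
      simpa using this
    | coe z =>
      have := form_mem_of_nhdsNE h hy hbot ((hN.coe z).hol i) (by
        filter_upwards [hcof i] with y' h'
        rw [h']; exact zero_mem _) v
      simpa using this
  · intro y hy v
    rintro _ ⟨a, rfl⟩
    obtain ⟨s, hs, rfl⟩ := SectionHolAt.const_extension E a
    have hmem : ∀ᶠ y' in 𝓝[≠] y, φ y' (coordTangent y') (s y') ∈ I y' := by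
      filter_upwards [hpt y] with y' hy'
      induction y' using OnePoint.rec with
      | infty => exact absurd rfl hy'.2
      | coe w => exact hrange w hy'.1 ⟨_, rfl⟩
    induction y using OnePoint.rec with
    | infty => exact form_mem_of_nhdsNE h hy hI.infty hs hmem v
    | coe z => exact form_mem_of_nhdsNE h hy (hI.coe z) hs hmem v
  · have h1 := hineq' (min (min B1 B2) (B3 - 2)) (by lia) (by lia) (by lia)
    have h2 : (m : ℤ) = rN + rI := by exact_mod_cast heq.symm
    rw [h2] at h1
    nlinarith

end HolBundle

/-! ### Flags with a single weight. -/

namespace WeightedFlag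

variable {W : Type u} [AddCommGroup W] [Module ℂ W] [FiniteDimensional ℂ W] {F : WeightedFlag W}
  {n : ℕ} {w t : ℝ}

theorem HasType.filt_of_le (h : F.HasType fun _ : Fin n => w) (hn : Module.finrank ℂ W = n)
    (ht : t ≤ w) : F.filt t = ⊤ :=
  Submodule.eq_top_of_finrank_eq (by rw [h t, hn]; simp [ht])

theorem HasType.filt_of_lt (h : F.HasType fun _ : Fin n => w) (ht : w < t) : F.filt t = ⊥ :=
  Submodule.finrank_eq_zero.1 (by rw [h t]; simp [ht.not_ge])

theorem HasType.above_of_lt (h : F.HasType fun _ : Fin n => w) (hn : Module.finrank ℂ W = n)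
    (ht : t < w) : F.above t = ⊤ := by
  rw [eq_top_iff, ← h.filt_of_le hn le_rfl]
  exact le_iSup (fun t' : Set.Ioi t => F.filt t') ⟨w, ht⟩

theorem HasType.above_of_le (h : F.HasType fun _ : Fin n => w) (ht : w ≤ t) : F.above t = ⊥ :=
  iSup_eq_bot.2 fun t' => h.filt_of_lt (ht.trans_lt t'.2)

/-- The filtration jumps only at `w`, so the sum over weights has a single term. -/
theorem HasType.weight_eq (h : F.HasType fun _ : Fin n => w) (hn : Module.finrank ℂ W = n)
    (L : Submodule ℂ W) : F.weight L = w * Module.finrank ℂ L := by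
  rw [weight, finsum_eq_single _ w]
  · rw [h.filt_of_le hn le_rfl, h.above_of_le le_rfl, top_inf_eq, bot_inf_eq, finrank_bot,
      Nat.cast_zero, sub_zero]
  · intro t ht
    rcases lt_or_gt_of_ne ht with ht | ht
    · rw [h.filt_of_le hn ht.le, h.above_of_lt hn ht, sub_self, mul_zero]
    · rw [h.filt_of_lt ht, h.above_of_le ht.le, sub_self, mul_zero]

end WeightedFlag

theorem weightNorm_constWeight {s : ℕ} (n : ℕ) (a : Fin s → ℝ) :
    weightNorm (constWeight n a) = n * ∑ j, a j := by
  simp [weightNorm, constWeight, Finset.mul_sum]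

/-! ### Semistability, the vanishing of `δ` and its consequences. -/

namespace ParabolicHiggs

open HolBundle

variable {s p q m n : ℕ} {pt : Fin s → RiemannSphere} {H : ParabolicHiggs.{u} p q pt}
  {α β : Fin s → ℝ}

theorem parDegree_subbundle (h : H.HasType (constWeight p α) (constWeight q β))
    {L : ∀ y, Submodule ℂ (H.U.fiber y)} {b : Fin m → ∀ y, H.U.fiber y} {d : Fin m → ℤ}
    {L' : ∀ y, Submodule ℂ (H.V.fiber y)} {b' : Fin n → ∀ y, H.V.fiber y} {d' : Fin n → ℤ}
    (hL : H.U.IsSplitFrame L b d) (hL' : H.V.IsSplitFrame L' b' d') :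
    H.parDegree hL.subbundle hL'.subbundle =
      ∑ i, (d i : ℝ) + ∑ i, (d' i : ℝ) + m * ∑ j, α j + n * ∑ j, β j := by
  have h1 : ∀ j, (H.parU j).weight (hL.subbundle.toSubmodule (pt j)) +
      (H.parV j).weight (hL'.subbundle.toSubmodule (pt j)) = α j * m + β j * n := fun j => by
    rw [(h j).1.weight_eq (finrank_fiber _ _), (h j).2.weight_eq (finrank_fiber _ _)]
    change α j * (Module.finrank ℂ (L (pt j)) : ℝ) + β j * (Module.finrank ℂ (L' (pt j)) : ℝ) = _
    rw [hL.finrank_eq, hL'.finrank_eq]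
  rw [parDegree, Finset.sum_congr rfl fun j _ => h1 j, Finset.sum_add_distrib, ← Finset.sum_mul,
    ← Finset.sum_mul]
  change ((H.U.subDegree L m : ℤ) : ℝ) + ((H.V.subDegree L' n : ℤ) : ℝ) + _ = _
  rw [hL.subDegree_eq, hL'.subDegree_eq]
  push_cast
  ring

theorem IsSemistable.sum_le (hs : H.IsSemistable) (h : H.HasType (constWeight p α) (constWeight q β))
    {L : ∀ y, Submodule ℂ (H.U.fiber y)} {b : Fin m → ∀ y, H.U.fiber y} {d : Fin m → ℤ}
    {L' : ∀ y, Submodule ℂ (H.V.fiber y)} {b' : Fin n → ∀ y, H.V.fiber y} {d' : Fin n → ℤ}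
    (hL : H.U.IsSplitFrame L b d) (hL' : H.V.IsSplitFrame L' b' d')
    (hinv : ∀ y, y ∉ Set.range pt → ∀ v, L y ≤ (L' y).comap (H.γ y v) ∧
      L' y ≤ (L y).comap (H.δ y v)) :
    ∑ i, (d i : ℝ) + ∑ i, (d' i : ℝ) + m * ∑ j, α j + n * ∑ j, β j ≤ 0 := by
  rw [← parDegree_subbundle h hL hL']
  exact hs _ _ _ _ hinv

theorem HasTrivialDet.sum_add_sum (hdet : H.HasTrivialDet (constWeight p α) (constWeight q β))
    {b : Fin p → ∀ y, H.U.fiber y} {d : Fin p → ℤ} {b' : Fin q → ∀ y, H.V.fiber y} {d' : Fin q → ℤ}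
    (hb : H.U.IsSplitFrame (fun _ => ⊤) b d) (hb' : H.V.IsSplitFrame (fun _ => ⊤) b' d') :
    ∑ i, (d i : ℝ) + ∑ i, (d' i : ℝ) + p * ∑ j, α j + q * ∑ j, β j = 0 := by
  classical
  obtain ⟨D₁, D₂, h1, h2, -, h3⟩ := hdet
  have e1 := hb.sum_eq h1
  have e2 := hb'.sum_eq h2
  set S := D₁.support ∪ D₂.support ∪ Finset.univ.image pt with hS
  rw [Finsupp.sum_of_support_subset D₁ (s := S) (by intro x; simp only [hS, Finset.mem_union]; tauto)
    _ (fun _ _ => rfl)] at e1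
  rw [Finsupp.sum_of_support_subset D₂ (s := S) (by intro x; simp only [hS, Finset.mem_union]; tauto)
    _ (fun _ _ => rfl)] at e2
  have e3 : ∑ x ∈ S, ((D₁ x + D₂ x : ℤ) : ℝ) = -(p * ∑ j, α j + q * ∑ j, β j) := by
    rw [Finset.sum_congr rfl fun x _ => h3 x, Finset.sum_neg_distrib, Finset.sum_comm]
    have : ∀ j, (∑ x ∈ S, if pt j = x then
        ∑ i, constWeight p α j i + ∑ i, constWeight q β j i else 0) = p * α j + q * β j := by
      intro j
      rw [Finset.sum_ite_eq, if_pos (Finset.mem_union_right _ (by simp))]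
      simp [constWeight]
    rw [Finset.sum_congr rfl fun j _ => this j, Finset.sum_add_distrib, Finset.mul_sum,
      Finset.mul_sum]
  have e4 : ∑ x ∈ S, ((D₁ x + D₂ x : ℤ) : ℝ) = ∑ i, (d i : ℝ) + ∑ i, (d' i : ℝ) := by
    push_cast
    rw [Finset.sum_add_distrib]
    exact_mod_cast congrArg₂ (fun a b : ℤ => (a + b : ℝ)) e1 e2
  linarith

/-- All of `V` has weight `β j`, and nothing in `U` has weight greater than `β j` because `α j < β
j`. -/
theorem residueVanish_δ (h : H.HasType (constWeight p α) (constWeight q β)) (hlt : ∀ j, α j < β j) :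
    ResidueVanish H.parV H.parU := fun j =>
  ⟨β j, (h j).2.filt_of_le (finrank_fiber _ _) le_rfl, (h j).1.above_of_le (hlt j).le⟩

/-- A semistable Higgs bundle in the given range of degrees has `δ = 0`. -/
theorem δ_eq_zero {d : ℤ} (hlt : ∀ j, α j < β j)
    (hgap : weightGap α β < 2) (hd : (d : ℝ) ∈ intervalJ p q α β)
    (h : H.RepresentsPointOfModuli (constWeight p α) (constWeight q β) d) :
    ∀ y, y ∉ Set.range pt → ∀ v, H.δ y v = 0 := by
  obtain ⟨D₁, D₂, h1, h2, -⟩ := h.hasTrivialDet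
  obtain ⟨bU, dU, hU, -⟩ := exists_isSplitFrame_top h1
  obtain ⟨bV, dV, hV, hVfin, hVdim⟩ := exists_isSplitFrame_top h2
  obtain ⟨rN, bN, dN, N, rI, bI, dI, I, hN, hI, hker, hran, hr, hsum⟩ :=
    exists_ker_range_splitFrame H.isParabolicLogForm_δ (residueVanish_δ h.hasType hlt) h2 h1 hV
      hVfin hVdim
  -- The sub-bundle `0 ⊕ N` is invariant because `δ` kills `N`, and `I ⊕ V` because `I` contains the
  -- image of `δ` while `γ` takes its values in `V`.
  have e1 := h.isSemistable.sum_le h.hasType (isSplitFrame_bot H.U) hN fun y hy v =>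
    ⟨bot_le, fun a ha => by rw [Submodule.mem_comap, hker y hy v ha]; exact zero_mem _⟩
  have e2 := h.isSemistable.sum_le h.hasType hI hV fun y hy v =>
    ⟨fun _ _ => trivial, fun a _ => hran y hy v ⟨a, rfl⟩⟩
  have e3 := h.hasTrivialDet.sum_add_sum hU hV
  have e4 := h.degree_sub
  rw [degree, degree, hU.subDegree_eq, hV.subDegree_eq] at e4
  have e5 : ∑ i, (dU i : ℝ) - ∑ i, (dV i : ℝ) = d := by exact_mod_cast e4
  have e6 : ∑ i, (dV i : ℝ) ≤ ∑ i, (dN i : ℝ) + ∑ i, (dI i : ℝ) - 2 * rI := by exact_mod_cast hsum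
  have e7 : (rN : ℝ) + rI = q := by exact_mod_cast hr
  rw [intervalJ, Set.mem_Ioo, weightNorm_constWeight, weightNorm_constWeight] at hd
  rw [weightGap] at hgap hd
  -- The sum of the two semistability inequalities reads `rI * (2 - ε) ≤ d - (q|β| - p|α|)`, and the
  -- right side is less than `2 - ε`.
  have hrI : rI = 0 := by
    by_contra hne
    have : (1 : ℝ) ≤ rI := by exact_mod_cast Nat.one_le_iff_ne_zero.2 hne
    simp only [Finset.univ_eq_empty, Finset.sum_empty, CharP.cast_eq_zero, zero_mul] at e1
    have e8 : (rN : ℝ) = q - rI := by linarith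
    rw [e8] at e1
    nlinarith
  subst hrI
  intro y hy v
  have := hran y hy v
  rw [Submodule.finrank_eq_zero.1 (hI.finrank_eq y), le_bot_iff, LinearMap.range_eq_bot] at this
  exact this

/-- With `δ = 0`, the sub-bundles `0 ⊕ 𝒪(dV i)` and `𝒪(dU i) ⊕ V` are invariant; the last two
conclusions are semistability for these. -/
theorem exists_splitting {d : ℤ} (hlt : ∀ j, α j < β j)
    (hgap : weightGap α β < 2) (hd : (d : ℝ) ∈ intervalJ p q α β)
    (h : H.RepresentsPointOfModuli (constWeight p α) (constWeight q β) d) :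
    ∃ (bU : Fin p → ∀ y, H.U.fiber y) (dU : Fin p → ℤ) (bV : Fin q → ∀ y, H.V.fiber y)
      (dV : Fin q → ℤ), H.U.IsSplitFrame (fun _ => ⊤) bU dU ∧ H.V.IsSplitFrame (fun _ => ⊤) bV dV ∧
      ∑ i, (dU i : ℝ) + ∑ i, (dV i : ℝ) + p * ∑ j, α j + q * ∑ j, β j = 0 ∧
      ∑ i, (dU i : ℝ) - ∑ i, (dV i : ℝ) = d ∧
      (∀ i, dV i + ∑ j, β j ≤ 0) ∧
      ∀ i, dU i + ∑ i, (dV i : ℝ) + ∑ j, α j + q * ∑ j, β j ≤ 0 := by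
  have hδ := δ_eq_zero hlt hgap hd h
  obtain ⟨D₁, D₂, h1, h2, -⟩ := h.hasTrivialDet
  obtain ⟨bU, dU, hU, -⟩ := exists_isSplitFrame_top h1
  obtain ⟨bV, dV, hV, -⟩ := exists_isSplitFrame_top h2
  have e4 := h.degree_sub
  rw [degree, degree, hU.subDegree_eq, hV.subDegree_eq] at e4
  refine ⟨bU, dU, bV, dV, hU, hV, h.hasTrivialDet.sum_add_sum hU hV, by exact_mod_cast e4,
    fun i => ?_, fun i => ?_⟩
  · have := h.isSemistable.sum_le h.hasType (isSplitFrame_bot H.U) (hV.single i) fun y hy v =>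
      ⟨bot_le, by rw [hδ y hy v, Submodule.comap_zero]; exact le_top⟩
    simpa using this
  · have := h.isSemistable.sum_le h.hasType (hU.single i) hV fun y hy v =>
      ⟨fun _ _ => trivial, by rw [hδ y hy v, Submodule.comap_zero]⟩
    simpa using this

end ParabolicHiggs

/-! ### Arithmetic of degrees and construction of multiweights. -/

/-- If `v i < v j`, then integrality gives `v i + B ≤ -1` from `v j + B ≤ 0`, and the other terms
can only lower the sum. -/
theorem eq_of_nonpos_of_neg_one_lt_sum {n : ℕ} {v : Fin n → ℤ} {B : ℝ} (hv : ∀ i, v i + B ≤ 0)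
    (hsum : -1 < ∑ i, (v i : ℝ) + n * B) (i j : Fin n) : v i = v j := by
  have key : ∀ i j, v j ≤ v i := by
    intro i j
    by_contra! hlt
    have h1 : (v i : ℝ) + 1 ≤ v j := by exact_mod_cast hlt
    have h2 : ∑ k, ((v k : ℝ) + B) ≤ v i + B := by
      rw [← Finset.add_sum_erase _ _ (Finset.mem_univ i)]
      linarith [Finset.sum_nonpos fun k (_ : k ∈ Finset.univ.erase i) => hv k]
    rw [Finset.sum_add_distrib] at h2
    simp only [Finset.sum_const, Finset.card_univ, Fintype.card_fin, nsmul_eq_mul] at h2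
    linarith [hv j]
  exact le_antisymm (key j i) (key i j)

theorem exists_bounded_sum_eq {lo hi : ℕ} (hle : lo ≤ hi) : ∀ (s N : ℕ), s * lo ≤ N → N ≤ s * hi →
    ∃ k : Fin s → ℕ, (∀ j, lo ≤ k j ∧ k j ≤ hi) ∧ ∑ j, k j = N
  | 0, N, _, h2 => ⟨fun j => j.elim0, fun j => j.elim0, by simp at h2; simp [h2]⟩
  | s + 1, N, h1, h2 => by
    have h3 : s * lo ≤ s * hi := Nat.mul_le_mul_left s hle
    rw [Nat.add_mul, one_mul] at h1 h2
    -- The first value is the least one for which the other `s` entries can still make up the rest.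
    obtain ⟨k, hk, hk'⟩ := exists_bounded_sum_eq hle s (N - max lo (N - s * hi)) (by lia) (by lia)
    refine ⟨Fin.cons (max lo (N - s * hi)) k, fun j => ?_, ?_⟩
    · cases j using Fin.cases with
      | zero => rw [Fin.cons_zero]; lia
      | succ j => rw [Fin.cons_succ]; exact hk j
    · rw [Fin.sum_univ_succ]
      simp only [Fin.cons_zero, Fin.cons_succ, hk']
      lia

/-- A constant multiweight with prescribed sums `k j` of the weights and prescribed gap `t`. -/
theorem isAdapted_of_bounds {s p q : ℕ} (hp : 0 < p) (hq : 0 < q) {a : ℤ} {k : Fin s → ℕ}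
    {m : Fin s → ℝ} {t : ℝ} (hk : ((∑ j, k j : ℕ) : ℤ) = (p + q) * a - p) (hm : ∀ j, 0 < m j)
    (hmk : ∀ j, q * m j ≤ k j) (hmk' : ∀ j, p * m j ≤ p + q - k j) (hM : 1 ≤ ∑ j, m j)
    (ht0 : 0 < t) (ht1 : t < 1) (ht : (2 * p * q - 2 * p - 2 * q : ℝ) < t * (2 * p * q - p - q))
    (ht' : (2 * p * q - 2 * p - 2 * q : ℝ) / (2 * p * q - p - q) < t) :
    ∃ α β : Fin s → ℝ, IsAdapted p q a α β := by
  have hp' : (1 : ℝ) ≤ p := by exact_mod_cast hp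
  have hq' : (1 : ℝ) ≤ q := by exact_mod_cast hq
  set M := ∑ j, m j with hMdef
  -- The total gap `t` is shared in proportion to the capacities `m j`; as `t < 1 ≤ M`, each share
  -- stays below its capacity.
  set ε : Fin s → ℝ := fun j => m j * t / M with hε
  have hM0 : 0 < M := by linarith
  have hε0 : ∀ j, 0 < ε j := fun j => div_pos (mul_pos (hm j) ht0) hM0
  have hεm : ∀ j, ε j < m j := fun j => by
    rw [hε, div_lt_iff₀ hM0]
    exact mul_lt_mul_of_pos_left (by linarith) (hm j)
  have hsumε : ∑ j, ε j = t := by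
    rw [hε, ← Finset.sum_div, ← Finset.sum_mul, ← hMdef, mul_comm, mul_div_assoc, div_self hM0.ne',
      mul_one]
  have hpq : (0 : ℝ) < p + q := by linarith
  -- `α j` and `β j` solve `p * α j + q * β j = k j` and `β j - α j = ε j`. The bounds on `m j` then
  -- say that `α j ≥ 0` and `β j < 1`.
  set α : Fin s → ℝ := fun j => (k j - q * ε j) / (p + q) with hα
  set β : Fin s → ℝ := fun j => (k j + p * ε j) / (p + q) with hβ
  have hlt : ∀ j, α j < β j := fun j => by
    rw [hα, hβ]
    refine div_lt_div_of_pos_right ?_ hpq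
    nlinarith [hε0 j]
  have hα0 : ∀ j, 0 ≤ α j := fun j => by
    refine div_nonneg ?_ hpq.le
    nlinarith [hεm j, hmk j]
  have hβ1 : ∀ j, β j < 1 := fun j => by
    rw [hβ, div_lt_one hpq]
    nlinarith [hεm j, hmk' j]
  have hN : ∑ j, (k j : ℝ) = (p + q) * a - p := by exact_mod_cast hk
  have hA : ∑ j, α j = ((p + q) * a - p - q * t) / (p + q) := by
    rw [hα, ← Finset.sum_div, Finset.sum_sub_distrib, ← Finset.mul_sum, hN, hsumε]
  have hB : ∑ j, β j = ((p + q) * a - p + p * t) / (p + q) := by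
    rw [hβ, ← Finset.sum_div, Finset.sum_add_distrib, ← Finset.mul_sum, hN, hsumε]
  have hgap : weightGap α β = t := by
    rw [weightGap, hA, hB]
    field_simp
    ring
  refine ⟨α, β, ⟨?_, ?_, fun j i i' _ => le_rfl, fun j i i' _ => le_rfl, ?_⟩, hlt, ?_, ?_, ?_⟩
  · exact fun j _ => ⟨hα0 j, (hlt j).trans (hβ1 j)⟩
  · exact fun j _ => ⟨(hα0 j).trans (hlt j).le, hβ1 j⟩
  · refine fun j => ⟨k j, ?_⟩
    simp only [constWeight, Finset.sum_const, Finset.card_univ, Fintype.card_fin, nsmul_eq_mul, hα,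
      hβ]
    field_simp
    ring
  · rw [hgap]
    exact ⟨ht', ht1⟩
  · rw [intervalJ, hgap, weightNorm_constWeight, weightNorm_constWeight, hA, hB]
    -- So `d` exceeds the left end of `J` by `2pq(1 - t) / (p + q)`. That this is less than `2 - t`,
    -- the length of `J`, is exactly the hypothesis `ht`.
    have e : (q : ℝ) * (((p + q) * a - p + p * t) / (p + q)) -
        p * (((p + q) * a - p - q * t) / (p + q)) =
        (q - p) * a + p - 2 * p * q * (1 - t) / (p + q) := by
      field_simp
      ring
    rw [e]
    push_cast
    constructor
    · have : 0 < 2 * p * q * (1 - t) / (p + q) := by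
        have : 0 < 1 - t := by linarith
        positivity
      linarith
    · have : 2 * p * q * (1 - t) / (p + q) < 2 - t := by
        rw [div_lt_iff₀ hpq]
        linarith
      linarith
  · rw [weightNorm_constWeight, weightNorm_constWeight, hA, hB]
    field_simp
    ring

/-- The largest gap compatible with `k j` is the minimum of `k j / q` and `(p + q - k j) / p`, which
agree at `k j = q`. Keeping all the `k j` on one side of `q` makes the total capacity linear in
their sum `N`. It is `N / q`, at least `1` since `a ≥ 1`, or `(s(p + q) - N) / p`, at least `1`
since `a ≤ s`. -/
theorem exists_isAdapted {s p q : ℕ} (hp : 0 < p) (hq : 0 < q) {a : ℤ}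
    (ha : (a : ℝ) ∈ Set.Icc ((s + p : ℝ) / (p + q)) (((p + q - 1) * s + p : ℝ) / (p + q))) :
    ∃ α β : Fin s → ℝ, IsAdapted p q a α β := by
  have hp' : (1 : ℝ) ≤ p := by exact_mod_cast hp
  have hq' : (1 : ℝ) ≤ q := by exact_mod_cast hq
  have hpq : (0 : ℝ) < p + q := by linarith
  have hlow : (s : ℤ) + p ≤ a * (p + q) := by
    have := ha.1
    rw [div_le_iff₀ hpq] at this
    exact_mod_cast this
  have hupp : a * (p + q) ≤ ((p : ℤ) + q - 1) * s + p := by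
    have := ha.2
    rw [le_div_iff₀ hpq] at this
    exact_mod_cast this
  have hp0 : (0 : ℤ) < p := by exact_mod_cast hp
  have hq0 : (0 : ℤ) < q := by exact_mod_cast hq
  have ha1 : 1 ≤ a := by
    by_contra! h
    nlinarith
  have has : a ≤ s := by
    by_contra! h
    nlinarith
  obtain ⟨N, hN⟩ : ∃ N : ℕ, (N : ℤ) = (p + q) * a - p :=
    ⟨((p + q) * a - p).toNat, Int.toNat_of_nonneg (by nlinarith)⟩
  have hNr : (N : ℝ) = (p + q) * a - p := by exact_mod_cast hN
  have ha1' : (1 : ℝ) ≤ a := by exact_mod_cast ha1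
  have has' : (a : ℝ) ≤ s := by exact_mod_cast has
  obtain ⟨t, ht0, ht1, ht, ht'⟩ : ∃ t : ℝ, 0 < t ∧ t < 1 ∧
      (2 * p * q - 2 * p - 2 * q : ℝ) < t * (2 * p * q - p - q) ∧
      (2 * p * q - 2 * p - 2 * q : ℝ) / (2 * p * q - p - q) < t := by
    -- The denominator vanishes only for `p = q = 1`, where division by zero gives the lower end
    -- `0`. Otherwise the lower end may be negative, hence the maximum with `0`.
    by_cases h : (0 : ℝ) < 2 * p * q - p - q
    · obtain ⟨t, h1, h2⟩ := exists_between (show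
        max 0 ((2 * p * q - 2 * p - 2 * q : ℝ) / (2 * p * q - p - q)) < 1 from
          max_lt one_pos (by rw [div_lt_one h]; linarith))
      have h3 := (le_max_right _ _).trans_lt h1
      exact ⟨t, (le_max_left _ _).trans_lt h1, h2, (div_lt_iff₀ h).1 h3, h3⟩
    · have h0 : (2 * p * q - p - q : ℝ) = 0 := by nlinarith
      refine ⟨1 / 2, by norm_num, by norm_num, ?_, ?_⟩
      · rw [h0]; linarith
      · rw [h0, div_zero]; norm_num
  by_cases hNq : N ≤ s * q
  · obtain ⟨k, hk, hk'⟩ := exists_bounded_sum_eq (lo := 1) hq s N (by zify; linarith) hNq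
    have hkr : ∀ j, (1 : ℝ) ≤ k j ∧ (k j : ℝ) ≤ q := fun j => by exact_mod_cast hk j
    refine isAdapted_of_bounds hp hq (k := k) (m := fun j => k j / q) (by rw [hk', hN])
      (fun j => div_pos (by linarith [hkr j]) (by linarith)) (fun j => ?_) (fun j => ?_) ?_ ht0 ht1 ht ht'
    · rw [mul_div_cancel₀ _ (by positivity)]
    · have : (k j : ℝ) / q ≤ 1 := div_le_one_of_le₀ (hkr j).2 (by positivity)
      nlinarith [(hkr j).2]
    · rw [← Finset.sum_div, le_div_iff₀ (by positivity), ← Nat.cast_sum, hk', hNr]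
      nlinarith
  · obtain ⟨k, hk, hk'⟩ := exists_bounded_sum_eq (lo := q) (hi := p + q - 1) (by lia) s N (by lia) (by
      zify [show 1 ≤ p + q by lia]; linarith)
    have hkr : ∀ j, (q : ℝ) ≤ k j ∧ (k j : ℝ) + 1 ≤ p + q := fun j => by
      have := hk j
      exact_mod_cast (show q ≤ k j ∧ k j + 1 ≤ p + q by lia)
    refine isAdapted_of_bounds hp hq (k := k) (m := fun j => (p + q - k j) / p) (by rw [hk', hN])
      (fun j => div_pos (by linarith [hkr j]) (by linarith)) (fun j => ?_) (fun j => ?_) ?_ ht0 ht1 ht ht'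
    · have : ((p : ℝ) + q - k j) / p ≤ 1 := div_le_one_of_le₀ (by linarith [hkr j]) (by positivity)
      nlinarith [(hkr j).1]
    · rw [mul_div_cancel₀ _ (by positivity)]
    · rw [← Finset.sum_div, le_div_iff₀ (by positivity), Finset.sum_sub_distrib, ← Nat.cast_sum, hk', hNr]
      simp only [Finset.sum_const, Finset.card_univ, Fintype.card_fin, nsmul_eq_mul]
      nlinarith

/-! ### The splitting types of `V` and `U`. -/

namespace ParabolicHiggs

open HolBundle

variable {s p q : ℕ} {pt : Fin s → RiemannSphere} {H : ParabolicHiggs.{u} p q pt}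
  {α β : Fin s → ℝ}

theorem exists_isIsomorphic_split (hq : 0 < q)
    (hβ : ∀ j, 0 ≤ β j) (hlt : ∀ j, α j < β j) (hgap : weightGap α β < 2) {d : ℤ}
    (hd : (d : ℝ) ∈ intervalJ p q α β)
    (h : H.RepresentsPointOfModuli (constWeight p α) (constWeight q β) d) :
    ∃ a : ℤ, 0 < a ∧ H.V.IsIsomorphic (HolBundle.split fun _ : Fin q => -a) := by
  obtain ⟨bU, dU, bV, dV, hU, hV, e1, e2, e3, e4⟩ := exists_splitting hlt hgap hd h
  rw [intervalJ, Set.mem_Ioo, weightNorm_constWeight, weightNorm_constWeight] at hd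
  have hgap0 : 0 ≤ weightGap α β := sub_nonneg.2 (Finset.sum_le_sum fun j _ => (hlt j).le)
  have hB : 0 ≤ ∑ j, β j := Finset.sum_nonneg fun j _ => hβ j
  let i₀ : Fin q := ⟨0, hq⟩
  -- The upper end of `J` amounts to `deg V + q|β| > -1 + ε / 2`.
  have heq := eq_of_nonpos_of_neg_one_lt_sum e3 (by linarith)
  have hdV : dV = fun _ => -(-dV i₀) := funext fun i => by rw [neg_neg]; exact heq i i₀
  refine ⟨-dV i₀, ?_, hdV ▸ hV.isIsomorphic_split⟩
  -- The lower end of `J` amounts to `deg V + q|β| < 0`, so `deg V` cannot be nonnegative.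
  by_contra! hneg
  have h0 : (0 : ℝ) ≤ dV i₀ := by exact_mod_cast (by lia : 0 ≤ dV i₀)
  have h1 : 0 ≤ ∑ i, (dV i : ℝ) := Finset.sum_nonneg fun i _ => by rw [heq i i₀]; exact h0
  have h2 : (0 : ℝ) ≤ q * ∑ j, β j := by positivity
  linarith

theorem isIsomorphic_split_of_isAdapted (hp : 0 < p) (hq : 0 < q) {a : ℤ}
    (had : IsAdapted p q a α β)
    (h : H.RepresentsPointOfModuli (constWeight p α) (constWeight q β) ((q - p) * a + p)) :
    H.U.IsIsomorphic (HolBundle.split fun _ : Fin p => -a + 1) ∧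
      H.V.IsIsomorphic (HolBundle.split fun _ : Fin q => -a) := by
  obtain ⟨-, hlt, hgap, hd, hn⟩ := had
  obtain ⟨bU, dU, bV, dV, hU, hV, e1, e2, e3, e4⟩ :=
    exists_splitting hlt (by linarith [hgap.2]) hd h
  rw [intervalJ, Set.mem_Ioo, weightNorm_constWeight, weightNorm_constWeight] at hd
  rw [weightNorm_constWeight, weightNorm_constWeight] at hn
  have hgap0 : 0 ≤ weightGap α β := sub_nonneg.2 (Finset.sum_le_sum fun j _ => (hlt j).le)
  have heq := eq_of_nonpos_of_neg_one_lt_sum e3 (by linarith)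
  push_cast at e2
  have hsV : ∑ i, (dV i : ℝ) = -(q * a) := by linarith
  have hsU : ∑ i, (dU i : ℝ) = p * (-a + 1) := by linarith
  have hdV : dV = fun _ => -a := by
    funext i
    have h1 : ∑ k, dV k = -(q * a) := by exact_mod_cast hsV
    rw [Finset.sum_congr rfl fun k _ => heq k i] at h1
    simp only [Finset.sum_const, Finset.card_univ, Fintype.card_fin, nsmul_eq_mul] at h1
    have hq0 : (q : ℤ) ≠ 0 := by exact_mod_cast hq.ne'
    exact mul_left_cancel₀ hq0 (by linarith)
  have hp' : (1 : ℝ) ≤ p := by exact_mod_cast hp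
  have hq' : (1 : ℝ) ≤ q := by exact_mod_cast hq
  have hle : ∀ i, dU i ≤ -a + 1 := by
    intro i
    by_contra! hlt'
    have h1 : (-a + 2 : ℝ) ≤ dU i := by exact_mod_cast (by lia : -a + 2 ≤ dU i)
    have hε : weightGap α β = ∑ j, β j - ∑ j, α j := rfl
    set ε := weightGap α β
    have h2 : (p + q) * ∑ j, α j = (p + q) * a - p - q * ε := by rw [hε]; linarith
    have h3 := e4 i
    rw [hsV] at h3
    -- Multiply `h5` by `p + q` and use `(p + q) (1 - a + |α|) = q (1 - ε)`, which is `h2`.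
    have h4 : (p : ℝ) + q ≤ (p - 1) * q * (1 - ε) := by
      have h5 : (1 : ℝ) ≤ (p - 1) * (1 - a) + (p - 1) * ∑ j, α j := by linarith
      nlinarith
    -- For `p = 1` the right side of `h4` is zero. Otherwise the lower bound on `ε` reads `(2pq - p
    -- - q)(1 - ε) < p + q`, and `(p - 1) q ≤ 2pq - p - q`.
    rcases hp'.eq_or_lt with h5 | h5
    · rw [← h5] at h4
      linarith
    · have h6 : (0 : ℝ) < 2 * p * q - p - q := by nlinarith
      have h7 := (div_lt_iff₀ h6).1 hgap.1
      have h8 : (p - 1) * q * (1 - ε) ≤ (2 * p * q - p - q) * (1 - ε) :=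
        mul_le_mul_of_nonneg_right (by nlinarith) (by linarith [hgap.2])
      linarith
  have hdU : dU = fun _ => -a + 1 := by
    have h1 : ∑ k, dU k = ∑ _k : Fin p, (-a + 1) := by
      simp only [Finset.sum_const, Finset.card_univ, Fintype.card_fin, nsmul_eq_mul]
      exact_mod_cast hsU
    funext i
    exact (Finset.sum_eq_sum_iff_of_le fun i _ => hle i).1 h1 i (Finset.mem_univ i)
  exact ⟨hdU ▸ hU.isIsomorphic_split, hdV ▸ hV.isIsomorphic_split⟩

end ParabolicHiggs

theorem lemmal {s p q : ℕ} (hp : 0 < p) (hq : 0 < q) (pt : Fin s → RiemannSphere)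
    (hpt : Function.Injective pt) :
    (∀ (α β : Fin s → ℝ) (d : ℤ),
      IsMultiweight (constWeight p α) (constWeight q β) → (∀ j, α j < β j) →
      weightGap α β < 2 → (d : ℝ) ∈ intervalJ p q α β →
      ∀ H : ParabolicHiggs.{u} p q pt,
        H.RepresentsPointOfModuli (constWeight p α) (constWeight q β) d →
        ∃ a : ℤ, 0 < a ∧ H.V.IsIsomorphic (HolBundle.split fun _ : Fin q => -a)) ∧
    (∀ a : ℤ,
      (a : ℝ) ∈ Set.Icc ((s + p : ℝ) / (p + q)) (((p + q - 1) * s + p : ℝ) / (p + q)) →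
      (∃ α β : Fin s → ℝ, IsAdapted p q a α β) ∧
      ∀ α β : Fin s → ℝ, IsAdapted p q a α β →
        ∀ H : ParabolicHiggs.{u} p q pt,
          H.RepresentsPointOfModuli (constWeight p α) (constWeight q β) ((q - p) * a + p) →
          H.U.IsIsomorphic (HolBundle.split fun _ : Fin p => -a + 1) ∧
          H.V.IsIsomorphic (HolBundle.split fun _ : Fin q => -a)) := by
  refine ⟨fun α β d hw hlt hgap hd H h => ?_, fun a ha =>
    ⟨exists_isAdapted hp hq ha, fun α β had H h =>
      ParabolicHiggs.isIsomorphic_split_of_isAdapted hp hq had h⟩⟩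
  exact ParabolicHiggs.exists_isIsomorphic_split hq (fun j => (hw.mem_right j ⟨0, hq⟩).1) hlt hgap hd h
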